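/- **Definitions.** Fix a unit vector $e\in\mathbb R^2$ and let $e^\perp$ be its rotation by a right angle; write $(x_1,x_2)$ for the coordinates of a point in the basis $(e,e^\perp)$. A *dyadic grid* is a collection of half-open intervals $[a,b)$ whose lengths are integer powers of $2$ and any two of which are disjoint or nested. A rectangle $R=I_R\times J_R$ (in these coordinates) has center $c(R)$. Given $K>0$ and constants $A=(A_{\alpha,\beta})_{\alpha,\beta\ge 0}$, Schwartz functions $\psi_R:\mathbb R^2\to\mathbb C$ $(R\in\mathcal R)$ are *product wave packets adapted to* $\mathcal R$ with constants $K,A$ if for every $R\in\mathcal R$, all integers $\alpha,\beta\ge0$ and all $x$, $$|\partial_{x_1}^\alpha\partial_{x_2}^\beta\psi_R(x)|\le \frac{A_{\alpha,\beta}}{|I_R|^{\alpha+\frac12}|J_R|^{\beta+\frac12}}\Big(1+\frac{|x_1-c(R)_1|}{|I_R|}+\frac{|x_2-c(R)_2|}{|J_R|}\Big)^{-K},$$ and the integral of $\psi_R$ along every line parallel to $e$ or to $e^\perp$ is $0$. For coefficients $B=\{b_R\}_{R\in\mathcal R}\subset\mathbb C$ put $$\mathrm{sh}(\mathcal R)=\bigcup_{R\in\mathcal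 R}R,\qquad \mathrm{size}(B)=\sup_{\mathcal R'\subset\mathcal R}\Big(\frac1{|\mathrm{sh}(\mathcal R')|}\sum_{R\in\mathcal R'}|b_R|^2\Big)^{1/2},\qquad \mathsf B_{\mathcal R}=\sum_{R\in\mathcal R}b_R\psi_R ,$$ where the empty subcollection contributes $0$ to the supremum. **Proposition (product John–Nirenberg inequality).** There is an absolute constant $K_0$ such that for every $K\ge K_0$ and every $A=(A_{\alpha,\beta})$ there are constants $C,c>0$, depending only on $K$ and $A$, with the following property. Let $e$ be a unit vector, let $\mathcal R$ be a (finite or infinite) collection of rectangles with orientation $(e,e^\perp)$ such that $\{I_R:R\in\mathcal R\}$ and $\{J_R:R\in\mathcal R\}$ are each contained in a dyadic grid, let $\{\psi_R\}_{R\in\mathcal R}$ be product wave packets adapted to $\mathcal R$ with constants $K,A$, and let $B=\{b_R\}_{R\in\mathcal R}$ be complex coefficients. Assume $|\mathrm{sh}(\mathcal R)|<\infty$ and $\mathrm{size}(B)<\infty$. Then the series $\mathsf B_{\mathcal R}=\sum_{R\in\mathcal R}b_R\psi_R$ converges unconditionally in $L^p(\mathbb R^2)$ for every $2\le p<\infty$,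 with the same sum (up to null sets) for all $p$, and $$\|\mathsf B_{\mathcal R}\|_p\le C\,p^2\,\mathrm{size}(B)\,|\mathrm{sh}(\mathcal R)|^{1/p},\qquad 2\le p<\infty .$$ If in addition $\operatorname{supp}\psi_R\subset \overline R$ for every $R\in\mathcal R$, then for every $\lambda>0$ $$\big|\{x\in\mathrm{sh}(\mathcal R):|\mathsf B_{\mathcal R}(x)|>\lambda\}\big|\le C\exp\Big(-c\sqrt{\lambda/\mathrm{size}(B)}\Big)\,|\mathrm{sh}(\mathcal R)|$$ (when $\mathrm{size}(B)=0$ the function $\mathsf B_{\mathcal R}$ vanishes and the exponential factor is read as $1$). -/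

import Mathlib

open MeasureTheory Filter Topology
open scoped ENNReal SchwartzMap

noncomputable section

namespace ProductJN

/-- The Euclidean plane. -/
abbrev Plane : Type := EuclideanSpace ℝ (Fin 2)

/-- The vector `e` rotated by a right angle, so that `(e, perp e)` is an orientation
when `e` is a unit vector. -/
def perp (e : Plane) : Plane := !₂[-(e 1), e 0]

/-- A bounded nondegenerate half-open interval `[left, right)`. -/
@[ext]
structure HalfOpenInterval where
  left : ℝ
  right : ℝ
  left_lt_right : left < right

namespace HalfOpenInterval

def toSet (I : HalfOpenInterval) : Set ℝ := Set.Ico I.left I.right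

def length (I : HalfOpenInterval) : ℝ := I.right - I.left

def center (I : HalfOpenInterval) : ℝ := (I.left + I.right) / 2

end HalfOpenInterval

/-- A one-dimensional grid: any two intervals are disjoint or nested. -/
def IsGrid (G : Set HalfOpenInterval) : Prop :=
  ∀ I ∈ G, ∀ I' ∈ G,
    I.toSet ∩ I'.toSet = ∅ ∨ I.toSet ∩ I'.toSet = I.toSet ∨ I.toSet ∩ I'.toSet = I'.toSet

/-- A dyadic grid: a grid all of whose intervals have length a power of two. -/
def IsDyadicGrid (G : Set HalfOpenInterval) : Prop :=
  IsGrid G ∧ ∀ I ∈ G, ∃ j : ℤ, I.length = (2 : ℝ) ^ j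

/-- A rectangle `I × J`, described by its two sides in the coordinates of an orientation. -/
@[ext]
structure Rect where
  I : HalfOpenInterval
  J : HalfOpenInterval

/-- The subset of the plane occupied by the rectangle `R = I × J` with orientation `(e, perp e)`. -/
def Rect.toSet (e : Plane) (R : Rect) : Set Plane :=
  {x | inner ℝ e x ∈ R.I.toSet ∧ inner ℝ (perp e) x ∈ R.J.toSet}

/-- The shadow of a collection of rectangles with orientation `(e, perp e)`: their union. -/
def shadow (e : Plane) (𝓡 : Set Rect) : Set Plane := ⋃ R ∈ 𝓡, R.toSet e

/-- The mixed partial derivative `∂₁^α ∂₂^β ψ` at the point with coordinates `(x₁, x₂)`,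
in the coordinates of the orientation `(e, perp e)`. -/
def mixedDeriv (e : Plane) (α β : ℕ) (ψ : Plane → ℂ) (x₁ x₂ : ℝ) : ℂ :=
  iteratedDeriv α (fun s : ℝ => iteratedDeriv β (fun t : ℝ => ψ (s • e + t • perp e)) x₂) x₁

/-- `ψ` is `L²`-adapted to the rectangle `R` with orientation `(e, perp e)`,
with decay exponent `K` and constants `A α β`. -/
def IsAdapted (e : Plane) (K : ℝ) (A : ℕ → ℕ → ℝ) (R : Rect) (ψ : 𝓢(Plane, ℂ)) : Prop :=
  ∀ (α β : ℕ) (x₁ x₂ : ℝ),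
    ‖mixedDeriv e α β ψ x₁ x₂‖ ≤
      A α β / (R.I.length ^ ((α : ℝ) + 1 / 2) * R.J.length ^ ((β : ℝ) + 1 / 2)) *
        (1 + |x₁ - R.I.center| / R.I.length + |x₂ - R.J.center| / R.J.length) ^ (-K)

/-- The integrals of `ψ` along all lines parallel to `e` or to `perp e` vanish. -/
def HasProductMeanZero (e : Plane) (ψ : 𝓢(Plane, ℂ)) : Prop :=
  ∀ x : Plane, (∫ t : ℝ, ψ (x + t • e)) = 0 ∧ (∫ t : ℝ, ψ (x + t • perp e)) = 0

/-- `(ψ R)`, for `R ∈ 𝓡`, are product wave packets adapted to `𝓡`, uniformly with the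
adaptation constants `K` and `A α β`. -/
def AreProductWavePackets (e : Plane) (K : ℝ) (A : ℕ → ℕ → ℝ) (𝓡 : Set Rect)
    (ψ : Rect → 𝓢(Plane, ℂ)) : Prop :=
  ∀ R ∈ 𝓡, IsAdapted e K A R (ψ R) ∧ HasProductMeanZero e (ψ R)

/-- The size of the coefficients `(b R)`, for `R ∈ 𝓡`: the supremum over all subcollections `𝓡'`
of `(|sh 𝓡'|⁻¹ ∑_{R ∈ 𝓡'} |b R|²)^{1/2}` (the empty subcollection contributes `0`). -/
def size (e : Plane) (𝓡 : Set Rect) (b : Rect → ℂ) : ℝ≥0∞ :=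
  ⨆ (𝓡' : Set Rect) (_ : 𝓡' ⊆ 𝓡),
    ((∑' R : 𝓡', ‖b R‖ₑ ^ 2) / volume (shadow e 𝓡')) ^ (1 / 2 : ℝ)

/-- `f` is the sum in `L^p` of the unconditionally convergent series `∑_{R ∈ 𝓡} b R • ψ R`.
For a finite collection this says that `f` is the finite sum, almost everywhere. -/
def IsLpSum (p : ℝ≥0∞) (𝓡 : Set Rect) (b : Rect → ℂ) (ψ : Rect → 𝓢(Plane, ℂ))
    (f : Plane → ℂ) : Prop :=
  MemLp f p volume ∧
    Tendsto (fun F : Finset 𝓡 => eLpNorm (fun x => f x - ∑ R ∈ F, b R * ψ R x) p volume)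
      atTop (𝓝 0)

end ProductJN

end

/-!
The growth `p²` of the `L^p` norms comes from a weighted `L²` estimate with a polynomial dependence
on the weight, and no interpolation or atomic theory of product spaces enters.

*Weighted estimate on the line.* Let `w` satisfy the `A₁` condition with constant `Q`. Then
`∫ |g|² w` is at most `38 Q` times the sum over dyadic intervals `I` of `|⟨g, h_I⟩|²` times the
average of `w` over `I` (`lintegral_sq_mul_le_haar`). This is a Bellman function argument: along
the dyadic filtration one follows the energy `∑ |I| |⟨g⟩_I|² pot(⟨w⟩_I, m_I)`, where `m_I` is the
largest average of `w` over the dyadic ancestors of `I`. The potential `pot` is comparable to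
`⟨w⟩_I` and has a quadratic concavity gain of order `1 / Q`, which absorbs the cross terms
(`pot_step`).

*Wave packets.* The matrix of Haar coefficients of wave packets decays away from the diagonal in
scale and in space (`IsPacket.norm_haarCoeff_le`). Its columns over a dyadic grid are summable
(`sum_haarKernel_le`), and its rows, integrated against an `A₁` weight, reproduce the weight up to
the factor `Q` (`IsA1.tsum_haarKernel_le`). Schur's test, applied in each variable in turn, gives for
a weight `W` on the plane that is in `A₁` with constant `Q` in each variable
`∫ |∑ b_R ψ_R|² W ≤ C Q⁴ ∑ |b_R|² inf_R W` (`lintegral_sq_mul_le_sum_rectInf`).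

*Carleson embedding.* By the definition of the size, applied to the rectangles with
`inf_R W > t` and integrated in `t`, the right-hand side is at most
`C Q⁴ size² ∫_{sh} W` (`sum_rectInf_le`).

*Duality.* For a finite sum `B` and `p > 2`, the weight is the Rubio de Francia majorant `rdf` of
`|B|^(p-2)`: it is pointwise at least `|B|^(p-2)`, its `L^q` norm with `q = p / (p - 2)` is at most
twice as large, and its `A₁` constants are of order `p`, because the maximal function on `L^q` has
norm of order `q / (q - 1) = p / 2`. Hölder's inequality then gives
`‖B‖_p² ≤ C p⁴ size² |sh|^(2/p)` (`IsPacketSystem.lintegral_rpow_le_of_two_lt`).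

Infinite sums converge in `L²` by almost orthogonality, and in `L^p` by interpolating the smallness
of the tails in `L²` with their boundedness in `L^(2p-2)` (`IsPacketSystem.exists_tail_bound`). The
exponential estimate is Chebyshev's inequality with the best exponent
(`measure_lt_le_of_eLpNorm_le`).
-/

noncomputable section

namespace ProductJN

/-! ### A concave potential on dyadic averages -/

/-- The potential `w - s m - s w log (w / m)`, where `w` is the average of a weight over a dyadic
interval, `m` is the largest average over its dyadic ancestors, and `s` is a small parameter.
At `w = m` it is stationary in `m`, and it is uniformly concave in `w` for `w ≤ m`. -/
def pot (s w m : ℝ) : ℝ := w - s * m - s * w * Real.log (w / m)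

theorem sq_le_mul_log {z : ℝ} (h0 : 0 < z) (h1 : z ≤ 1) :
    (z - 1) + (z - 1) ^ 2 / 2 ≤ z * Real.log z := by
  have hd : ∀ x ∈ Set.Icc z 1, HasDerivAt (fun x : ℝ => x * Real.log x - (x - 1) - (x - 1) ^ 2 / 2)
      (Real.log x - (x - 1)) x := by
    intro x hx
    have hx0 : x ≠ 0 := (h0.trans_le hx.1).ne'
    have h := (((hasDerivAt_id' x).mul (Real.hasDerivAt_log hx0)).sub
      ((hasDerivAt_id' x).sub_const 1)).sub ((((hasDerivAt_id' x).sub_const 1).pow 2).div_const 2)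
    refine h.congr_deriv ?_
    field_simp
    simp
    ring
  have hanti : AntitoneOn (fun x : ℝ => x * Real.log x - (x - 1) - (x - 1) ^ 2 / 2)
      (Set.Icc z 1) := by
    refine antitoneOn_of_deriv_nonpos (convex_Icc z 1)
      (fun x hx => (hd x hx).continuousAt.continuousWithinAt)
      (fun x hx => (hd x (interior_subset hx)).differentiableAt.differentiableWithinAt) ?_
    intro x hx
    have hx' := interior_subset hx
    rw [(hd x hx').deriv]
    linarith [Real.log_le_sub_one_of_pos (h0.trans_le hx'.1)]
  have := hanti (Set.left_mem_Icc.2 h1) (Set.right_mem_Icc.2 h1) h1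
  simp at this
  linarith

theorem pot_le {s w m : ℝ} (hs : 0 ≤ s) (hw : 0 < w) (hm : w ≤ m) : pot s w m ≤ w := by
  have hm0 : 0 < m := hw.trans_le hm
  have h : Real.log (m / w) ≤ m / w - 1 := Real.log_le_sub_one_of_pos (by positivity)
  have h2 : Real.log (w / m) = - Real.log (m / w) := by rw [← Real.log_inv, inv_div]
  have h3 : w * Real.log (m / w) ≤ m - w := by
    calc _ ≤ w * (m / w - 1) := by gcongr
      _ = m - w := by field_simp
  unfold pot
  rw [h2]
  nlinarith

theorem le_pot {s w m Q : ℝ} (hQ : 1 ≤ Q) (hs : s = 1 / (2 * Q)) (hw : 0 < w) (hm : w ≤ m)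
    (hmQ : m ≤ Q * w) : w / 2 ≤ pot s w m := by
  have hm0 : 0 < m := hw.trans_le hm
  have h : Real.log (w / m) ≤ 0 := Real.log_nonpos (by positivity) (div_le_one_of_le₀ hm hm0.le)
  have h1 : s * m ≤ w / 2 := by
    rw [hs, div_mul_eq_mul_div, div_le_iff₀ (by positivity)]; linarith
  have h2 : 0 ≤ s := by rw [hs]; positivity
  unfold pot
  nlinarith [mul_nonneg (mul_nonneg h2 hw.le) (neg_nonneg.2 h)]

/-- The potential with its running maximum lies below its tangents. -/
theorem pot_max_le_tangent {s v w m : ℝ} (hs : 0 ≤ s) (hv : 0 < v) (hvm : v ≤ m) (hw : 0 < w) :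
    pot s w (max m w) ≤ pot s v m + (1 - s - s * Real.log (v / m)) * (w - v) := by
  have hm0 : 0 < m := hv.trans_le hvm
  have key : m + w * Real.log (v / m) + w - v ≤ max m w + w * Real.log (w / max m w) := by
    rcases le_total w m with h | h
    · rw [max_eq_left h]
      have e : Real.log (w / m) = Real.log (v / m) + Real.log (w / v) := by
        rw [← Real.log_mul (by positivity) (by positivity)]; congr 1; field_simp
      have h1 : 1 - (w / v)⁻¹ ≤ Real.log (w / v) := Real.one_sub_inv_le_log_of_pos (by positivity)
      have h2 : w * (1 - (w / v)⁻¹) ≤ w * Real.log (w / v) := by gcongr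
      have h3 : w * (1 - (w / v)⁻¹) = w - v := by field_simp
      rw [e]; nlinarith
    · rw [max_eq_right h, div_self hw.ne', Real.log_one]
      have h1 : Real.log (v / m) ≤ v / m - 1 := Real.log_le_sub_one_of_pos (by positivity)
      have h1' : m * Real.log (v / m) ≤ v - m := by
        calc _ ≤ m * (v / m - 1) := by gcongr
          _ = _ := by field_simp
      have h2 : Real.log (v / m) ≤ 0 :=
        Real.log_nonpos (by positivity) (div_le_one_of_le₀ hvm hm0.le)
      nlinarith
  unfold pot
  nlinarith [mul_le_mul_of_nonneg_left key hs]

/-- For a smaller weight the tangent inequality has a quadratic gain. -/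
theorem pot_le_tangent_sub_sq {s v w m : ℝ} (hs : 0 ≤ s) (hv : 0 < v) (hvm : v ≤ m) (hw : 0 < w)
    (hwv : w ≤ v) :
    pot s w m ≤ pot s v m + (1 - s - s * Real.log (v / m)) * (w - v) -
      s / 2 * ((w - v) ^ 2 / v) := by
  have hm0 : 0 < m := hv.trans_le hvm
  have e : Real.log (w / m) = Real.log (v / m) + Real.log (w / v) := by
    rw [← Real.log_mul (by positivity) (by positivity)]; congr 1; field_simp
  have h1 := sq_le_mul_log (z := w / v) (by positivity) (div_le_one_of_le₀ hwv hv.le)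
  have h2 : (w - v) + (w - v) ^ 2 / v / 2 ≤ w * Real.log (w / v) := by
    have := mul_le_mul_of_nonneg_left h1 hv.le
    have e1 : v * ((w / v - 1) + (w / v - 1) ^ 2 / 2) = (w - v) + (w - v) ^ 2 / v / 2 := by
      field_simp
    have e2 : v * (w / v * Real.log (w / v)) = w * Real.log (w / v) := by field_simp
    linarith
  unfold pot
  rw [e]
  nlinarith [mul_le_mul_of_nonneg_left h2 hs]

/-- The potential is concave along the splitting of a dyadic interval, with a quadratic gain. -/
theorem pot_mean_le {s m w₁ w₂ : ℝ} (hs : 0 ≤ s) (h₁ : 0 < w₁) (h₂ : 0 < w₂)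
    (hm : (w₁ + w₂) / 2 ≤ m) :
    (pot s w₁ (max m w₁) + pot s w₂ (max m w₂)) / 2 ≤
      pot s ((w₁ + w₂) / 2) m - s / 4 * (((w₁ - w₂) / 2) ^ 2 / ((w₁ + w₂) / 2)) := by
  wlog h : w₁ ≤ w₂ generalizing w₁ w₂
  · have := this h₂ h₁ (by rwa [add_comm]) (le_of_not_ge h)
    rw [add_comm w₁ w₂, add_comm (pot _ _ _)]
    convert this using 4
    ring
  have hw : 0 < (w₁ + w₂) / 2 := by positivity
  have hm1 : max m w₁ = m := max_eq_left (by linarith)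
  have a := pot_le_tangent_sub_sq hs hw hm h₁ (by linarith)
  have b := pot_max_le_tangent hs hw hm h₂
  rw [hm1]
  have e : (w₁ - (w₁ + w₂) / 2) ^ 2 = ((w₁ - w₂) / 2) ^ 2 := by ring
  rw [e] at a
  nlinarith

/-- The `A₁` condition makes the potential Lipschitz, uniformly in `Q`; this bounds the cross terms
in `pot_step`. -/
theorem abs_pot_sub_le {s m w₁ w₂ Q : ℝ} (hQ : 1 ≤ Q) (hs : s = 1 / (2 * Q)) (h₁ : 0 < w₁)
    (h₂ : 0 < w₂) (hm : (w₁ + w₂) / 2 ≤ m) (hm₁ : m ≤ Q * w₁) (hm₂ : m ≤ Q * w₂) :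
    |pot s w₁ (max m w₁) - pot s w₂ (max m w₂)| ≤ 3 / 2 * |w₁ - w₂| := by
  wlog h : w₁ ≤ w₂ generalizing w₁ w₂
  · rw [abs_sub_comm, abs_sub_comm w₁]
    exact this h₂ h₁ (by rwa [add_comm]) hm₂ hm₁ (le_of_not_ge h)
  have hs0 : 0 ≤ s := by rw [hs]; positivity
  have hs1 : s ≤ 1 / 2 := by
    rw [hs, div_le_div_iff₀ (by positivity) (by positivity)]; linarith
  have hm1 : w₁ ≤ m := by linarith
  have hm0 : 0 < m := h₁.trans_le hm1
  rw [max_eq_left hm1]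
  have hsQ : s * (Q - 1) ≤ 1 / 2 := by
    rw [hs]; rw [div_mul_eq_mul_div, div_le_iff₀ (by positivity)]; linarith
  have up := pot_max_le_tangent (s := s) hs0 h₁ hm1 h₂
  have hlog : - Real.log (w₁ / m) ≤ Q - 1 := by
    rw [← Real.log_inv, inv_div]
    have : Real.log (m / w₁) ≤ m / w₁ - 1 := Real.log_le_sub_one_of_pos (by positivity)
    have : m / w₁ ≤ Q := by rwa [div_le_iff₀ h₁]
    linarith
  have hslope : 1 - s - s * Real.log (w₁ / m) ≤ 3 / 2 := by
    nlinarith [mul_le_mul_of_nonneg_left hlog hs0]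
  have lo : pot s w₁ m ≤ pot s w₂ (max m w₂) := by
    rcases le_total w₂ m with h' | h'
    · rw [max_eq_left h']
      have := pot_max_le_tangent hs0 h₂ h' h₁
      rw [max_eq_left hm1] at this
      have hl : Real.log (w₂ / m) ≤ 0 :=
        Real.log_nonpos (by positivity) (div_le_one_of_le₀ h' hm0.le)
      have h3 : 0 ≤ 1 - s - s * Real.log (w₂ / m) := by nlinarith
      nlinarith [mul_nonneg h3 (sub_nonneg.2 h)]
    · rw [max_eq_right h']
      have := pot_max_le_tangent hs0 hm0 le_rfl h₁
      rw [max_eq_left hm1] at this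
      unfold pot at *
      rw [div_self h₂.ne']
      rw [div_self hm0.ne'] at this
      simp at *
      nlinarith
  rw [abs_sub_comm, abs_sub_comm w₁, abs_of_nonneg (sub_nonneg.2 lo), abs_of_nonneg (sub_nonneg.2 h)]
  nlinarith [mul_le_mul_of_nonneg_right hslope (sub_nonneg.2 h)]

/-- One step of the weighted Haar square function estimate: passing from a dyadic interval to its
two halves, the quantity `|f|² pot` grows at most by `19 Q |d|² w`, where `d` is the Haar
difference. -/
theorem pot_step {s m w₁ w₂ Q : ℝ} (f₁ f₂ : ℂ) (hQ : 1 ≤ Q) (hs : s = 1 / (2 * Q)) (h₁ : 0 < w₁)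
    (h₂ : 0 < w₂) (hm : (w₁ + w₂) / 2 ≤ m) (hm₁ : m ≤ Q * w₁) (hm₂ : m ≤ Q * w₂) :
    (‖f₁‖ ^ 2 * pot s w₁ (max m w₁) + ‖f₂‖ ^ 2 * pot s w₂ (max m w₂)) / 2 ≤
      ‖(f₁ + f₂) / 2‖ ^ 2 * pot s ((w₁ + w₂) / 2) m +
        19 * Q * (‖(f₁ - f₂) / 2‖ ^ 2 * ((w₁ + w₂) / 2)) := by
  obtain ⟨f, hf⟩ : ∃ f, f = (f₁ + f₂) / 2 := ⟨_, rfl⟩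
  obtain ⟨d, hd⟩ : ∃ d, d = (f₁ - f₂) / 2 := ⟨_, rfl⟩
  have e1 : f₁ = f + d := by rw [hf, hd]; ring
  have e2 : f₂ = f - d := by rw [hf, hd]; ring
  rw [← hf, ← hd, e1, e2, norm_add_sq_real, norm_sub_sq_real]
  have hs0 : 0 < s := by rw [hs]; positivity
  have hw : 0 < (w₁ + w₂) / 2 := by positivity
  have A := pot_mean_le hs0.le h₁ h₂ hm
  have B := abs_pot_sub_le hQ hs h₁ h₂ hm hm₁ hm₂
  have P1 := pot_le hs0.le h₁ (le_max_right m w₁)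
  have P2 := pot_le hs0.le h₂ (le_max_right m w₂)
  set G₁ := pot s w₁ (max m w₁)
  set G₂ := pot s w₂ (max m w₂)
  set G := pot s ((w₁ + w₂) / 2) m
  set w := (w₁ + w₂) / 2 with hwdef
  set δ := |w₁ - w₂| / 2 with hδ
  have hδ2 : ((w₁ - w₂) / 2) ^ 2 = δ ^ 2 := by rw [hδ, div_pow, div_pow, sq_abs]
  rw [hδ2] at A
  have hin : |inner ℝ f d| ≤ ‖f‖ * ‖d‖ := abs_real_inner_le_norm f d
  have cross : inner ℝ f d * (G₁ - G₂) ≤ 3 * (‖f‖ * ‖d‖) * δ := by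
    calc _ ≤ |inner ℝ f d * (G₁ - G₂)| := le_abs_self _
      _ = |inner ℝ f d| * |G₁ - G₂| := abs_mul _ _
      _ ≤ (‖f‖ * ‖d‖) * (3 / 2 * |w₁ - w₂|) := by gcongr
      _ = _ := by rw [hδ]; ring
  have am : 3 * (‖f‖ * ‖d‖) * δ ≤ s / 4 * (δ ^ 2 / w) * ‖f‖ ^ 2 + 18 * Q * (‖d‖ ^ 2 * w) := by
    have hr : 18 * Q = 9 / s := by rw [hs]; field_simp; ring
    rw [hr]
    have : s / 4 * (δ ^ 2 / w) * ‖f‖ ^ 2 + 9 / s * (‖d‖ ^ 2 * w) - 3 * (‖f‖ * ‖d‖) * δ =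
      (s * δ * ‖f‖ / 2 - 3 * ‖d‖ * w) ^ 2 / (s * w) := by field_simp; ring
    have h0 : 0 ≤ (s * δ * ‖f‖ / 2 - 3 * ‖d‖ * w) ^ 2 / (s * w) := by positivity
    linarith
  have c1 := mul_le_mul_of_nonneg_left A (sq_nonneg ‖f‖)
  have c2 : ‖d‖ ^ 2 * ((G₁ + G₂) / 2) ≤ ‖d‖ ^ 2 * w := by gcongr; linarith
  have c3 : ‖d‖ ^ 2 * w ≤ Q * (‖d‖ ^ 2 * w) := le_mul_of_one_le_left (by positivity) hQ
  nlinarith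

/-! ### Dyadic intervals and averages -/

/-- The standard dyadic interval of length `2 ^ (-n)` with left endpoint `k * 2 ^ (-n)`. -/
def dyadic (n k : ℤ) : Set ℝ := Set.Ico ((k : ℝ) * 2 ^ (-n)) (((k : ℝ) + 1) * 2 ^ (-n))

theorem measurableSet_dyadic (n k : ℤ) : MeasurableSet (dyadic n k) := measurableSet_Ico

theorem volume_dyadic (n k : ℤ) : volume (dyadic n k) = ENNReal.ofReal (2 ^ (-n)) := by
  rw [dyadic, Real.volume_Ico]; congr 1; ring

theorem mem_dyadic_iff {n k : ℤ} {x : ℝ} : x ∈ dyadic n k ↔ ⌊x * 2 ^ n⌋ = k := by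
  rw [Int.floor_eq_iff, dyadic, Set.mem_Ico, zpow_neg, ← div_eq_mul_inv, ← div_eq_mul_inv,
    div_le_iff₀ (by positivity), lt_div_iff₀ (by positivity)]

theorem mem_dyadic_floor (n : ℤ) (x : ℝ) : x ∈ dyadic n ⌊x * 2 ^ n⌋ := mem_dyadic_iff.2 rfl

theorem iUnion_dyadic (n : ℤ) : ⋃ k, dyadic n k = Set.univ :=
  Set.eq_univ_of_forall fun x => Set.mem_iUnion.2 ⟨_, mem_dyadic_floor n x⟩

theorem pairwise_disjoint_dyadic (n : ℤ) : Pairwise (Function.onFun Disjoint (dyadic n)) := by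
  intro k l hkl
  refine Set.disjoint_left.2 fun x hx hx' => hkl ?_
  rw [← mem_dyadic_iff.1 hx, ← mem_dyadic_iff.1 hx']

theorem dyadic_eq_union (n k : ℤ) :
    dyadic n k = dyadic (n + 1) (2 * k) ∪ dyadic (n + 1) (2 * k + 1) := by
  have h : (2 : ℝ) ^ (-n) = 2 * 2 ^ (-(n + 1)) := by
    rw [show -n = 1 + -(n + 1) by ring, zpow_add₀ (by norm_num)]; norm_num
  unfold dyadic
  rw [h, show ((2 * k : ℤ) : ℝ) = 2 * k by push_cast; ring,
    show ((2 * k + 1 : ℤ) : ℝ) = 2 * k + 1 by push_cast; ring]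
  have hp : (0 : ℝ) < 2 ^ (-(n + 1)) := by positivity
  rw [Set.Ico_union_Ico_eq_Ico (by nlinarith) (by nlinarith)]
  congr 1 <;> ring

theorem disjoint_dyadic_halves (n k : ℤ) :
    Disjoint (dyadic (n + 1) (2 * k)) (dyadic (n + 1) (2 * k + 1)) :=
  pairwise_disjoint_dyadic _ (by omega)

theorem dyadic_subset_parent (n k : ℤ) : dyadic (n + 1) k ⊆ dyadic n (k / 2) := by
  rw [dyadic_eq_union n]
  rcases Int.emod_two_eq_zero_or_one k with h | h
  · rw [show 2 * (k / 2) = k by omega]; exact Set.subset_union_left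
  · rw [show 2 * (k / 2) + 1 = k by omega]; exact Set.subset_union_right

theorem dyadic_subset_ancestor (n k : ℤ) (j : ℕ) : dyadic n k ⊆ dyadic (n - j) (k / 2 ^ j) := by
  induction j with
  | zero => simp
  | succ j ih =>
    refine ih.trans ?_
    have := dyadic_subset_parent (n - (j + 1 : ℕ)) (k / 2 ^ j)
    rwa [Int.ediv_ediv_of_nonneg (by positivity), ← pow_succ,
      show n - ((j + 1 : ℕ) : ℤ) + 1 = n - j by push_cast; ring] at this

theorem tsum_int_eq_tsum_pairs (F : ℤ → ℝ≥0∞) :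
    ∑' k, F k = ∑' k, (F (2 * k) + F (2 * k + 1)) := by
  rw [← (Int.divModEquiv 2).symm.tsum_eq, ENNReal.tsum_prod']
  refine tsum_congr fun k => ?_
  rw [tsum_fintype, Fin.sum_univ_two]
  simp [mul_comm]

theorem lintegral_eq_tsum_dyadic (F : ℝ → ℝ≥0∞) (n : ℤ) :
    ∫⁻ x, F x = ∑' k, ∫⁻ x in dyadic n k, F x := by
  rw [← lintegral_iUnion (measurableSet_dyadic n) (pairwise_disjoint_dyadic n), iUnion_dyadic,
    Measure.restrict_univ]

/-- The average of `g` over a dyadic interval. -/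
def dyAvg (g : ℝ → ℂ) (n k : ℤ) : ℂ := ((2 : ℝ) ^ n : ℝ) • ∫ x in dyadic n k, g x

/-- The average of a nonnegative weight over a dyadic interval. -/
def dyAvgW (w : ℝ → ℝ≥0∞) (n k : ℤ) : ℝ≥0∞ := ENNReal.ofReal (2 ^ n) * ∫⁻ x in dyadic n k, w x

/-- The integral of `g` against the Haar function of a dyadic interval, normalized to have the
values `1` and `-1` on the two halves. -/
def haarCoeff (g : ℝ → ℂ) (n k : ℤ) : ℂ :=
  (∫ x in dyadic (n + 1) (2 * k), g x) - ∫ x in dyadic (n + 1) (2 * k + 1), g x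

/-- The `A₁` condition with constant `Q`, on the line and without exceptional null sets: the mean
of `w` over an interval is at most `Q` times the value of `w` at any point of the interval. -/
def IsA1 (Q : ℝ) (w : ℝ → ℝ≥0∞) : Prop :=
  ∀ a b : ℝ, a < b → ∀ x ∈ Set.Icc a b, ∫⁻ y in Set.Icc a b, w y ≤ ENNReal.ofReal (Q * (b - a)) * w x

theorem two_zpow_succ (n : ℤ) : (2 : ℝ) ^ (n + 1) = 2 * 2 ^ n := by
  rw [zpow_add_one₀ (by norm_num), mul_comm]

theorem ofReal_two_zpow_mul_neg (n : ℤ) :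
    ENNReal.ofReal ((2 : ℝ) ^ n) * ENNReal.ofReal (2 ^ (-n)) = 1 := by
  rw [← ENNReal.ofReal_mul (by positivity), ← zpow_add₀ (by norm_num)]; simp

theorem dyAvg_eq_mean {g : ℝ → ℂ} (hg : Integrable g) (n k : ℤ) :
    dyAvg g n k = (dyAvg g (n + 1) (2 * k) + dyAvg g (n + 1) (2 * k + 1)) / 2 := by
  unfold dyAvg
  rw [dyadic_eq_union, setIntegral_union (disjoint_dyadic_halves n k) (measurableSet_dyadic _ _)
    hg.integrableOn hg.integrableOn, two_zpow_succ]
  simp only [Complex.real_smul]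
  push_cast
  ring

theorem dyAvg_sub_div_two (g : ℝ → ℂ) (n k : ℤ) :
    (dyAvg g (n + 1) (2 * k) - dyAvg g (n + 1) (2 * k + 1)) / 2 =
      ((2 : ℝ) ^ n : ℝ) • haarCoeff g n k := by
  unfold dyAvg haarCoeff
  rw [two_zpow_succ]
  simp only [Complex.real_smul]
  push_cast
  ring

theorem dyAvgW_eq_mean (w : ℝ → ℝ≥0∞) (n k : ℤ) :
    dyAvgW w n k = (dyAvgW w (n + 1) (2 * k) + dyAvgW w (n + 1) (2 * k + 1)) / 2 := by
  unfold dyAvgW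
  rw [dyadic_eq_union, lintegral_union (measurableSet_dyadic _ _) (disjoint_dyadic_halves n k),
    two_zpow_succ, ENNReal.ofReal_mul (by norm_num), ← mul_add, mul_assoc, div_eq_mul_inv,
    mul_comm (ENNReal.ofReal 2), mul_assoc]
  simp [ENNReal.mul_inv_cancel]

theorem dyAvgW_le {w : ℝ → ℝ≥0∞} {c : ℝ≥0∞} (hc : ∀ x, w x ≤ c) (n k : ℤ) : dyAvgW w n k ≤ c := by
  unfold dyAvgW
  calc _ ≤ ENNReal.ofReal (2 ^ n) * ∫⁻ x in dyadic n k, c := by gcongr; exact hc _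
    _ = c := by
      rw [setLIntegral_const, volume_dyadic, mul_left_comm, ofReal_two_zpow_mul_neg, mul_one]

theorem lintegral_dyadic_eq (w : ℝ → ℝ≥0∞) (n k : ℤ) :
    ∫⁻ x in dyadic n k, w x = ENNReal.ofReal (2 ^ (-n)) * dyAvgW w n k := by
  rw [dyAvgW, ← mul_assoc, mul_comm (ENNReal.ofReal (2 ^ (-n))), ofReal_two_zpow_mul_neg, one_mul]

theorem IsA1.dyAvgW_le_mul {Q : ℝ} {w : ℝ → ℝ≥0∞} (h : IsA1 Q w) (hQ : 0 ≤ Q) {n k : ℤ} {x : ℝ}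
    (hx : x ∈ dyadic n k) : dyAvgW w n k ≤ ENNReal.ofReal Q * w x := by
  have hp : (0 : ℝ) < 2 ^ (-n) := by positivity
  have := h ((k : ℝ) * 2 ^ (-n)) (((k : ℝ) + 1) * 2 ^ (-n)) (by nlinarith) x
    (Set.Ico_subset_Icc_self hx)
  rw [show ((k : ℝ) + 1) * 2 ^ (-n) - (k : ℝ) * 2 ^ (-n) = 2 ^ (-n) by ring,
    ENNReal.ofReal_mul hQ] at this
  calc dyAvgW w n k ≤ ENNReal.ofReal (2 ^ n) *
        (ENNReal.ofReal Q * ENNReal.ofReal (2 ^ (-n)) * w x) := by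
        unfold dyAvgW
        gcongr
        exact (lintegral_mono_set Set.Ico_subset_Icc_self).trans this
    _ = (ENNReal.ofReal (2 ^ n) * ENNReal.ofReal (2 ^ (-n))) * (ENNReal.ofReal Q * w x) := by ring
    _ = _ := by rw [ofReal_two_zpow_mul_neg, one_mul]

/-- Averages over ancestors are controlled by averages over descendants, for `A₁` weights. -/
theorem IsA1.dyAvgW_ancestor_le {Q : ℝ} {w : ℝ → ℝ≥0∞} (h : IsA1 Q w) (hQ : 0 ≤ Q) (n k : ℤ)
    (j : ℕ) : dyAvgW w (n - j) (k / 2 ^ j) ≤ ENNReal.ofReal Q * dyAvgW w n k := by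
  have h1 : ∫⁻ x in dyadic n k, dyAvgW w (n - j) (k / 2 ^ j) ≤
      ∫⁻ x in dyadic n k, ENNReal.ofReal Q * w x :=
    setLIntegral_mono' (measurableSet_dyadic n k) fun x hx =>
      h.dyAvgW_le_mul hQ (dyadic_subset_ancestor n k j hx)
  rw [setLIntegral_const, lintegral_const_mul' _ _ ENNReal.ofReal_ne_top, volume_dyadic] at h1
  calc dyAvgW w (n - j) (k / 2 ^ j) = ENNReal.ofReal (2 ^ n) *
        (dyAvgW w (n - j) (k / 2 ^ j) * ENNReal.ofReal (2 ^ (-n))) := by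
        rw [mul_left_comm, ofReal_two_zpow_mul_neg, mul_one]
    _ ≤ ENNReal.ofReal (2 ^ n) * (ENNReal.ofReal Q * ∫⁻ x in dyadic n k, w x) := by gcongr
    _ = _ := by rw [dyAvgW, mul_left_comm]

/-! ### The weighted Haar square function estimate on the line -/

/-- The largest average of a weight over the dyadic intervals containing a given one. -/
def ancSup (w : ℝ → ℝ≥0∞) (n k : ℤ) : ℝ := ⨆ j : ℕ, (dyAvgW w (n - j) (k / 2 ^ j)).toReal

theorem ancSup_spec {w : ℝ → ℝ≥0∞} {c : ℝ≥0∞} (hc : ∀ x, w x ≤ c) (hct : c ≠ ∞) (n k : ℤ) :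
    (dyAvgW w n k).toReal ≤ ancSup w n k ∧
      ancSup w (n + 1) k = max (ancSup w n (k / 2)) (dyAvgW w (n + 1) k).toReal := by
  have bdd : ∀ n k, BddAbove (Set.range fun j : ℕ => (dyAvgW w (n - j) (k / 2 ^ j)).toReal) :=
    fun n k => ⟨c.toReal, by
      rintro _ ⟨j, rfl⟩
      exact ENNReal.toReal_mono hct (dyAvgW_le hc _ _)⟩
  have h0 : ∀ n k, (dyAvgW w n k).toReal ≤ ancSup w n k := fun n k => by
    simpa [ancSup] using le_ciSup (bdd n k) 0
  have hshift : ∀ j : ℕ, dyAvgW w (n + 1 - (j + 1 : ℕ)) (k / 2 ^ (j + 1)) =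
      dyAvgW w (n - j) (k / 2 / 2 ^ j) := fun j => by
    rw [Int.ediv_ediv_of_nonneg (by norm_num), ← pow_succ']
    congr 1
    push_cast; ring
  refine ⟨h0 n k, le_antisymm (ciSup_le fun j => ?_) (max_le (ciSup_le fun j => ?_) (h0 _ _))⟩
  · rcases j with _ | j
    · simp
    · rw [hshift]
      exact (le_ciSup (bdd n (k / 2)) j).trans (le_max_left _ _)
  · rw [← hshift]
    exact le_ciSup (bdd (n + 1) k) (j + 1)

theorem IsA1.ancSup_le {Q : ℝ} {w : ℝ → ℝ≥0∞} (h : IsA1 Q w) (hQ : 0 ≤ Q) {c : ℝ≥0∞}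
    (hc : ∀ x, w x ≤ c) (hct : c ≠ ∞) (n k : ℤ) :
    ancSup w n k ≤ Q * (dyAvgW w n k).toReal := by
  refine ciSup_le fun j => ?_
  have := ENNReal.toReal_mono
    (ENNReal.mul_ne_top ENNReal.ofReal_ne_top (ne_top_of_le_ne_top hct (dyAvgW_le hc n k)))
    (h.dyAvgW_ancestor_le hQ n k j)
  rwa [ENNReal.toReal_mul, ENNReal.toReal_ofReal hQ] at this

theorem half_le_pot_and_pot_le {s w m Q : ℝ} (hQ : 1 ≤ Q) (hs : s = 1 / (2 * Q)) (hw : 0 ≤ w)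
    (hm : w ≤ m) (hmQ : m ≤ Q * w) : w / 2 ≤ pot s w m ∧ pot s w m ≤ w := by
  rcases hw.eq_or_lt with h | h
  · have : m = 0 := le_antisymm (by simpa [← h] using hmQ) (h ▸ hm)
    simp [← h, this, pot]
  · exact ⟨le_pot hQ hs h hm hmQ, pot_le (by rw [hs]; positivity) h hm⟩

theorem pot_step' {s m w₁ w₂ Q : ℝ} (f₁ f₂ : ℂ) (hQ : 1 ≤ Q) (hs : s = 1 / (2 * Q)) (h₁ : 0 ≤ w₁)
    (h₂ : 0 ≤ w₂) (hm : (w₁ + w₂) / 2 ≤ m) (hm₁ : m ≤ Q * w₁) (hm₂ : m ≤ Q * w₂) :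
    (‖f₁‖ ^ 2 * pot s w₁ (max m w₁) + ‖f₂‖ ^ 2 * pot s w₂ (max m w₂)) / 2 ≤
      ‖(f₁ + f₂) / 2‖ ^ 2 * pot s ((w₁ + w₂) / 2) m +
        19 * Q * (‖(f₁ - f₂) / 2‖ ^ 2 * ((w₁ + w₂) / 2)) := by
  rcases h₁.eq_or_lt with h | h
  · have hm0 : m ≤ 0 := by simpa [← h] using hm₁
    have e2 : w₂ = 0 := by linarith
    have e : m = 0 := by linarith
    simp [← h, e2, e, pot]
  rcases h₂.eq_or_lt with h' | h'
  · have hm0 : m ≤ 0 := by simpa [← h'] using hm₂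
    linarith
  exact pot_step f₁ f₂ hQ hs h h' hm hm₁ hm₂

/-- The potential energy of `g` at the scale `2 ^ (-n)`. -/
def energy (s : ℝ) (g : ℝ → ℂ) (w : ℝ → ℝ≥0∞) (n : ℤ) : ℝ≥0∞ :=
  ∑' k, ENNReal.ofReal
    (2 ^ (-n) * (‖dyAvg g n k‖ ^ 2 * pot s (dyAvgW w n k).toReal (ancSup w n k)))

/-- The part of the weighted Haar square function coming from the scale `2 ^ (-n)`. -/
def haarLevel (g : ℝ → ℂ) (w : ℝ → ℝ≥0∞) (n : ℤ) : ℝ≥0∞ :=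
  ∑' k, ENNReal.ofReal (2 ^ n) * ‖haarCoeff g n k‖ₑ ^ 2 * dyAvgW w n k

theorem ofReal_mul_norm_sq_mul {c : ℝ≥0∞} (hc : c ≠ ∞) (a : ℝ) (ha : 0 ≤ a) (z : ℂ) :
    ENNReal.ofReal (a * (‖z‖ ^ 2 * c.toReal)) = ENNReal.ofReal a * ‖z‖ₑ ^ 2 * c := by
  rw [ENNReal.ofReal_mul ha, ENNReal.ofReal_mul (by positivity), ENNReal.ofReal_toReal hc,
    ENNReal.ofReal_pow (norm_nonneg _), ofReal_norm, mul_assoc]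

theorem energy_succ_le {g : ℝ → ℂ} (hg : Integrable g) {w : ℝ → ℝ≥0∞} {c : ℝ≥0∞}
    (hc : ∀ x, w x ≤ c) (hct : c ≠ ∞) {Q : ℝ} (hQ : 1 ≤ Q) (hw : IsA1 Q w) (n : ℤ) :
    energy (1 / (2 * Q)) g w (n + 1) ≤
      energy (1 / (2 * Q)) g w n + ENNReal.ofReal (19 * Q) * haarLevel g w n := by
  have hQ0 : 0 ≤ Q := by linarith
  have fin : ∀ n k, dyAvgW w n k ≠ ∞ := fun n k => ne_top_of_le_ne_top hct (dyAvgW_le hc n k)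
  have avg : ∀ k, (dyAvgW w n k).toReal =
      ((dyAvgW w (n + 1) (2 * k)).toReal + (dyAvgW w (n + 1) (2 * k + 1)).toReal) / 2 := fun k => by
    rw [dyAvgW_eq_mean, ENNReal.toReal_div, ENNReal.toReal_add (fin _ _) (fin _ _)]; simp
  unfold energy haarLevel
  rw [tsum_int_eq_tsum_pairs, ← ENNReal.tsum_mul_left, ← ENNReal.tsum_add]
  refine ENNReal.tsum_le_tsum fun k => ?_
  have a1 := (ancSup_spec hc hct n (2 * k)).2
  have a2 := (ancSup_spec hc hct n (2 * k + 1)).2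
  rw [show 2 * k / 2 = k by omega] at a1
  rw [show (2 * k + 1) / 2 = k by omega] at a2
  have m0 := (ancSup_spec hc hct n k).1
  have l1 := hw.ancSup_le hQ0 hc hct (n + 1) (2 * k)
  have l2 := hw.ancSup_le hQ0 hc hct (n + 1) (2 * k + 1)
  have m1 : ancSup w n k ≤ ancSup w (n + 1) (2 * k) := a1 ▸ le_max_left _ _
  have m2 : ancSup w n k ≤ ancSup w (n + 1) (2 * k + 1) := a2 ▸ le_max_left _ _
  have p1 := (half_le_pot_and_pot_le hQ rfl ENNReal.toReal_nonneg
    (ancSup_spec hc hct (n + 1) (2 * k)).1 l1).1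
  have p2 := (half_le_pot_and_pot_le hQ rfl ENNReal.toReal_nonneg
    (ancSup_spec hc hct (n + 1) (2 * k + 1)).1 l2).1
  have p0 := (half_le_pot_and_pot_le hQ rfl ENNReal.toReal_nonneg m0 (hw.ancSup_le hQ0 hc hct n k)).1
  have t1 : 0 ≤ (dyAvgW w (n + 1) (2 * k)).toReal := ENNReal.toReal_nonneg
  have t2 : 0 ≤ (dyAvgW w (n + 1) (2 * k + 1)).toReal := ENNReal.toReal_nonneg
  have t0 : 0 ≤ (dyAvgW w n k).toReal := ENNReal.toReal_nonneg
  have step := pot_step' (dyAvg g (n + 1) (2 * k)) (dyAvg g (n + 1) (2 * k + 1)) hQ rfl t1 t2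
    (avg k ▸ m0) (m1.trans l1) (m2.trans l2)
  rw [← a1, ← a2, ← avg, ← dyAvg_eq_mean hg, dyAvg_sub_div_two, norm_smul, Real.norm_of_nonneg
    (by positivity : (0 : ℝ) ≤ 2 ^ n)] at step
  have q1 := (div_nonneg t1 zero_le_two).trans p1
  have q2 := (div_nonneg t2 zero_le_two).trans p2
  have q0 := (div_nonneg t0 zero_le_two).trans p0
  have h2 : (0 : ℝ) < 2 ^ (-(n + 1)) := by positivity
  have e2 : (2 : ℝ) ^ (-n) = 2 * 2 ^ (-(n + 1)) := by
    rw [← two_zpow_succ]; congr 1; ring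
  have e3 : (2 : ℝ) ^ (-n) * (2 ^ n) ^ 2 = 2 ^ n := by
    rw [sq, ← mul_assoc, ← zpow_add₀ (by norm_num)]; simp
  rw [← ofReal_mul_norm_sq_mul (fin n k) _ (by positivity),
    ← ENNReal.ofReal_add (mul_nonneg h2.le (mul_nonneg (sq_nonneg _) q1))
      (mul_nonneg h2.le (mul_nonneg (sq_nonneg _) q2)), ← ENNReal.ofReal_mul (by positivity),
    ← ENNReal.ofReal_add (mul_nonneg (by positivity) (mul_nonneg (sq_nonneg _) q0))
      (by positivity)]
  refine ENNReal.ofReal_le_ofReal ?_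
  calc _ = 2 ^ (-n) * ((‖dyAvg g (n + 1) (2 * k)‖ ^ 2 *
          pot (1 / (2 * Q)) (dyAvgW w (n + 1) (2 * k)).toReal (ancSup w (n + 1) (2 * k)) +
        ‖dyAvg g (n + 1) (2 * k + 1)‖ ^ 2 * pot (1 / (2 * Q)) (dyAvgW w (n + 1) (2 * k + 1)).toReal
          (ancSup w (n + 1) (2 * k + 1))) / 2) := by rw [e2]; ring
    _ ≤ _ := mul_le_mul_of_nonneg_left step (by positivity)
    _ = 2 ^ (-n) * (‖dyAvg g n k‖ ^ 2 * pot (1 / (2 * Q)) (dyAvgW w n k).toReal (ancSup w n k)) +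
      19 * Q * ((2 ^ (-n) * (2 ^ n) ^ 2) * (‖haarCoeff g n k‖ ^ 2 * (dyAvgW w n k).toReal)) := by
        ring
    _ = _ := by rw [e3]

theorem lintegral_dyAvg_eq (g : ℝ → ℂ) (w : ℝ → ℝ≥0∞) (n : ℤ) :
    ∫⁻ x, ‖dyAvg g n ⌊x * 2 ^ n⌋‖ₑ ^ 2 * w x =
      ∑' k, ‖dyAvg g n k‖ₑ ^ 2 * (ENNReal.ofReal (2 ^ (-n)) * dyAvgW w n k) := by
  rw [lintegral_eq_tsum_dyadic _ n]
  refine tsum_congr fun k => ?_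
  rw [← lintegral_dyadic_eq, ← lintegral_const_mul' _ _ (by simp)]
  refine setLIntegral_congr_fun (measurableSet_dyadic n k) fun x hx => ?_
  simp only [mem_dyadic_iff.1 hx]

theorem energy_bounds (g : ℝ → ℂ) {w : ℝ → ℝ≥0∞} {c : ℝ≥0∞} (hc : ∀ x, w x ≤ c) (hct : c ≠ ∞)
    {Q : ℝ} (hQ : 1 ≤ Q) (hw : IsA1 Q w) (n : ℤ) :
    (∫⁻ x, ‖dyAvg g n ⌊x * 2 ^ n⌋‖ₑ ^ 2 * w x) ≤ 2 * energy (1 / (2 * Q)) g w n ∧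
    energy (1 / (2 * Q)) g w n ≤ ∫⁻ x, ‖dyAvg g n ⌊x * 2 ^ n⌋‖ₑ ^ 2 * w x := by
  have fin : ∀ n k, dyAvgW w n k ≠ ∞ := fun n k => ne_top_of_le_ne_top hct (dyAvgW_le hc n k)
  have key : ∀ k, ‖dyAvg g n k‖ₑ ^ 2 * (ENNReal.ofReal (2 ^ (-n)) * dyAvgW w n k) =
      ENNReal.ofReal (2 ^ (-n) * (‖dyAvg g n k‖ ^ 2 * (dyAvgW w n k).toReal)) := fun k => by
    rw [ofReal_mul_norm_sq_mul (fin n k) _ (by positivity)]; ring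
  have hp := fun k => half_le_pot_and_pot_le hQ rfl ENNReal.toReal_nonneg
    (ancSup_spec hc hct n k).1 (hw.ancSup_le (by linarith) hc hct n k)
  rw [lintegral_dyAvg_eq]
  unfold energy
  constructor
  · rw [← ENNReal.tsum_mul_left]
    refine ENNReal.tsum_le_tsum fun k => ?_
    rw [key, ← ENNReal.ofReal_ofNat 2, ← ENNReal.ofReal_mul (by norm_num)]
    refine ENNReal.ofReal_le_ofReal ?_
    have := mul_le_mul_of_nonneg_left (hp k).1 (by positivity : 0 ≤ (2 : ℝ) ^ (-n) * ‖dyAvg g n k‖ ^ 2)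
    nlinarith
  · refine ENNReal.tsum_le_tsum fun k => ?_
    rw [key]
    refine ENNReal.ofReal_le_ofReal ?_
    have := (hp k).2
    gcongr

theorem lintegral_dyAvg_le_haar_add {g : ℝ → ℂ} (hg : Integrable g) {w : ℝ → ℝ≥0∞} {c : ℝ≥0∞}
    (hc : ∀ x, w x ≤ c) (hct : c ≠ ∞) {Q : ℝ} (hQ : 1 ≤ Q) (hw : IsA1 Q w) (n : ℤ) (N : ℕ) :
    (∫⁻ x, ‖dyAvg g (n + N) ⌊x * 2 ^ (n + N)⌋‖ₑ ^ 2 * w x) ≤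
      ENNReal.ofReal (38 * Q) * ∑' n, haarLevel g w n +
        2 * ∫⁻ x, ‖dyAvg g n ⌊x * 2 ^ n⌋‖ₑ ^ 2 * w x := by
  have ind : energy (1 / (2 * Q)) g w (n + N) ≤ energy (1 / (2 * Q)) g w n +
      ENNReal.ofReal (19 * Q) * ∑ i ∈ Finset.range N, haarLevel g w (n + i) := by
    induction N with
    | zero => simp
    | succ N ih =>
      push_cast
      rw [← add_assoc]
      refine (energy_succ_le hg hc hct hQ hw _).trans ?_
      rw [Finset.sum_range_succ, mul_add, ← add_assoc]
      gcongr
  have hsum : ∑ i ∈ Finset.range N, haarLevel g w (n + i) ≤ ∑' n, haarLevel g w n := by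
    have hinj : Function.Injective (fun i : ℕ => n + (i : ℤ)) := fun i j h => by simpa using h
    exact (ENNReal.sum_le_tsum _).trans
      (ENNReal.tsum_comp_le_tsum_of_injective hinj (haarLevel g w))
  have h2 : ENNReal.ofReal (38 * Q) = 2 * ENNReal.ofReal (19 * Q) := by
    rw [← ENNReal.ofReal_ofNat 2, ← ENNReal.ofReal_mul (by norm_num)]; congr 1; ring
  calc _ ≤ 2 * energy (1 / (2 * Q)) g w (n + N) := (energy_bounds g hc hct hQ hw _).1
    _ ≤ 2 * (energy (1 / (2 * Q)) g w n + ENNReal.ofReal (19 * Q) * ∑' n, haarLevel g w n) := by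
      gcongr; exact ind.trans (by gcongr)
    _ ≤ 2 * ((∫⁻ x, ‖dyAvg g n ⌊x * 2 ^ n⌋‖ₑ ^ 2 * w x) +
        ENNReal.ofReal (19 * Q) * ∑' n, haarLevel g w n) := by
      gcongr; exact (energy_bounds g hc hct hQ hw _).2
    _ = _ := by rw [h2]; ring

theorem enorm_dyAvg_le (g : ℝ → ℂ) (n k : ℤ) :
    ‖dyAvg g n k‖ₑ ≤ ENNReal.ofReal (2 ^ n) * ∫⁻ x in dyadic n k, ‖g x‖ₑ := by
  unfold dyAvg
  rw [enorm_smul, Real.enorm_of_nonneg (by positivity)]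
  gcongr
  exact enorm_integral_le_lintegral_enorm _

/-- Averages over very long intervals carry no energy. -/
theorem lintegral_dyAvg_le {g : ℝ → ℂ} {w : ℝ → ℝ≥0∞} {c : ℝ≥0∞} (hc : ∀ x, w x ≤ c) (n : ℤ) :
    (∫⁻ x, ‖dyAvg g n ⌊x * 2 ^ n⌋‖ₑ ^ 2 * w x) ≤
      ENNReal.ofReal (2 ^ n) * (c * (∫⁻ x, ‖g x‖ₑ) ^ 2) := by
  rw [lintegral_dyAvg_eq]
  calc _ ≤ ∑' k, ENNReal.ofReal (2 ^ n) * (c * ((∫⁻ x, ‖g x‖ₑ) * ∫⁻ x in dyadic n k, ‖g x‖ₑ)) := by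
        refine ENNReal.tsum_le_tsum fun k => ?_
        calc _ ≤ (ENNReal.ofReal (2 ^ n) * ∫⁻ x in dyadic n k, ‖g x‖ₑ) ^ 2 *
              (ENNReal.ofReal (2 ^ (-n)) * c) := by
              gcongr
              · exact enorm_dyAvg_le g n k
              · exact dyAvgW_le hc n k
          _ = (ENNReal.ofReal (2 ^ n) * ENNReal.ofReal (2 ^ (-n))) * (ENNReal.ofReal (2 ^ n) *
              (c * ((∫⁻ x in dyadic n k, ‖g x‖ₑ) * ∫⁻ x in dyadic n k, ‖g x‖ₑ))) := by ring
          _ ≤ _ := by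
              rw [ofReal_two_zpow_mul_neg, one_mul]
              gcongr
              exact Measure.restrict_le_self
    _ = _ := by
        rw [ENNReal.tsum_mul_left, ENNReal.tsum_mul_left, ENNReal.tsum_mul_left,
          ← lintegral_eq_tsum_dyadic _ n, sq]

theorem tendsto_dyAvg {g : ℝ → ℂ} (hg : Continuous g) (x : ℝ) :
    Tendsto (fun N : ℕ => dyAvg g N ⌊x * 2 ^ (N : ℤ)⌋) atTop (𝓝 (g x)) := by
  rw [Metric.tendsto_atTop]
  intro ε hε
  obtain ⟨δ, hδ, hball⟩ := Metric.continuousAt_iff.1 hg.continuousAt (ε / 2) (half_pos hε)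
  obtain ⟨N₀, hN₀⟩ := exists_pow_lt_of_lt_one hδ (by norm_num : (1 / 2 : ℝ) < 1)
  refine ⟨N₀, fun N hN => ?_⟩
  set k := ⌊x * 2 ^ (N : ℤ)⌋
  have hx : x ∈ dyadic N k := mem_dyadic_floor _ _
  have hlen : (2 : ℝ) ^ (-(N : ℤ)) < δ := by
    refine lt_of_le_of_lt ?_ hN₀
    rw [zpow_neg, zpow_natCast, ← inv_pow, show (2 : ℝ)⁻¹ = 1 / 2 by norm_num]
    exact pow_le_pow_of_le_one (by norm_num) (by norm_num) hN
  have hclose : ∀ y ∈ dyadic N k, ‖g y - g x‖ ≤ ε / 2 := by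
    intro y hy
    rw [← dist_eq_norm]
    refine (hball ?_).le
    have h1 := hx.1; have h2 := hx.2; have h3 := hy.1; have h4 := hy.2
    rw [Real.dist_eq, abs_lt]
    constructor <;> nlinarith
  have hint : IntegrableOn g (dyadic N k) :=
    (hg.integrableOn_Icc).mono_set Set.Ico_subset_Icc_self
  have hvol : (volume (dyadic N k)).toReal = 2 ^ (-(N : ℤ)) := by
    rw [volume_dyadic, ENNReal.toReal_ofReal (by positivity)]
  have hfin : volume (dyadic N k) < ∞ := by rw [volume_dyadic]; exact ENNReal.ofReal_lt_top
  have h1 : (2 : ℝ) ^ (N : ℤ) * 2 ^ (-(N : ℤ)) = 1 := by rw [← zpow_add₀ (by norm_num)]; simp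
  have e : dyAvg g N k - g x = ((2 : ℝ) ^ (N : ℤ) : ℝ) • ∫ y in dyadic N k, (g y - g x) := by
    rw [integral_sub hint (integrableOn_const hfin.ne), setIntegral_const, smul_sub, smul_smul,
      measureReal_def, hvol, h1, one_smul]
    rfl
  rw [dist_eq_norm, e, norm_smul, Real.norm_of_nonneg (by positivity)]
  have := norm_setIntegral_le_of_norm_le_const hfin hclose
  rw [measureReal_def, hvol] at this
  calc _ ≤ (2 : ℝ) ^ (N : ℤ) * (ε / 2 * 2 ^ (-(N : ℤ))) := by gcongr
    _ = ε / 2 * ((2 : ℝ) ^ (N : ℤ) * 2 ^ (-(N : ℤ))) := by ring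
    _ < ε := by rw [h1]; linarith

theorem measurable_dyAvg (g : ℝ → ℂ) (n : ℤ) : Measurable fun x : ℝ => dyAvg g n ⌊x * 2 ^ n⌋ :=
  (measurable_from_top (f := dyAvg g n)).comp (Int.measurable_floor.comp (measurable_id.mul_const _))

/-- The weighted square function estimate: for a weight in `A₁` with constant `Q`, the weighted
`L²` norm is controlled by the Haar coefficients, with linear dependence on `Q`. -/
theorem lintegral_sq_mul_le_haar {g : ℝ → ℂ} (hgc : Continuous g) (hg : Integrable g)
    {w : ℝ → ℝ≥0∞} (hwm : Measurable w) {c : ℝ≥0∞} (hc : ∀ x, w x ≤ c) (hct : c ≠ ∞) {Q : ℝ}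
    (hQ : 1 ≤ Q) (hw : IsA1 Q w) :
    ∫⁻ x, ‖g x‖ₑ ^ 2 * w x ≤ ENNReal.ofReal (38 * Q) * ∑' n, haarLevel g w n := by
  have step : ∀ N : ℕ, (∫⁻ x, ‖dyAvg g N ⌊x * 2 ^ (N : ℤ)⌋‖ₑ ^ 2 * w x) ≤
      ENNReal.ofReal (38 * Q) * ∑' n, haarLevel g w n := by
    intro N
    have lim : Tendsto (fun M : ℕ => ENNReal.ofReal (38 * Q) * ∑' n, haarLevel g w n +
        2 * (ENNReal.ofReal (2 ^ (-(M : ℤ))) * (c * (∫⁻ x, ‖g x‖ₑ) ^ 2))) atTop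
        (𝓝 (ENNReal.ofReal (38 * Q) * ∑' n, haarLevel g w n +
          2 * (0 * (c * (∫⁻ x, ‖g x‖ₑ) ^ 2)))) := by
      have hz : Tendsto (fun M : ℕ => ENNReal.ofReal ((2 : ℝ) ^ (-(M : ℤ)))) atTop (𝓝 0) := by
        rw [← ENNReal.ofReal_zero]
        refine (ENNReal.continuous_ofReal.tendsto _).comp ?_
        have : (fun M : ℕ => (2 : ℝ) ^ (-(M : ℤ))) = fun M : ℕ => (1 / 2 : ℝ) ^ M := by
          ext M; rw [zpow_neg, zpow_natCast, one_div, inv_pow]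
        rw [this]
        exact tendsto_pow_atTop_nhds_zero_of_lt_one (by norm_num) (by norm_num)
      refine tendsto_const_nhds.add (ENNReal.Tendsto.const_mul ?_ (Or.inr (by simp)))
      refine ENNReal.Tendsto.mul_const hz (Or.inr ?_)
      exact ENNReal.mul_ne_top hct (ENNReal.pow_ne_top hg.2.ne)
    rw [zero_mul, mul_zero, add_zero] at lim
    refine ge_of_tendsto lim (Eventually.of_forall fun M => ?_)
    have := lintegral_dyAvg_le_haar_add hg hc hct hQ hw (-(M : ℤ)) (M + N)
    rw [show -(M : ℤ) + (M + N : ℕ) = N by push_cast; ring] at this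
    refine this.trans ?_
    gcongr
    exact lintegral_dyAvg_le hc _
  calc _ = ∫⁻ x, liminf (fun N : ℕ => ‖dyAvg g N ⌊x * 2 ^ (N : ℤ)⌋‖ₑ ^ 2 * w x) atTop := by
        refine lintegral_congr fun x => ?_
        have h1 : Tendsto (fun N : ℕ => ‖dyAvg g N ⌊x * 2 ^ (N : ℤ)⌋‖ₑ ^ 2) atTop
            (𝓝 (‖g x‖ₑ ^ 2)) :=
          ((ENNReal.continuous_pow 2).tendsto _).comp ((tendsto_dyAvg hgc x).enorm)
        exact (ENNReal.Tendsto.mul_const h1 (Or.inr (ne_top_of_le_ne_top hct (hc x)))).liminf_eq.symm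
    _ ≤ liminf (fun N : ℕ => ∫⁻ x, ‖dyAvg g N ⌊x * 2 ^ (N : ℤ)⌋‖ₑ ^ 2 * w x) atTop :=
        lintegral_liminf_le fun N => ((measurable_dyAvg g N).enorm.pow_const 2).mul hwm
    _ ≤ _ := by
        refine (liminf_le_liminf (Eventually.of_forall step)).trans ?_
        simp

/-! ### The maximal function on the line -/

/-- The uncentred maximal function on the line, taken over compact intervals with rational
endpoints; the countability of the family makes measurability evident. -/
def intervalMax (w : ℝ → ℝ≥0∞) (x : ℝ) : ℝ≥0∞ :=
  ⨆ p : {p : ℚ × ℚ // p.1 < p.2}, Set.indicator (Set.Icc (p.1.1 : ℝ) p.1.2)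
    (fun _ => (ENNReal.ofReal (p.1.2 - p.1.1))⁻¹ * ∫⁻ y in Set.Icc (p.1.1 : ℝ) p.1.2, w y) x

theorem lintegral_Icc_le_intervalMax (w : ℝ → ℝ≥0∞) {a b : ℝ} (hab : a < b) {x : ℝ}
    (hx : x ∈ Set.Icc a b) :
    ∫⁻ y in Set.Icc a b, w y ≤ ENNReal.ofReal (2 * (b - a)) * intervalMax w x := by
  obtain ⟨a', ha1, ha2⟩ := exists_rat_btwn (show a - (b - a) / 2 < a by linarith)
  obtain ⟨b', hb1, hb2⟩ := exists_rat_btwn (show b < b + (b - a) / 2 by linarith)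
  have hlt : a' < b' := by exact_mod_cast ha2.trans (hab.trans hb1)
  have hpos : (0 : ℝ) < b' - a' := by linarith
  have h1 : (ENNReal.ofReal (b' - a'))⁻¹ * ∫⁻ y in Set.Icc (a' : ℝ) b', w y ≤ intervalMax w x := by
    refine le_trans (le_of_eq ?_) (le_iSup _ ⟨(a', b'), hlt⟩)
    rw [Set.indicator_of_mem]
    exact ⟨ha2.le.trans hx.1, hx.2.trans hb1.le⟩
  calc _ ≤ ∫⁻ y in Set.Icc (a' : ℝ) b', w y :=
        lintegral_mono_set (Set.Icc_subset_Icc ha2.le hb1.le)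
    _ = ENNReal.ofReal (b' - a') *
        ((ENNReal.ofReal (b' - a'))⁻¹ * ∫⁻ y in Set.Icc (a' : ℝ) b', w y) := by
        rw [← mul_assoc, ENNReal.mul_inv_cancel (by simpa using hpos) ENNReal.ofReal_ne_top,
          one_mul]
    _ ≤ _ := by gcongr; linarith

theorem intervalMax_mono {w w' : ℝ → ℝ≥0∞} (h : ∀ x, w x ≤ w' x) (x : ℝ) :
    intervalMax w x ≤ intervalMax w' x :=
  iSup_mono fun _ => Set.indicator_le_indicator (by gcongr; exact h _)

theorem intervalMax_le_of_le {w : ℝ → ℝ≥0∞} {c : ℝ≥0∞} (h : ∀ x, w x ≤ c) (x : ℝ) :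
    intervalMax w x ≤ c := by
  refine iSup_le fun p => Set.indicator_le' (g := fun _ => c) (fun x _ => ?_)
    (fun x _ => zero_le) x
  have hpos : (0 : ℝ) < p.1.2 - p.1.1 := by
    have : (p.1.1 : ℝ) < p.1.2 := by exact_mod_cast p.2
    linarith
  calc _ ≤ (ENNReal.ofReal (p.1.2 - p.1.1))⁻¹ * ∫⁻ y in Set.Icc (p.1.1 : ℝ) p.1.2, c := by
        gcongr; exact h _
    _ = c := by
        rw [setLIntegral_const, Real.volume_Icc, mul_left_comm,
          ENNReal.inv_mul_cancel (by simpa using hpos) ENNReal.ofReal_ne_top, mul_one]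

theorem intervalMax_const_mul (c : ℝ≥0∞) (hc : c ≠ ∞) (w : ℝ → ℝ≥0∞) (x : ℝ) :
    intervalMax (fun y => c * w y) x = c * intervalMax w x := by
  unfold intervalMax
  rw [ENNReal.mul_iSup]
  refine iSup_congr fun p => ?_
  rw [lintegral_const_mul' _ _ hc]
  by_cases h : x ∈ Set.Icc (p.1.1 : ℝ) p.1.2
  · simp only [Set.indicator_of_mem h]; ring
  · simp only [Set.indicator_of_notMem h, mul_zero]

theorem intervalMax_tsum_le {w : ℕ → ℝ → ℝ≥0∞} (hw : ∀ i, Measurable (w i)) (x : ℝ) :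
    intervalMax (fun y => ∑' i, w i y) x ≤ ∑' i, intervalMax (w i) x := by
  refine iSup_le fun p => ?_
  by_cases h : x ∈ Set.Icc (p.1.1 : ℝ) p.1.2
  · rw [Set.indicator_of_mem h, lintegral_tsum fun i => (hw i).aemeasurable,
      ← ENNReal.tsum_mul_left]
    refine ENNReal.tsum_le_tsum fun i => ?_
    refine le_trans (le_of_eq ?_) (le_iSup _ p)
    rw [Set.indicator_of_mem h]
  · rw [Set.indicator_of_notMem h]; exact zero_le

theorem intervalMax_add_const_le {w : ℝ → ℝ≥0∞} (hw : Measurable w) (c : ℝ≥0∞) (x : ℝ) :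
    intervalMax (fun y => w y + c) x ≤ intervalMax w x + c := by
  refine iSup_le fun p => ?_
  have hpos : (0 : ℝ) < p.1.2 - p.1.1 := by
    have : (p.1.1 : ℝ) < p.1.2 := by exact_mod_cast p.2
    linarith
  by_cases h : x ∈ Set.Icc (p.1.1 : ℝ) p.1.2
  · rw [Set.indicator_of_mem h, lintegral_add_left hw, mul_add]
    gcongr
    · refine le_trans (le_of_eq ?_) (le_iSup _ p)
      rw [Set.indicator_of_mem h]
    · rw [setLIntegral_const, Real.volume_Icc, mul_left_comm,
        ENNReal.inv_mul_cancel (by simpa using hpos) ENNReal.ofReal_ne_top, mul_one]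
  · rw [Set.indicator_of_notMem h]; exact zero_le

/-- The maximal function of a measurable function of a parameter and a real variable is jointly
measurable. -/
theorem measurable_intervalMax {α : Type*} [MeasurableSpace α] {W : α → ℝ → ℝ≥0∞}
    (hW : Measurable (Function.uncurry W)) {f : α → ℝ} (hf : Measurable f) :
    Measurable fun a => intervalMax (W a) (f a) := by
  refine Measurable.iSup fun p => ?_
  have h : Measurable fun a => ∫⁻ y in Set.Icc (p.1.1 : ℝ) p.1.2, W a y :=
    Measurable.lintegral_prod_right' (f := Function.uncurry W) hW
  exact (h.const_mul _).indicator (hf measurableSet_Icc)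

/-- Weak type `(1, 1)` of the maximal function, from the Vitali covering lemma. -/
theorem mul_volume_intervalMax_le (w : ℝ → ℝ≥0∞) (t : ℝ≥0∞) :
    t * volume {x | t < intervalMax w x} ≤ 5 * ∫⁻ x, w x := by
  rcases eq_or_ne t 0 with rfl | ht0
  · simp
  rcases eq_or_ne t ∞ with rfl | htt
  · simp
  by_cases hfin : ∫⁻ x, w x = ∞
  · rw [hfin]; simp
  set T : Set {p : ℚ × ℚ // p.1 < p.2} := {p | t * ENNReal.ofReal ((p.1.2 : ℝ) - p.1.1) ≤
    ∫⁻ y in Set.Icc (p.1.1 : ℝ) p.1.2, w y} with hT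
  have hpos : ∀ p : {p : ℚ × ℚ // p.1 < p.2}, (0 : ℝ) < p.1.2 - p.1.1 := fun p => by
    have : (p.1.1 : ℝ) < p.1.2 := by exact_mod_cast p.2
    linarith
  obtain ⟨u, huT, hdis, hcov⟩ := Vitali.exists_disjoint_subfamily_covering_enlargement_closedBall T
    (fun p => ((p.1.1 : ℝ) + p.1.2) / 2) (fun p => ((p.1.2 : ℝ) - p.1.1) / 2)
    (((∫⁻ x, w x) / t).toReal) (fun p hp => by
      have h1 : t * ENNReal.ofReal ((p.1.2 : ℝ) - p.1.1) ≤ ∫⁻ x, w x :=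
        le_trans hp (setLIntegral_le_lintegral _ _)
      have h2 : ENNReal.ofReal ((p.1.2 : ℝ) - p.1.1) ≤ (∫⁻ x, w x) / t := by
        rw [ENNReal.le_div_iff_mul_le (Or.inl ht0) (Or.inl htt), mul_comm]; exact h1
      have h3 := ENNReal.toReal_mono (ENNReal.div_ne_top hfin ht0) h2
      rw [ENNReal.toReal_ofReal (hpos p).le] at h3
      linarith [hpos p]) 5 (by norm_num)
  simp only [← Real.Icc_eq_closedBall] at hdis hcov
  have hball : ∀ p : {p : ℚ × ℚ // p.1 < p.2}, Metric.closedBall (((p.1.1 : ℝ) + p.1.2) / 2)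
      (((p.1.2 : ℝ) - p.1.1) / 2) = Set.Icc (p.1.1 : ℝ) p.1.2 := fun p => by
    rw [Real.closedBall_eq_Icc]; congr 1 <;> ring
  have hsub : {x | t < intervalMax w x} ⊆ ⋃ p ∈ u, Metric.closedBall (((p.1.1 : ℝ) + p.1.2) / 2)
      (5 * (((p.1.2 : ℝ) - p.1.1) / 2)) := by
    intro x hx
    obtain ⟨p, hp⟩ := lt_iSup_iff.1 (show t < intervalMax w x from hx)
    have hxp : x ∈ Set.Icc (p.1.1 : ℝ) p.1.2 := by
      by_contra hcon
      rw [Set.indicator_of_notMem hcon] at hp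
      exact not_lt_zero hp
    rw [Set.indicator_of_mem hxp] at hp
    have hpT : p ∈ T := by
      have hm : (ENNReal.ofReal ((p.1.2 : ℝ) - p.1.1)) ≠ 0 := by simpa using hpos p
      calc t * ENNReal.ofReal ((p.1.2 : ℝ) - p.1.1) ≤
          ((ENNReal.ofReal (p.1.2 - p.1.1))⁻¹ * ∫⁻ y in Set.Icc (p.1.1 : ℝ) p.1.2, w y) *
            ENNReal.ofReal ((p.1.2 : ℝ) - p.1.1) := by gcongr
        _ = _ := by
          rw [mul_right_comm, ENNReal.inv_mul_cancel hm ENNReal.ofReal_ne_top, one_mul]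
    obtain ⟨q, hq, hpq⟩ := hcov p hpT
    exact Set.mem_biUnion hq (hpq (hball p ▸ hxp))
  calc t * volume {x | t < intervalMax w x}
      ≤ t * ∑' p : u, volume (Metric.closedBall (((p.1.1.1 : ℝ) + p.1.1.2) / 2)
          (5 * (((p.1.1.2 : ℝ) - p.1.1.1) / 2))) := by
        gcongr
        exact (measure_mono hsub).trans (measure_biUnion_le _ u.to_countable _)
    _ = ∑' p : u, 5 * (t * ENNReal.ofReal ((p.1.1.2 : ℝ) - p.1.1.1)) := by
        rw [← ENNReal.tsum_mul_left]
        refine tsum_congr fun p => ?_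
        rw [Real.volume_closedBall, show 2 * (5 * (((p.1.1.2 : ℝ) - p.1.1.1) / 2)) =
          5 * ((p.1.1.2 : ℝ) - p.1.1.1) by ring, ENNReal.ofReal_mul (by norm_num)]
        simp only [ENNReal.ofReal_ofNat]
        ring
    _ ≤ 5 * ∑' p : u, ∫⁻ y in Set.Icc (p.1.1.1 : ℝ) p.1.1.2, w y := by
        rw [ENNReal.tsum_mul_left]
        gcongr with p
        exact huT p.2
    _ = 5 * ∫⁻ y in ⋃ p : u, Set.Icc (p.1.1.1 : ℝ) p.1.1.2, w y := by
        rw [lintegral_iUnion (fun _ => measurableSet_Icc)]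
        intro p q hpq
        have := hdis p.2 q.2 (fun h => hpq (Subtype.ext h))
        simp only [Function.onFun] at this ⊢
        exact this
    _ ≤ 5 * ∫⁻ y, w y := by gcongr; exact Measure.restrict_le_self

theorem lintegral_Ioo_rpow {q : ℝ} (hq : 1 < q) {b : ℝ} (hb : 0 ≤ b) :
    ∫⁻ t in Set.Ioo 0 b, ENNReal.ofReal (t ^ (q - 2)) = ENNReal.ofReal (b ^ (q - 1) / (q - 1)) := by
  have hint : IntervalIntegrable (fun t : ℝ => t ^ (q - 2)) volume 0 b :=
    intervalIntegral.intervalIntegrable_rpow' (by linarith)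
  rw [setLIntegral_congr Ioo_ae_eq_Ioc, ← ofReal_integral_eq_lintegral_ofReal
    ((intervalIntegrable_iff_integrableOn_Ioc_of_le hb).1 hint)
    ((ae_restrict_mem measurableSet_Ioc).mono fun t ht => Real.rpow_nonneg ht.1.le _),
    ← intervalIntegral.integral_of_le hb, integral_rpow (Or.inl (by linarith)),
    Real.zero_rpow (by linarith)]
  congr 1
  rw [show q - 2 + 1 = q - 1 by ring, sub_zero]

/-- The `L^q` bound for the maximal function, with the growth `q / (q - 1)` of the constant as
`q → 1`. -/
theorem lintegral_intervalMax_rpow_le {w : ℝ → ℝ≥0∞} (hw : Measurable w) {c : ℝ≥0∞}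
    (hc : ∀ x, w x ≤ c) (hct : c ≠ ∞) {q : ℝ} (hq : 1 < q) :
    ∫⁻ x, intervalMax w x ^ q ≤
      ENNReal.ofReal (10 * 2 ^ (q - 1) * (q / (q - 1))) * ∫⁻ x, w x ^ q := by
  have hM : Measurable (intervalMax w) :=
    measurable_intervalMax (W := fun (_ : ℝ) y => w y) (hw.comp measurable_snd) measurable_id
  have hMfin : ∀ x, intervalMax w x ≠ ∞ := fun x =>
    ne_top_of_le_ne_top hct (intervalMax_le_of_le hc x)
  have hwfin : ∀ x, w x ≠ ∞ := fun x => ne_top_of_le_ne_top hct (hc x)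
  have weak : ∀ t : ℝ, 0 < t → volume {x | t < (intervalMax w x).toReal} *
      ENNReal.ofReal (t ^ (q - 1)) ≤ 10 * ∫⁻ x, ENNReal.ofReal (t ^ (q - 2)) *
        Set.indicator {z : ℝ × ℝ | z.1 < 2 * (w z.2).toReal} (fun z => w z.2) (t, x) := by
    intro t ht
    set w' := Set.indicator {x | t < 2 * (w x).toReal} w with hw'
    have hset : {x | t < (intervalMax w x).toReal} ⊆
        {x | ENNReal.ofReal (t / 2) < intervalMax w' x} := by
      intro x hx
      by_contra hcon
      rw [Set.mem_ofPred_eq, not_lt] at hcon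
      have h1 : intervalMax w x ≤ intervalMax (fun y => w' y + ENNReal.ofReal (t / 2)) x := by
        refine intervalMax_mono (fun y => ?_) x
        by_cases hy : t < 2 * (w y).toReal
        · rw [hw', Set.indicator_of_mem (by exact hy)]; exact le_self_add
        · refine le_trans ?_ le_add_self
          rw [← ENNReal.ofReal_toReal (hwfin y)]
          exact ENNReal.ofReal_le_ofReal (by linarith)
      have h2 := h1.trans (intervalMax_add_const_le
        (hw.indicator (measurableSet_lt measurable_const (hw.ennreal_toReal.const_mul 2))) _ x)
      have h3 : intervalMax w x ≤ ENNReal.ofReal t := by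
        refine h2.trans ((add_le_add_left hcon _).trans (le_of_eq ?_))
        rw [← ENNReal.ofReal_add (by positivity) (by positivity)]; congr 1; ring
      have h4 := ENNReal.toReal_mono ENNReal.ofReal_ne_top h3
      rw [ENNReal.toReal_ofReal ht.le] at h4
      exact absurd hx (not_lt.2 h4)
    have e : t ^ (q - 1) = t / 2 * (2 * t ^ (q - 2)) := by
      rw [show q - 1 = 1 + (q - 2) by ring, Real.rpow_add ht, Real.rpow_one]; ring
    calc _ ≤ volume {x | ENNReal.ofReal (t / 2) < intervalMax w' x} * ENNReal.ofReal (t ^ (q - 1)) :=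
          by gcongr
      _ = (ENNReal.ofReal (t / 2) * volume {x | ENNReal.ofReal (t / 2) < intervalMax w' x}) *
          (2 * ENNReal.ofReal (t ^ (q - 2))) := by
          rw [e, ENNReal.ofReal_mul (by positivity), ENNReal.ofReal_mul (by positivity)]
          simp only [ENNReal.ofReal_ofNat]
          ring
      _ ≤ (5 * ∫⁻ x, w' x) * (2 * ENNReal.ofReal (t ^ (q - 2))) := by
          exact mul_le_mul_left (mul_volume_intervalMax_le _ _) _
      _ = 10 * (ENNReal.ofReal (t ^ (q - 2)) * ∫⁻ x, w' x) := by ring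
      _ = _ := by rw [← lintegral_const_mul' _ _ ENNReal.ofReal_ne_top]; rfl
  have e1 : ∀ x, intervalMax w x ^ q = ENNReal.ofReal ((intervalMax w x).toReal ^ q) := fun x => by
    rw [← ENNReal.ofReal_rpow_of_nonneg ENNReal.toReal_nonneg (by linarith),
      ENNReal.ofReal_toReal (hMfin x)]
  have inner : ∀ x, ∫⁻ t in Set.Ioi 0, ENNReal.ofReal (t ^ (q - 2)) *
      Set.indicator {z : ℝ × ℝ | z.1 < 2 * (w z.2).toReal} (fun z => w z.2) (t, x) =
        ENNReal.ofReal (2 ^ (q - 1) / (q - 1)) * w x ^ q := by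
    intro x
    set v := (w x).toReal with hv
    have hv0 : 0 ≤ v := ENNReal.toReal_nonneg
    have hwv : w x = ENNReal.ofReal v := (ENNReal.ofReal_toReal (hwfin x)).symm
    have h1 : ∀ t : ℝ, ENNReal.ofReal (t ^ (q - 2)) *
        Set.indicator {z : ℝ × ℝ | z.1 < 2 * (w z.2).toReal} (fun z => w z.2) (t, x) =
        Set.indicator (Set.Iio (2 * v)) (fun t => ENNReal.ofReal (t ^ (q - 2)) * w x) t := by
      intro t
      by_cases ht : t < 2 * v
      · rw [Set.indicator_of_mem (by exact ht), Set.indicator_of_mem (by exact ht)]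
      · rw [Set.indicator_of_notMem (by exact ht), Set.indicator_of_notMem (by exact ht), mul_zero]
    simp_rw [h1]
    rw [setLIntegral_indicator measurableSet_Iio, Set.inter_comm, Set.Ioi_inter_Iio,
      lintegral_mul_const' _ _ (hwfin x), lintegral_Ioo_rpow hq (by positivity), hwv,
      ENNReal.ofReal_rpow_of_nonneg hv0 (by linarith), ← ENNReal.ofReal_mul
        (div_nonneg (by positivity) (by linarith)),
      ← ENNReal.ofReal_mul (div_nonneg (by positivity) (by linarith))]
    congr 1
    rw [Real.mul_rpow (by norm_num) hv0]
    rcases hv0.eq_or_lt with h0 | h0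
    · rw [← h0, Real.zero_rpow (by linarith), Real.zero_rpow (by linarith)]; ring
    · rw [show v ^ q = v ^ (q - 1) * v by
        rw [← Real.rpow_add_one h0.ne']; congr 1; ring]
      ring
  simp_rw [e1]
  rw [lintegral_rpow_eq_lintegral_meas_lt_mul volume
    (Eventually.of_forall fun _ => ENNReal.toReal_nonneg) hM.ennreal_toReal.aemeasurable
    (by linarith)]
  calc _ ≤ ENNReal.ofReal q * ∫⁻ t in Set.Ioi (0 : ℝ), 10 * ∫⁻ x, ENNReal.ofReal (t ^ (q - 2)) *
        Set.indicator {z : ℝ × ℝ | z.1 < 2 * (w z.2).toReal} (fun z => w z.2) (t, x) := by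
        exact mul_le_mul_right (setLIntegral_mono' measurableSet_Ioi weak) _
    _ = ENNReal.ofReal q * (10 * ∫⁻ x, ENNReal.ofReal (2 ^ (q - 1) / (q - 1)) * w x ^ q) := by
        rw [lintegral_const_mul' _ _ (by norm_num), lintegral_lintegral_swap]
        · simp_rw [inner]
        · refine Measurable.aemeasurable ?_
          refine Measurable.mul (by fun_prop) ?_
          exact (hw.comp measurable_snd).indicator (measurableSet_lt measurable_fst
            ((hw.ennreal_toReal.comp measurable_snd).const_mul 2))
    _ = _ := by
        rw [lintegral_const_mul' _ _ ENNReal.ofReal_ne_top, ← mul_assoc, ← mul_assoc]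
        congr 1
        rw [show 10 * 2 ^ (q - 1) * (q / (q - 1)) = q * 10 * (2 ^ (q - 1) / (q - 1)) by ring,
          ENNReal.ofReal_mul (by linarith), ENNReal.ofReal_mul (by linarith)]
        simp

/-! ### Majorants in `A₁` of the plane, in each variable separately -/

/-- The sum of the maximal functions in the two coordinate directions. -/
def sumMax (W : ℝ → ℝ → ℝ≥0∞) (x y : ℝ) : ℝ≥0∞ :=
  intervalMax (fun s => W s y) x + intervalMax (W x) y

theorem measurable_sumMax {W : ℝ → ℝ → ℝ≥0∞} (hW : Measurable (Function.uncurry W)) :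
    Measurable (Function.uncurry (sumMax W)) := by
  refine Measurable.add ?_ ?_
  · exact measurable_intervalMax (W := fun (z : ℝ × ℝ) s => W s z.2)
      (hW.comp (measurable_snd.prodMk (measurable_snd.comp measurable_fst))) measurable_fst
  · exact measurable_intervalMax (W := fun (z : ℝ × ℝ) s => W z.1 s)
      (hW.comp ((measurable_fst.comp measurable_fst).prodMk measurable_snd)) measurable_snd

theorem sumMax_le {W : ℝ → ℝ → ℝ≥0∞} {c : ℝ≥0∞} (h : ∀ x y, W x y ≤ c) (x y : ℝ) :
    sumMax W x y ≤ 2 * c := by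
  rw [two_mul]
  exact add_le_add (intervalMax_le_of_le (fun s => h s y) x) (intervalMax_le_of_le (h x) y)

theorem lintegral_sumMax_rpow_le {W : ℝ → ℝ → ℝ≥0∞} (hW : Measurable (Function.uncurry W))
    {c : ℝ≥0∞} (hc : ∀ x y, W x y ≤ c) (hct : c ≠ ∞) {q : ℝ} (hq : 1 < q) :
    ∫⁻ y, ∫⁻ x, sumMax W x y ^ q ≤
      ENNReal.ofReal (40 * (q / (q - 1))) ^ q * ∫⁻ y, ∫⁻ x, W x y ^ q := by
  set D := ENNReal.ofReal (10 * 2 ^ (q - 1) * (q / (q - 1))) with hD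
  have hq1 : 1 ≤ q / (q - 1) := by rw [le_div_iff₀ (by linarith)]; linarith
  have hq0 : (0 : ℝ) ≤ q := by linarith
  have m1 : Measurable fun z : ℝ × ℝ => intervalMax (fun s => W s z.1) z.2 :=
    measurable_intervalMax (W := fun (z : ℝ × ℝ) s => W s z.1)
      (hW.comp (measurable_snd.prodMk (measurable_fst.comp measurable_fst))) measurable_snd
  have m2 : Measurable fun z : ℝ × ℝ => intervalMax (W z.2) z.1 :=
    measurable_intervalMax (W := fun (z : ℝ × ℝ) s => W z.2 s)
      (hW.comp ((measurable_snd.comp measurable_fst).prodMk measurable_snd)) measurable_fst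
  have b1 : ∫⁻ y, ∫⁻ x, intervalMax (fun s => W s y) x ^ q ≤ D * ∫⁻ y, ∫⁻ x, W x y ^ q := by
    rw [← lintegral_const_mul' _ _ ENNReal.ofReal_ne_top]
    exact lintegral_mono fun y => lintegral_intervalMax_rpow_le
      (hW.comp (measurable_id.prodMk measurable_const)) (fun x => hc x y) hct hq
  have b2 : ∫⁻ y, ∫⁻ x, intervalMax (W x) y ^ q ≤ D * ∫⁻ y, ∫⁻ x, W x y ^ q := by
    have s1 := lintegral_lintegral_swap (μ := volume) (ν := volume)
      (f := fun y x => intervalMax (W x) y ^ q) (m2.pow_const q).aemeasurable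
    have s2 := lintegral_lintegral_swap (μ := volume) (ν := volume) (f := fun y x => W x y ^ q)
      ((hW.comp measurable_swap).pow_const q).aemeasurable
    rw [s1, s2, ← lintegral_const_mul' _ _ ENNReal.ofReal_ne_top]
    exact lintegral_mono fun x => lintegral_intervalMax_rpow_le
      (hW.comp (measurable_const.prodMk measurable_id)) (hc x) hct hq
  have hconst : 2 ^ (q - 1) * (D + D) ≤ ENNReal.ofReal (40 * (q / (q - 1))) ^ q := by
    have e2 : (2 : ℝ≥0∞) ^ (q - 1) = ENNReal.ofReal (2 ^ (q - 1)) := by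
      rw [← ENNReal.ofReal_rpow_of_pos (by norm_num)]; simp
    rw [e2, hD, ← ENNReal.ofReal_add (by positivity) (by positivity),
      ← ENNReal.ofReal_mul (by positivity), ENNReal.ofReal_rpow_of_nonneg (by positivity) hq0]
    refine ENNReal.ofReal_le_ofReal ?_
    have h1 : (2 : ℝ) ^ (q - 1) * 2 = 2 ^ q := by
      rw [← Real.rpow_add_one (by norm_num)]; congr 1; ring
    have h2 : 10 * (q / (q - 1)) ≤ (10 * (q / (q - 1))) ^ q := by
      have := Real.rpow_le_rpow_of_exponent_le (by linarith : 1 ≤ 10 * (q / (q - 1))) hq.le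
      rwa [Real.rpow_one] at this
    have h3 : (2 : ℝ) ^ (q - 1) ≤ 2 ^ q :=
      Real.rpow_le_rpow_of_exponent_le (by norm_num) (by linarith)
    calc _ = (2 : ℝ) ^ (q - 1) * (2 ^ (q - 1) * 2) * (10 * (q / (q - 1))) := by ring
      _ ≤ 2 ^ q * 2 ^ q * (10 * (q / (q - 1))) ^ q := by rw [h1]; gcongr
      _ = _ := by
        rw [← Real.mul_rpow (by norm_num) (by norm_num), ← Real.mul_rpow (by norm_num)
          (by positivity)]
        congr 1; ring
  calc _ ≤ ∫⁻ y, ∫⁻ x, 2 ^ (q - 1) *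
        (intervalMax (fun s => W s y) x ^ q + intervalMax (W x) y ^ q) :=
        lintegral_mono fun y => lintegral_mono fun x =>
          ENNReal.rpow_add_le_mul_rpow_add_rpow _ _ hq.le
    _ = 2 ^ (q - 1) * ((∫⁻ y, ∫⁻ x, intervalMax (fun s => W s y) x ^ q) +
        ∫⁻ y, ∫⁻ x, intervalMax (W x) y ^ q) := by
        have h2t : (2 : ℝ≥0∞) ^ (q - 1) ≠ ∞ := ENNReal.rpow_ne_top_of_nonneg (by linarith) (by simp)
        rw [← lintegral_add_left ((m1.pow_const q).lintegral_prod_right'),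
          ← lintegral_const_mul' _ _ h2t]
        refine lintegral_congr fun y => ?_
        rw [lintegral_const_mul' _ _ h2t, lintegral_add_left]
        exact (m1.pow_const q).comp (measurable_const.prodMk measurable_id)
    _ ≤ 2 ^ (q - 1) * (D * (∫⁻ y, ∫⁻ x, W x y ^ q) + D * ∫⁻ y, ∫⁻ x, W x y ^ q) := by gcongr
    _ = (2 ^ (q - 1) * (D + D)) * ∫⁻ y, ∫⁻ x, W x y ^ q := by ring
    _ ≤ _ := by gcongr

/-- Jensen's inequality for a countable sum with weights of total mass at most `1`. -/
theorem tsum_mul_rpow_le {v f : ℕ → ℝ≥0∞} (hv : ∑' k, v k ≤ 1) {q : ℝ} (hq : 1 < q) :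
    (∑' k, v k * f k) ^ q ≤ ∑' k, v k * f k ^ q := by
  have hq0 : 0 < q := by linarith
  have hlim : Tendsto (fun n => (∑ k ∈ Finset.range n, v k * f k) ^ q) atTop
      (𝓝 ((∑' k, v k * f k) ^ q)) :=
    ((ENNReal.continuous_rpow_const (y := q)).tendsto _).comp
      (ENNReal.tendsto_nat_tsum fun k => v k * f k)
  refine le_of_tendsto hlim (Eventually.of_forall fun n => ?_)
  have h := ENNReal.inner_le_weight_mul_Lp_of_nonneg (Finset.range n) hq.le v f
  have h1 : (∑ k ∈ Finset.range n, v k) ^ (1 - q⁻¹) ≤ 1 :=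
    ENNReal.rpow_le_one ((ENNReal.sum_le_tsum _).trans hv) (sub_nonneg.2 (inv_le_one_of_one_le₀ hq.le))
  calc _ ≤ ((∑ k ∈ Finset.range n, v k * f k ^ q) ^ q⁻¹) ^ q := by
        gcongr
        refine h.trans ((mul_le_mul_left h1 _).trans ?_)
        rw [one_mul]
    _ = ∑ k ∈ Finset.range n, v k * f k ^ q := ENNReal.rpow_inv_rpow hq0.ne' _
    _ ≤ _ := ENNReal.sum_le_tsum _

/-- The Rubio de Francia majorant of `w`: the sum of the iterates of the maximal operator
`sumMax`, discounted by powers of `1 / (2 * N)`. -/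
def rdf (N : ℝ) (w : ℝ → ℝ → ℝ≥0∞) (x y : ℝ) : ℝ≥0∞ :=
  ∑' k : ℕ, (ENNReal.ofReal (2 * N))⁻¹ ^ k * (sumMax^[k] w) x y

theorem measurable_iterate_sumMax {w : ℝ → ℝ → ℝ≥0∞} (hw : Measurable (Function.uncurry w))
    (k : ℕ) : Measurable (Function.uncurry (sumMax^[k] w)) := by
  induction k with
  | zero => exact hw
  | succ k ih => rw [Function.iterate_succ_apply']; exact measurable_sumMax ih

theorem iterate_sumMax_le {w : ℝ → ℝ → ℝ≥0∞} {c : ℝ≥0∞} (hc : ∀ x y, w x y ≤ c) (k : ℕ)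
    (x y : ℝ) : (sumMax^[k] w) x y ≤ 2 ^ k * c := by
  induction k generalizing x y with
  | zero => simpa using hc x y
  | succ k ih =>
    rw [Function.iterate_succ_apply']
    exact (sumMax_le ih x y).trans (le_of_eq (by ring))

theorem measurable_rdf (N : ℝ) {w : ℝ → ℝ → ℝ≥0∞} (hw : Measurable (Function.uncurry w)) :
    Measurable (Function.uncurry (rdf N w)) :=
  Measurable.tsum fun k => (measurable_iterate_sumMax hw k).const_mul _

theorem le_rdf (N : ℝ) (w : ℝ → ℝ → ℝ≥0∞) (x y : ℝ) : w x y ≤ rdf N w x y := by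
  refine le_trans (le_of_eq ?_) (ENNReal.le_tsum 0)
  simp

theorem tsum_inv_two_pow : ∑' k : ℕ, (2 : ℝ≥0∞)⁻¹ ^ k = 2 := by
  rw [ENNReal.tsum_geometric, ENNReal.one_sub_inv_two, inv_inv]

theorem rdf_le {N : ℝ} (hN : 2 ≤ N) {w : ℝ → ℝ → ℝ≥0∞} {c : ℝ≥0∞} (hc : ∀ x y, w x y ≤ c)
    (x y : ℝ) : rdf N w x y ≤ 2 * c := by
  calc rdf N w x y ≤ ∑' k : ℕ, (2 : ℝ≥0∞)⁻¹ ^ k * c := by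
        refine ENNReal.tsum_le_tsum fun k => ?_
        calc _ ≤ (ENNReal.ofReal (2 * 2))⁻¹ ^ k * (2 ^ k * c) := by
              gcongr
              exact iterate_sumMax_le hc k x y
          _ = _ := by
              rw [← mul_assoc, ← mul_pow, ENNReal.ofReal_mul (by norm_num), ENNReal.ofReal_ofNat,
                ENNReal.mul_inv (by simp) (by simp), mul_assoc,
                ENNReal.inv_mul_cancel (by simp) (by simp), mul_one]
    _ = 2 * c := by rw [ENNReal.tsum_mul_right, tsum_inv_two_pow]

/-- Shifting the defining series of `rdf` gives the `A₁` property. -/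
theorem tsum_rdf_succ_le {N : ℝ} (hN : 0 < N) (w : ℝ → ℝ → ℝ≥0∞) (x y : ℝ) :
    ∑' k : ℕ, (ENNReal.ofReal (2 * N))⁻¹ ^ k * (sumMax^[k + 1] w) x y ≤
      ENNReal.ofReal (2 * N) * rdf N w x y := by
  have h0 : ENNReal.ofReal (2 * N) ≠ 0 := by simpa using hN
  have e : ∀ k : ℕ, (ENNReal.ofReal (2 * N))⁻¹ ^ k * (sumMax^[k + 1] w) x y =
      ENNReal.ofReal (2 * N) * ((ENNReal.ofReal (2 * N))⁻¹ ^ (k + 1) * (sumMax^[k + 1] w) x y) :=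
    fun k => by
      rw [← mul_assoc, pow_succ', ← mul_assoc, ENNReal.mul_inv_cancel h0 ENNReal.ofReal_ne_top,
        one_mul]
  simp_rw [e]
  rw [ENNReal.tsum_mul_left]
  gcongr
  exact ENNReal.tsum_comp_le_tsum_of_injective (add_left_injective 1)
    (fun k => (ENNReal.ofReal (2 * N))⁻¹ ^ k * (sumMax^[k] w) x y)

/-- The `A₁` condition in each variable, from the fact that the maximal operators are sublinear. -/
theorem isA1_rdf {N : ℝ} (hN : 0 < N) {w : ℝ → ℝ → ℝ≥0∞} (hw : Measurable (Function.uncurry w)) :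
    (∀ y, IsA1 (4 * N) fun x => rdf N w x y) ∧ ∀ x, IsA1 (4 * N) (rdf N w x) := by
  have hd : (ENNReal.ofReal (2 * N))⁻¹ ≠ ∞ := by simpa using hN
  have fin : ∀ (a b : ℝ), a < b → ∀ v z : ℝ≥0∞, v ≤ ENNReal.ofReal (2 * N) * z →
      ENNReal.ofReal (2 * (b - a)) * v ≤ ENNReal.ofReal (4 * N * (b - a)) * z := by
    intro a b hab v z h
    have hab' : 0 ≤ b - a := by linarith
    calc _ ≤ ENNReal.ofReal (2 * (b - a)) * (ENNReal.ofReal (2 * N) * z) := by gcongr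
      _ = _ := by rw [← mul_assoc, ← ENNReal.ofReal_mul (by positivity)]; congr 2; ring
  constructor
  · intro y a b hab x hx
    refine (lintegral_Icc_le_intervalMax _ hab hx).trans (fin a b hab _ _ ?_)
    refine le_trans ?_ (tsum_rdf_succ_le hN w x y)
    refine (intervalMax_tsum_le (fun k => ((measurable_iterate_sumMax hw k).comp
      (measurable_id.prodMk measurable_const)).const_mul _) x).trans ?_
    refine ENNReal.tsum_le_tsum fun k => ?_
    rw [intervalMax_const_mul _ (ENNReal.pow_ne_top hd), Function.iterate_succ_apply']
    gcongr
    exact le_self_add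
  · intro x a b hab y hy
    refine (lintegral_Icc_le_intervalMax _ hab hy).trans (fin a b hab _ _ ?_)
    refine le_trans ?_ (tsum_rdf_succ_le hN w x y)
    refine (intervalMax_tsum_le (fun k => ((measurable_iterate_sumMax hw k).comp
      (measurable_const.prodMk measurable_id)).const_mul _) y).trans ?_
    refine ENNReal.tsum_le_tsum fun k => ?_
    rw [intervalMax_const_mul _ (ENNReal.pow_ne_top hd), Function.iterate_succ_apply']
    gcongr
    exact le_add_self

/-- With `N` at least the norm of `sumMax` on `L^q`, the series defining the majorant converges
geometrically in `L^q`. -/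
theorem lintegral_rdf_rpow_le {w : ℝ → ℝ → ℝ≥0∞} (hw : Measurable (Function.uncurry w))
    {c : ℝ≥0∞} (hc : ∀ x y, w x y ≤ c) (hct : c ≠ ∞) {q : ℝ} (hq : 1 < q) :
    ∫⁻ y, ∫⁻ x, rdf (40 * (q / (q - 1))) w x y ^ q ≤ 2 ^ q * ∫⁻ y, ∫⁻ x, w x y ^ q := by
  obtain ⟨N, hN⟩ : ∃ N, N = 40 * (q / (q - 1)) := ⟨_, rfl⟩
  rw [← hN]
  have hN0 : 0 < N := by
    have : 0 < q / (q - 1) := div_pos (by linarith) (by linarith)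
    rw [hN]; positivity
  have hNe0 : ENNReal.ofReal N ≠ 0 := by simpa using hN0
  have hq0 : 0 ≤ q := by linarith
  have iter : ∀ k : ℕ, ∫⁻ y, ∫⁻ x, (sumMax^[k] w) x y ^ q ≤
      (ENNReal.ofReal N ^ q) ^ k * ∫⁻ y, ∫⁻ x, w x y ^ q := by
    intro k
    induction k with
    | zero => simp
    | succ k ih =>
      rw [Function.iterate_succ_apply']
      refine (lintegral_sumMax_rpow_le (measurable_iterate_sumMax hw k) (iterate_sumMax_le hc k)
        (ENNReal.mul_ne_top (by simp) hct) hq).trans ?_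
      rw [← hN, pow_succ', mul_assoc]
      gcongr
  have expand : ∀ x y, rdf N w x y = ∑' k : ℕ, (2 : ℝ≥0∞)⁻¹ ^ (k + 1) *
      (2 * ((ENNReal.ofReal N)⁻¹ ^ k * (sumMax^[k] w) x y)) := by
    intro x y
    refine tsum_congr fun k => ?_
    rw [ENNReal.ofReal_mul (by norm_num), ENNReal.ofReal_ofNat,
      ENNReal.mul_inv (by simp) (by simp), mul_pow, pow_succ]
    calc _ = (2 : ℝ≥0∞)⁻¹ ^ k * ((ENNReal.ofReal N)⁻¹ ^ k * (sumMax^[k] w) x y) := by ring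
      _ = (2⁻¹ * 2) * ((2 : ℝ≥0∞)⁻¹ ^ k * ((ENNReal.ofReal N)⁻¹ ^ k * (sumMax^[k] w) x y)) := by
          rw [ENNReal.inv_mul_cancel (by simp) (by simp), one_mul]
      _ = _ := by ring
  have mass : ∑' k : ℕ, (2 : ℝ≥0∞)⁻¹ ^ (k + 1) = 1 := by
    simp_rw [pow_succ']
    rw [ENNReal.tsum_mul_left, tsum_inv_two_pow, ENNReal.inv_mul_cancel (by simp) (by simp)]
  have pt : ∀ x y, rdf N w x y ^ q ≤ ∑' k : ℕ, (2 : ℝ≥0∞)⁻¹ ^ (k + 1) *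
      (2 ^ q * (((ENNReal.ofReal N ^ q) ^ k)⁻¹ * (sumMax^[k] w) x y ^ q)) := by
    intro x y
    rw [expand]
    refine (tsum_mul_rpow_le mass.le hq).trans (le_of_eq (tsum_congr fun k => ?_))
    have e : ((ENNReal.ofReal N)⁻¹ ^ k) ^ q = ((ENNReal.ofReal N ^ q) ^ k)⁻¹ := by
      rw [← ENNReal.inv_pow, ENNReal.inv_rpow, ← ENNReal.rpow_natCast, ← ENNReal.rpow_mul,
        ← ENNReal.rpow_natCast, ← ENNReal.rpow_mul, mul_comm (k : ℝ)]
    rw [ENNReal.mul_rpow_of_nonneg _ _ hq0, ENNReal.mul_rpow_of_nonneg _ _ hq0, e]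
  have meas : ∀ k : ℕ, Measurable fun z : ℝ × ℝ => (2 : ℝ≥0∞)⁻¹ ^ (k + 1) *
      (2 ^ q * (((ENNReal.ofReal N ^ q) ^ k)⁻¹ * (sumMax^[k] w) z.2 z.1 ^ q)) := fun k =>
    ((((((measurable_iterate_sumMax hw k).comp measurable_swap).pow_const q).const_mul _).const_mul
      _).const_mul _)
  have hNp : ENNReal.ofReal N ^ q ≠ 0 := by simp [ENNReal.rpow_eq_zero_iff, hN0]
  have hNt : ENNReal.ofReal N ^ q ≠ ∞ := ENNReal.rpow_ne_top_of_nonneg hq0 ENNReal.ofReal_ne_top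
  have h2t : (2 : ℝ≥0∞) ^ q ≠ ∞ := ENNReal.rpow_ne_top_of_nonneg hq0 (by simp)
  calc _ ≤ ∫⁻ y, ∫⁻ x, ∑' k : ℕ, (2 : ℝ≥0∞)⁻¹ ^ (k + 1) *
        (2 ^ q * (((ENNReal.ofReal N ^ q) ^ k)⁻¹ * (sumMax^[k] w) x y ^ q)) :=
        lintegral_mono fun y => lintegral_mono fun x => pt x y
    _ = ∑' k : ℕ, (2 : ℝ≥0∞)⁻¹ ^ (k + 1) *
        (2 ^ q * (((ENNReal.ofReal N ^ q) ^ k)⁻¹ * ∫⁻ y, ∫⁻ x, (sumMax^[k] w) x y ^ q)) := by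
        have e1 : ∀ y : ℝ, ∫⁻ x, ∑' k : ℕ, (2 : ℝ≥0∞)⁻¹ ^ (k + 1) *
            (2 ^ q * (((ENNReal.ofReal N ^ q) ^ k)⁻¹ * (sumMax^[k] w) x y ^ q)) =
            ∑' k : ℕ, ∫⁻ x, (2 : ℝ≥0∞)⁻¹ ^ (k + 1) *
            (2 ^ q * (((ENNReal.ofReal N ^ q) ^ k)⁻¹ * (sumMax^[k] w) x y ^ q)) := fun y =>
          lintegral_tsum fun k => ((meas k).comp (measurable_const.prodMk measurable_id)).aemeasurable
        simp_rw [e1]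
        rw [lintegral_tsum fun k => ((meas k).lintegral_prod_right').aemeasurable]
        refine tsum_congr fun k => ?_
        have i1 : (2 : ℝ≥0∞)⁻¹ ^ (k + 1) ≠ ∞ := ENNReal.pow_ne_top (by simp)
        have i2 : ((ENNReal.ofReal N ^ q) ^ k)⁻¹ ≠ ∞ := by simpa using pow_ne_zero k hNp
        simp_rw [lintegral_const_mul' _ _ i1, lintegral_const_mul' _ _ h2t,
          lintegral_const_mul' _ _ i2]
    _ ≤ ∑' k : ℕ, (2 : ℝ≥0∞)⁻¹ ^ (k + 1) * (2 ^ q * ∫⁻ y, ∫⁻ x, w x y ^ q) := by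
        refine ENNReal.tsum_le_tsum fun k => ?_
        gcongr
        refine (mul_le_mul_right (iter k) _).trans (le_of_eq ?_)
        rw [← mul_assoc, ENNReal.inv_mul_cancel (pow_ne_zero k hNp) (ENNReal.pow_ne_top hNt),
          one_mul]
    _ = _ := by rw [ENNReal.tsum_mul_right, mass, one_mul]

/-! ### Decay factors -/

/-- The decay factor `1 / (1 + |x - c| / L)` away from an interval of centre `c` and length `L`. -/
def decay (c L x : ℝ) : ℝ := (1 + |x - c| / L)⁻¹

theorem decay_pos {L : ℝ} (hL : 0 < L) (c x : ℝ) : 0 < decay c L x := by unfold decay; positivity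

theorem decay_le_one {L : ℝ} (hL : 0 < L) (c x : ℝ) : decay c L x ≤ 1 :=
  inv_le_one_of_one_le₀ (le_add_of_nonneg_right (by positivity))

theorem decay_comm (c L x : ℝ) : decay c L x = decay x L c := by
  unfold decay; rw [abs_sub_comm]

theorem decay_le_two_mul {c L x y : ℝ} (hL : 0 < L) (h : |x - y| ≤ L) :
    decay c L x ≤ 2 * decay c L y := by
  unfold decay
  rw [← div_eq_mul_inv, inv_eq_one_div, div_le_div_iff₀ (by positivity) (by positivity)]
  have h1 : |y - c| ≤ |x - c| + L := by
    have := abs_sub_le y x c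
    rw [abs_sub_comm y x] at this
    linarith
  have h2 : |y - c| / L ≤ |x - c| / L + 1 := by
    rw [div_le_iff₀ hL, add_mul, one_mul, div_mul_cancel₀ _ hL.ne']; exact h1
  have : 0 ≤ |x - c| / L := by positivity
  linarith

theorem decay_mono {L L' : ℝ} (hL : 0 < L) (h : L ≤ L') (c x : ℝ) :
    decay c L x ≤ decay c L' x := by
  unfold decay
  gcongr
  exact add_pos_of_pos_of_nonneg one_pos (div_nonneg (abs_nonneg _) (hL.le.trans h))

theorem decay_pow_le {L : ℝ} (hL : 0 < L) (c x : ℝ) {m n : ℕ} (h : m ≤ n) :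
    decay c L x ^ n ≤ decay c L x ^ m :=
  pow_le_pow_of_le_one (decay_pos hL c x).le (decay_le_one hL c x) h

theorem continuous_decay {L : ℝ} (hL : 0 < L) (c : ℝ) : Continuous (decay c L) := by
  unfold decay
  exact Continuous.inv₀ (by fun_prop) fun x => by positivity

/-- The constant `2 * ∑ 1 / n ^ 2`, which bounds the normalized integral of the cube of a decay
factor. -/
def decayConst : ℝ := 2 * ∑' i : ℕ, (((i : ℝ) + 1) ^ 2)⁻¹

theorem summable_inv_succ_sq : Summable fun i : ℕ => (((i : ℝ) + 1) ^ 2)⁻¹ := by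
  have := (summable_nat_add_iff 1).2 (Real.summable_nat_pow_inv.2 (by norm_num : 1 < 2))
  simpa using this

theorem two_le_decayConst : 2 ≤ decayConst := by
  have := summable_inv_succ_sq.le_tsum 0 (fun i _ => by positivity)
  unfold decayConst
  simp at this
  linarith

/-- Weighted integrals of the decay factor are controlled by values of an `A₁` weight. -/
theorem IsA1.lintegral_decay_le {Q : ℝ} {w : ℝ → ℝ≥0∞} (h : IsA1 Q w) (hQ : 0 ≤ Q)
    (hw : Measurable w) {c L x : ℝ} (hL : 0 < L) (hx : |x - c| ≤ L) :
    ∫⁻ y, ENNReal.ofReal (decay c L y ^ 3) * w y ≤ ENNReal.ofReal (decayConst * Q * L) * w x := by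
  have dom : ∀ y, ENNReal.ofReal (decay c L y ^ 3) * w y ≤ ∑' i : ℕ,
      Set.indicator (Set.Icc (c - (i + 1) * L) (c + (i + 1) * L))
        (fun y => ENNReal.ofReal ((((i : ℝ) + 1) ^ 3)⁻¹) * w y) y := by
    intro y
    set i := ⌊|y - c| / L⌋₊
    have h0 : 0 ≤ |y - c| / L := by positivity
    have h1 : (i : ℝ) ≤ |y - c| / L := Nat.floor_le h0
    have h2 : |y - c| / L < i + 1 := Nat.lt_floor_add_one _
    refine le_trans ?_ (ENNReal.le_tsum i)
    have hy : y ∈ Set.Icc (c - (i + 1) * L) (c + (i + 1) * L) := by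
      rw [div_lt_iff₀ hL] at h2
      have := abs_lt.1 h2
      exact ⟨by linarith, by linarith⟩
    rw [Set.indicator_of_mem hy]
    gcongr
    rw [decay, inv_pow]
    refine inv_anti₀ (by positivity) (pow_le_pow_left₀ (by positivity) ?_ 3)
    linarith
  calc _ ≤ ∫⁻ y, ∑' i : ℕ, Set.indicator (Set.Icc (c - (i + 1) * L) (c + (i + 1) * L))
        (fun y => ENNReal.ofReal ((((i : ℝ) + 1) ^ 3)⁻¹) * w y) y := lintegral_mono dom
    _ = ∑' i : ℕ, ENNReal.ofReal ((((i : ℝ) + 1) ^ 3)⁻¹) *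
        ∫⁻ y in Set.Icc (c - (i + 1) * L) (c + (i + 1) * L), w y := by
        rw [lintegral_tsum fun i => ((hw.const_mul _).indicator measurableSet_Icc).aemeasurable]
        refine tsum_congr fun i => ?_
        rw [lintegral_indicator measurableSet_Icc, lintegral_const_mul' _ _ ENNReal.ofReal_ne_top]
    _ ≤ ∑' i : ℕ, ENNReal.ofReal (2 * Q * L * (((i : ℝ) + 1) ^ 2)⁻¹) * w x := by
        refine ENNReal.tsum_le_tsum fun i => ?_
        have hpos : (0 : ℝ) < (i + 1) * L := by positivity
        have hmem : x ∈ Set.Icc (c - (i + 1) * L) (c + (i + 1) * L) := by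
          have := abs_le.1 hx
          have hi : (0 : ℝ) ≤ i * L := by positivity
          exact ⟨by linarith, by linarith⟩
        calc _ ≤ ENNReal.ofReal ((((i : ℝ) + 1) ^ 3)⁻¹) *
              (ENNReal.ofReal (Q * (c + (i + 1) * L - (c - (i + 1) * L))) * w x) := by
              gcongr; exact h _ _ (by linarith) x hmem
          _ = _ := by
              rw [← mul_assoc, ← ENNReal.ofReal_mul (by positivity)]
              congr 2
              field_simp
              ring
    _ = _ := by
        rw [ENNReal.tsum_mul_right, ← ENNReal.ofReal_tsum_of_nonneg (fun i => by positivity)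
          (summable_inv_succ_sq.mul_left _), tsum_mul_left]
        congr 2
        unfold decayConst; ring

theorem isA1_const {Q : ℝ} (hQ : 1 ≤ Q) (c : ℝ≥0∞) : IsA1 Q fun _ => c := by
  intro a b hab x _
  rw [setLIntegral_const, Real.volume_Icc, mul_comm]
  gcongr
  nlinarith

theorem lintegral_decay_le {c L : ℝ} (hL : 0 < L) :
    ∫⁻ y, ENNReal.ofReal (decay c L y ^ 3) ≤ ENNReal.ofReal (decayConst * L) := by
  simpa using (isA1_const le_rfl 1).lintegral_decay_le zero_le_one measurable_const hL
    (show |c - c| ≤ L by simpa using hL.le)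

theorem integrable_decay {L : ℝ} (hL : 0 < L) (c : ℝ) : Integrable fun y => decay c L y ^ 3 := by
  refine ⟨((continuous_decay hL c).pow 3).aestronglyMeasurable, ?_⟩
  rw [hasFiniteIntegral_iff_ofReal (Eventually.of_forall fun y => pow_nonneg (decay_pos hL c y).le 3)]
  exact (lintegral_decay_le hL).trans_lt ENNReal.ofReal_lt_top

theorem integral_decay_le {L : ℝ} (hL : 0 < L) (c : ℝ) :
    ∫ y, decay c L y ^ 3 ≤ decayConst * L := by
  rw [integral_eq_lintegral_of_nonneg_ae
    (Eventually.of_forall fun y => pow_nonneg (decay_pos hL c y).le 3)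
    ((continuous_decay hL c).pow 3).aestronglyMeasurable]
  exact ENNReal.toReal_le_of_le_ofReal
    (mul_nonneg (zero_le_two.trans two_le_decayConst) hL.le) (lintegral_decay_le hL)

/-- Sums of decay factors over points spread out by disjoint intervals of length at least `L`. -/
theorem tsum_decay_le {ι : Type*} [Countable ι] {s : ι → Set ℝ} (hs : ∀ i, MeasurableSet (s i))
    (hd : Pairwise (Function.onFun Disjoint s)) {L L' : ℝ} (hL : 0 < L) (hLL : L ≤ L')
    (hv : ∀ i, volume (s i) = ENNReal.ofReal L') {p : ι → ℝ} (hp : ∀ i, ∀ y ∈ s i, |p i - y| ≤ L')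
    (e : ℝ) : ∑' i, ENNReal.ofReal (decay e L (p i) ^ 3) ≤ ENNReal.ofReal (8 * decayConst) := by
  have hL' : 0 < L' := hL.trans_le hLL
  have term : ∀ i, ENNReal.ofReal L' * ENNReal.ofReal (decay e L (p i) ^ 3) ≤
      8 * ∫⁻ y in s i, ENNReal.ofReal (decay e L' y ^ 3) := by
    intro i
    rw [← lintegral_const_mul' _ _ (by simp), ← hv i, mul_comm, ← setLIntegral_const]
    refine setLIntegral_mono' (hs i) fun y hy => ?_
    rw [← ENNReal.ofReal_ofNat, ← ENNReal.ofReal_mul (by norm_num)]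
    refine ENNReal.ofReal_le_ofReal ?_
    calc _ ≤ decay e L' (p i) ^ 3 := by
          have := decay_pos hL e (p i)
          gcongr
          exact decay_mono hL hLL _ _
      _ ≤ (2 * decay e L' y) ^ 3 := by
          have := decay_pos hL' e (p i)
          gcongr
          exact decay_le_two_mul hL' (hp i y hy)
      _ = _ := by ring
  have hne : ENNReal.ofReal L' ≠ 0 := by simpa using hL'
  have main : ENNReal.ofReal L' * ∑' i, ENNReal.ofReal (decay e L (p i) ^ 3) ≤
      ENNReal.ofReal L' * ENNReal.ofReal (8 * decayConst) := by
    calc _ ≤ ∑' i, 8 * ∫⁻ y in s i, ENNReal.ofReal (decay e L' y ^ 3) := by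
          rw [← ENNReal.tsum_mul_left]; exact ENNReal.tsum_le_tsum term
      _ = 8 * ∫⁻ y in ⋃ i, s i, ENNReal.ofReal (decay e L' y ^ 3) := by
          rw [ENNReal.tsum_mul_left, lintegral_iUnion hs hd]
      _ ≤ 8 * ENNReal.ofReal (decayConst * L') := by
          gcongr
          exact (setLIntegral_le_lintegral _ _).trans (lintegral_decay_le hL')
      _ = _ := by
          rw [← ENNReal.ofReal_mul hL'.le, ← ENNReal.ofReal_ofNat,
            ← ENNReal.ofReal_mul (by norm_num)]
          congr 1; ring
  exact (ENNReal.mul_le_mul_iff_right hne ENNReal.ofReal_ne_top).1 main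

/-! ### Haar coefficients of wave packets on the line -/

/-- `f` is a wave packet of height `a` adapted to an interval of centre `c` and length `L`: it
decays, satisfies a Lipschitz estimate at the scale `L`, and has mean zero. -/
structure IsPacket (c L a : ℝ) (f : ℝ → ℂ) : Prop where
  norm_le : ∀ x, ‖f x‖ ≤ a * decay c L x ^ 7
  norm_sub_le : ∀ x x', |x - x'| ≤ L → ‖f x - f x'‖ ≤ a * (|x - x'| / L) * decay c L x ^ 7
  integral_eq_zero : ∫ x, f x = 0

theorem IsPacket.continuous {c L a : ℝ} {f : ℝ → ℂ} (h : IsPacket c L a f) (hL : 0 < L)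
    (ha : 0 ≤ a) : Continuous f := by
  refine continuous_iff_continuousAt.2 fun x => ?_
  rw [ContinuousAt, tendsto_iff_norm_sub_tendsto_zero]
  have hlim : Tendsto (fun y : ℝ => a * (|y - x| / L)) (𝓝 x) (𝓝 0) := by
    have : Continuous fun y : ℝ => a * (|y - x| / L) := by fun_prop
    simpa using this.tendsto x
  refine squeeze_zero' (Eventually.of_forall fun _ => norm_nonneg _) ?_ hlim
  filter_upwards [Metric.ball_mem_nhds x hL] with y hy
  rw [Metric.mem_ball, Real.dist_eq] at hy
  refine (h.norm_sub_le y x hy.le).trans (mul_le_of_le_one_right (by positivity) ?_)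
  exact pow_le_one₀ (decay_pos hL c y).le (decay_le_one hL c y)

theorem IsPacket.integrable {c L a : ℝ} {f : ℝ → ℂ} (h : IsPacket c L a f) (hL : 0 < L)
    (ha : 0 ≤ a) : Integrable f := by
  refine ((integrable_decay hL c).const_mul a).mono' (h.continuous hL ha).aestronglyMeasurable
    (Eventually.of_forall fun x => (h.norm_le x).trans ?_)
  gcongr ?_ * ?_
  exact decay_pow_le hL c x (by norm_num)

theorem IsPacket.norm_setIntegral_le {c L a : ℝ} {f : ℝ → ℂ} (h : IsPacket c L a f) (hL : 0 < L)
    (ha : 0 ≤ a) {s : Set ℝ} (hs : MeasurableSet s) {e : ℝ}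
    (hse : ∀ x ∈ s, decay c L x ≤ decay c L e) :
    ‖∫ x in s, f x‖ ≤ a * decayConst * L * decay c L e ^ 4 := by
  have hi := (integrable_decay hL c).const_mul (a * decay c L e ^ 4)
  calc _ ≤ ∫ x in s, a * decay c L e ^ 4 * decay c L x ^ 3 := by
        refine norm_integral_le_of_norm_le hi.integrableOn ?_
        filter_upwards [ae_restrict_mem hs] with x hx
        refine (h.norm_le x).trans ?_
        have := (decay_pos hL c x).le
        rw [mul_assoc]
        gcongr ?_ * ?_
        calc decay c L x ^ 7 = decay c L x ^ 4 * decay c L x ^ 3 := by ring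
          _ ≤ _ := by gcongr; exact hse x hx
    _ ≤ ∫ x, a * decay c L e ^ 4 * decay c L x ^ 3 :=
        setIntegral_le_integral hi (Eventually.of_forall fun x => by
          have := (decay_pos hL c x).le
          have := (decay_pos hL c e).le
          positivity)
    _ ≤ _ := by
        rw [integral_const_mul]
        have := (decay_pos hL c e).le
        calc _ ≤ a * decay c L e ^ 4 * (decayConst * L) := by
              gcongr; exact integral_decay_le hL c
          _ = _ := by ring

/-- The mean zero condition gives decay of the primitive. -/
theorem IsPacket.norm_integral_Iio_le {c L a : ℝ} {f : ℝ → ℂ} (h : IsPacket c L a f) (hL : 0 < L)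
    (ha : 0 ≤ a) (e : ℝ) : ‖∫ x in Set.Iio e, f x‖ ≤ a * decayConst * L * decay c L e ^ 4 := by
  have mono : ∀ x, |e - c| ≤ |x - c| → decay c L x ≤ decay c L e := fun x hx => by
    unfold decay; gcongr
  rcases le_total e c with hec | hec
  · refine h.norm_setIntegral_le hL ha measurableSet_Iio fun x hx => mono x ?_
    have hx' : x < e := hx
    rw [abs_of_nonpos (by linarith), abs_of_nonpos (by linarith)]
    linarith
  · have e1 : ∫ x in Set.Iio e, f x = - ∫ x in Set.Ici e, f x := by
      have := integral_add_compl (measurableSet_Iio (a := e)) (h.integrable hL ha)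
      rw [h.integral_eq_zero, Set.compl_Iio] at this
      exact eq_neg_of_add_eq_zero_left this
    rw [e1, norm_neg]
    refine h.norm_setIntegral_le hL ha measurableSet_Ici fun x hx => mono x ?_
    have hx' : e ≤ x := hx
    rw [abs_of_nonneg (by linarith), abs_of_nonneg (by linarith)]
    linarith

theorem IsPacket.integral_Ico {c L a : ℝ} {f : ℝ → ℂ} (h : IsPacket c L a f) (hL : 0 < L)
    (ha : 0 ≤ a) {u v : ℝ} (huv : u ≤ v) :
    ∫ x in Set.Ico u v, f x = (∫ x in Set.Iio v, f x) - ∫ x in Set.Iio u, f x := by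
  have hi := h.integrable hL ha
  have hd : Disjoint (Set.Iio u) (Set.Ico u v) :=
    Set.disjoint_left.2 fun x hx hx' => absurd hx'.1 (not_le.2 hx)
  rw [← Set.Iio_union_Ico_eq_Iio huv, setIntegral_union hd measurableSet_Ico
    hi.integrableOn hi.integrableOn]
  ring

/-- The matrix bounding the (normalized) Haar coefficients of a wave packet adapted to an interval
of centre `c` and length `L`. For a dyadic interval shorter than `L` the packet is smooth at the
dyadic scale; for a longer one, only packets close to one of the three points where the Haar
function jumps contribute. -/
def haarKernel (c L : ℝ) (n k : ℤ) : ℝ :=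
  if (2 : ℝ) ^ (-n) ≤ L then
    √(2 ^ (-n) / L) * (2 ^ (-n) / L * decay c L ((k + 1 / 2) * 2 ^ (-n)) ^ 7)
  else
    √(L / 2 ^ (-n)) * (decay c L (k * 2 ^ (-n)) ^ 4 + decay c L ((k + 1 / 2) * 2 ^ (-n)) ^ 4 +
      decay c L ((k + 1) * 2 ^ (-n)) ^ 4)

theorem haarKernel_nonneg {L : ℝ} (hL : 0 < L) (c : ℝ) (n k : ℤ) : 0 ≤ haarKernel c L n k := by
  have h := fun x => (decay_pos hL c x).le
  unfold haarKernel
  split_ifs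
  · have := h ((k + 1 / 2) * 2 ^ (-n)); positivity
  · have h1 := h (k * 2 ^ (-n))
    have h2 := h ((k + 1 / 2) * 2 ^ (-n))
    have h3 := h ((k + 1) * 2 ^ (-n))
    positivity

/-- The absolute constant in the bound for the Haar coefficients of a wave packet. -/
def haarConst : ℝ := 32 + 2 * decayConst

theorem dyadic_halves (n k : ℤ) :
    dyadic (n + 1) (2 * k) = Set.Ico (k * 2 ^ (-n) : ℝ) ((k + 1 / 2) * 2 ^ (-n)) ∧
    dyadic (n + 1) (2 * k + 1) = Set.Ico ((k + 1 / 2) * 2 ^ (-n) : ℝ) ((k + 1) * 2 ^ (-n)) := by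
  have h : (2 : ℝ) ^ (-n) = 2 * 2 ^ (-(n + 1)) := by
    rw [← two_zpow_succ]; congr 1; ring
  unfold dyadic
  rw [h]
  push_cast
  constructor <;> congr 1 <;> ring

theorem IsPacket.norm_haarCoeff_le {c L a : ℝ} {f : ℝ → ℂ} (h : IsPacket c L a f) (hL : 0 < L)
    (ha : 0 ≤ a) (n k : ℤ) :
    ‖haarCoeff f n k‖ ≤ haarConst * a * (√L * √(2 ^ (-n)) * haarKernel c L n k) := by
  obtain ⟨l, hl⟩ : ∃ l : ℝ, l = 2 ^ (-n) := ⟨_, rfl⟩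
  have hl0 : 0 < l := by rw [hl]; positivity
  have hi := h.integrable hL ha
  have hκ := two_le_decayConst
  unfold haarCoeff haarKernel haarConst
  rw [(dyadic_halves n k).1, (dyadic_halves n k).2, ← hl]
  have D := fun x => (decay_pos hL c x).le
  obtain ⟨m, hm⟩ : ∃ m : ℝ, m = (k + 1 / 2) * l := ⟨_, rfl⟩
  have e1 : (k : ℝ) * l = m - l / 2 := by rw [hm]; ring
  have e2 : ((k : ℝ) + 1) * l = m + l / 2 := by rw [hm]; ring
  rw [← hm, e1, e2]
  split_ifs with hc
  · have shift : ∫ x in Set.Ico m (m + l / 2), f x = ∫ x in Set.Ico (m - l / 2) m, f (x + l / 2) := by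
      have hmp := measurePreserving_add_right (volume : Measure ℝ) (l / 2)
      have := hmp.setIntegral_preimage_emb (measurableEmbedding_addRight (l / 2)) f
        (Set.Ico m (m + l / 2))
      rw [← this]
      congr 2
      ext x
      simp only [Set.mem_preimage, Set.mem_Ico]
      constructor <;> rintro ⟨h1, h2⟩ <;> constructor <;> linarith
    rw [shift, ← integral_sub hi.integrableOn (hi.comp_add_right (l / 2)).integrableOn]
    have bd : ∀ x ∈ Set.Ico (m - l / 2) m, ‖f x - f (x + l / 2)‖ ≤
        a * (l / 2 / L) * (2 * decay c L m) ^ 7 := by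
      intro x hx
      have e : |x - (x + l / 2)| = l / 2 := by
        rw [show x - (x + l / 2) = -(l / 2) by ring, abs_neg, abs_of_pos (by positivity)]
      refine (h.norm_sub_le x (x + l / 2) (by rw [e]; linarith)).trans ?_
      rw [e]
      have := D x
      gcongr
      refine decay_le_two_mul hL ?_
      rw [abs_le]
      constructor <;> linarith [hx.1, hx.2]
    refine (norm_setIntegral_le_of_norm_le_const (by simp) bd).trans ?_
    rw [measureReal_def, Real.volume_Ico, show m - (m - l / 2) = l / 2 by ring,
      ENNReal.toReal_ofReal (by positivity)]
    have es : √L * √l * (√(l / L) * (l / L * decay c L m ^ 7)) = l ^ 2 / L * decay c L m ^ 7 := by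
      rw [Real.sqrt_div hl0.le]
      have h1 : √L ≠ 0 := (Real.sqrt_pos.2 hL).ne'
      field_simp
      rw [Real.sq_sqrt hl0.le]
    rw [es]
    have h0 : 0 ≤ a * (l ^ 2 / L * decay c L m ^ 7) := by have := D m; positivity
    calc _ = 32 * (a * (l ^ 2 / L * decay c L m ^ 7)) := by ring
      _ ≤ _ := by nlinarith
  · rw [h.integral_Ico hL ha (by linarith), h.integral_Ico hL ha (by linarith)]
    have b := h.norm_integral_Iio_le hL ha
    have es : ∀ X, √L * √l * (√(L / l) * X) = L * X := by
      intro X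
      rw [Real.sqrt_div hL.le]
      have h1 : √l ≠ 0 := (Real.sqrt_pos.2 hl0).ne'
      field_simp
      rw [Real.sq_sqrt hL.le, mul_comm]
    rw [es]
    set A := ∫ x in Set.Iio m, f x
    set B := ∫ x in Set.Iio (m - l / 2), f x
    set E := ∫ x in Set.Iio (m + l / 2), f x
    have t : ‖A - B - (E - A)‖ ≤ ‖A‖ + ‖B‖ + (‖E‖ + ‖A‖) :=
      (_root_.norm_sub_le _ _).trans (add_le_add (_root_.norm_sub_le _ _) (_root_.norm_sub_le _ _))
    have x1 := b m
    have x2 := b (m - l / 2)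
    have x3 := b (m + l / 2)
    have n1 : 0 ≤ a * L * decay c L m ^ 4 := by have := D m; positivity
    have n2 : 0 ≤ a * L * decay c L (m - l / 2) ^ 4 := by have := D (m - l / 2); positivity
    have n3 : 0 ≤ a * L * decay c L (m + l / 2) ^ 4 := by have := D (m + l / 2); positivity
    nlinarith [mul_nonneg (zero_le_two.trans hκ) n1, mul_nonneg (zero_le_two.trans hκ) n2,
      mul_nonneg (zero_le_two.trans hκ) n3]

/-! ### Summing the Haar kernel -/

/-- The off-diagonal gain `2 ^ (-|i| / 2)` at a difference `i` of scales. -/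
def scaleGain (i : ℤ) : ℝ := √(1 / 2) ^ i.natAbs

theorem scaleGain_nonneg (i : ℤ) : 0 ≤ scaleGain i := by unfold scaleGain; positivity

theorem summable_scaleGain : Summable scaleGain := by
  have h1 : √(1 / 2 : ℝ) < 1 := by
    rw [Real.sqrt_lt' one_pos]; norm_num
  have hg := summable_geometric_of_lt_one (Real.sqrt_nonneg (1 / 2 : ℝ)) h1
  refine Summable.of_nat_of_neg ?_ ?_
  · simpa [scaleGain] using hg
  · simpa [scaleGain] using hg

/-- The sum of all off-diagonal gains. -/
def gainConst : ℝ := ∑' i, scaleGain i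

theorem tsum_scaleGain_add (j : ℤ) :
    ∑' n, ENNReal.ofReal (scaleGain (n + j)) = ENNReal.ofReal gainConst := by
  rw [gainConst, ENNReal.ofReal_tsum_of_nonneg scaleGain_nonneg summable_scaleGain]
  exact (Equiv.addRight j).tsum_eq fun i => ENNReal.ofReal (scaleGain i)

theorem gainConst_nonneg : 0 ≤ gainConst := tsum_nonneg scaleGain_nonneg

theorem zpow_div_zpow (n j : ℤ) : (2 : ℝ) ^ (-n) / 2 ^ j = 2 ^ (-(n + j)) := by
  rw [← zpow_sub₀ (by norm_num)]; congr 1; ring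

theorem sqrt_two_zpow_neg {i : ℤ} (hi : 0 ≤ i) : √((2 : ℝ) ^ (-i)) = scaleGain i := by
  obtain ⟨m, rfl⟩ := Int.eq_ofNat_of_zero_le hi
  rw [zpow_neg, zpow_natCast, ← inv_pow, Real.sqrt_eq_iff_mul_self_eq (by positivity)
    (scaleGain_nonneg _), scaleGain, Int.natAbs_natCast, ← mul_pow,
    Real.mul_self_sqrt (by norm_num), one_div]

/-- For intervals not shorter than the dyadic scale. -/
theorem haarKernel_of_le {c : ℝ} {n j : ℤ} (h : 0 ≤ n + j) (k : ℤ) :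
    haarKernel c (2 ^ j) n k = scaleGain (n + j) *
      (2 ^ (-n) / 2 ^ j * decay c (2 ^ j) ((k + 1 / 2) * 2 ^ (-n)) ^ 7) := by
  have hle : (2 : ℝ) ^ (-n) ≤ 2 ^ j := zpow_le_zpow_right₀ (by norm_num) (by omega)
  rw [haarKernel, if_pos hle]
  congr 1
  rw [zpow_div_zpow, sqrt_two_zpow_neg h]

/-- For intervals shorter than the dyadic scale. -/
theorem haarKernel_of_lt {c : ℝ} {n j : ℤ} (h : n + j < 0) (k : ℤ) :
    haarKernel c (2 ^ j) n k = scaleGain (n + j) *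
      (decay c (2 ^ j) (k * 2 ^ (-n)) ^ 4 + decay c (2 ^ j) ((k + 1 / 2) * 2 ^ (-n)) ^ 4 +
      decay c (2 ^ j) ((k + 1) * 2 ^ (-n)) ^ 4) := by
  have hle : ¬ (2 : ℝ) ^ (-n) ≤ 2 ^ j := by
    rw [not_le]; exact zpow_lt_zpow_right₀ (by norm_num) (by omega)
  rw [haarKernel, if_neg hle]
  congr 1
  have : scaleGain (n + j) = scaleGain (-(n + j)) := by simp only [scaleGain, Int.natAbs_neg]
  rw [this, ← sqrt_two_zpow_neg (by omega : 0 ≤ -(n + j)), ← zpow_sub₀ (by norm_num)]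
  congr 2
  ring

theorem HalfOpenInterval.length_pos (I : HalfOpenInterval) : 0 < I.length :=
  sub_pos.2 I.left_lt_right

theorem HalfOpenInterval.abs_sub_center_le (I : HalfOpenInterval) {x : ℝ} (hx : x ∈ I.toSet) :
    |x - I.center| ≤ I.length := by
  have h1 := hx.1
  have h2 := hx.2
  rw [abs_le, HalfOpenInterval.center, HalfOpenInterval.length]
  constructor <;> linarith

theorem HalfOpenInterval.volume_toSet (I : HalfOpenInterval) :
    volume I.toSet = ENNReal.ofReal I.length := Real.volume_Ico

theorem HalfOpenInterval.eq_of_subset {I I' : HalfOpenInterval} (h : I.toSet ⊆ I'.toSet)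
    (hl : I.length = I'.length) : I = I' := by
  have h1 := (Set.Ico_subset_Ico_iff I.left_lt_right).1 h
  unfold HalfOpenInterval.length at hl
  ext <;> linarith [h1.1, h1.2]

/-- Intervals of a grid with the same length are disjoint. -/
theorem IsGrid.disjoint {G : Set HalfOpenInterval} (hG : IsGrid G) {I I' : HalfOpenInterval}
    (hI : I ∈ G) (hI' : I' ∈ G) (hl : I.length = I'.length) (hne : I ≠ I') :
    Disjoint I.toSet I'.toSet := by
  rcases hG I hI I' hI' with h | h | h
  · exact Set.disjoint_iff_inter_eq_empty.2 h
  · exact absurd (HalfOpenInterval.eq_of_subset (Set.inter_eq_left.1 h) hl) hne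
  · exact absurd (HalfOpenInterval.eq_of_subset (Set.inter_eq_right.1 h) hl.symm).symm hne

theorem sum_decay_center_le {G : Set HalfOpenInterval} (hG : IsGrid G) {S : Finset HalfOpenInterval}
    (hS : ∀ I ∈ S, I ∈ G) {L : ℝ} (hL : 0 < L) (hl : ∀ I ∈ S, I.length = L) (e : ℝ) :
    ∑ I ∈ S, ENNReal.ofReal (decay I.center L e ^ 3) ≤ ENNReal.ofReal (8 * decayConst) := by
  rw [← Finset.sum_coe_sort, ← tsum_fintype (L := .unconditional _)]
  simp_rw [decay_comm _ _ e]
  refine tsum_decay_le (s := fun I : S => I.1.toSet) (fun I => measurableSet_Ico) ?_ hL le_rfl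
    (fun I => by rw [I.1.volume_toSet, hl _ I.2]) (fun I y hy => ?_) e
  · intro I I' hne
    exact hG.disjoint (hS _ I.2) (hS _ I'.2) ((hl _ I.2).trans (hl _ I'.2).symm)
      (fun h => hne (Subtype.ext h))
  · rw [abs_sub_comm, ← hl _ I.2]
    exact I.1.abs_sub_center_le hy

/-- The columns of the Haar kernel are summable, uniformly. -/
theorem sum_haarKernel_le {G : Set HalfOpenInterval} (hG : IsDyadicGrid G)
    {S : Finset HalfOpenInterval} (hS : ∀ I ∈ S, I ∈ G) (n k : ℤ) :
    ∑ I ∈ S, ENNReal.ofReal (haarKernel I.center I.length n k) ≤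
      ENNReal.ofReal (24 * decayConst * gainConst) := by
  classical
  have hκ : 0 ≤ decayConst := zero_le_two.trans two_le_decayConst
  have single : ∀ j : ℤ, ∑ I ∈ S with I.length = 2 ^ j,
      ENNReal.ofReal (haarKernel I.center I.length n k) ≤
        ENNReal.ofReal (24 * decayConst) * ENNReal.ofReal (scaleGain (n + j)) := by
    intro j
    have hL : (0 : ℝ) < 2 ^ j := by positivity
    have base := fun e => sum_decay_center_le hG.1 (S := S.filter fun I => I.length = 2 ^ j)
      (fun I hI => hS I (Finset.mem_filter.1 hI).1) hL (fun I hI => (Finset.mem_filter.1 hI).2) e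
    have e24 : ENNReal.ofReal (24 * decayConst) = 3 * ENNReal.ofReal (8 * decayConst) := by
      rw [← ENNReal.ofReal_ofNat 3, ← ENNReal.ofReal_mul (by norm_num)]; congr 1; ring
    rcases le_or_gt 0 (n + j) with h | h
    · calc _ ≤ ∑ I ∈ S with I.length = 2 ^ j, ENNReal.ofReal (scaleGain (n + j)) *
            ENNReal.ofReal (decay I.center (2 ^ j) ((k + 1 / 2) * 2 ^ (-n)) ^ 3) := by
            refine Finset.sum_le_sum fun I hI => ?_
            rw [(Finset.mem_filter.1 hI).2, haarKernel_of_le h, ← ENNReal.ofReal_mul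
              (scaleGain_nonneg _)]
            refine ENNReal.ofReal_le_ofReal (mul_le_mul_of_nonneg_left ?_ (scaleGain_nonneg _))
            have := (decay_pos hL I.center ((k + 1 / 2) * 2 ^ (-n))).le
            refine (mul_le_of_le_one_left (by positivity) ?_).trans (decay_pow_le hL _ _ (by norm_num))
            rw [zpow_div_zpow]
            exact zpow_le_one_of_nonpos₀ (by norm_num) (by omega)
        _ ≤ ENNReal.ofReal (scaleGain (n + j)) * ENNReal.ofReal (8 * decayConst) := by
            rw [← Finset.mul_sum]; gcongr; exact base _
        _ ≤ _ := by
            rw [mul_comm]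
            gcongr
            linarith
    · calc _ ≤ ∑ I ∈ S with I.length = 2 ^ j, ENNReal.ofReal (scaleGain (n + j)) *
            (ENNReal.ofReal (decay I.center (2 ^ j) (k * 2 ^ (-n)) ^ 3) +
              ENNReal.ofReal (decay I.center (2 ^ j) ((k + 1 / 2) * 2 ^ (-n)) ^ 3) +
              ENNReal.ofReal (decay I.center (2 ^ j) ((k + 1) * 2 ^ (-n)) ^ 3)) := by
            refine Finset.sum_le_sum fun I hI => ?_
            have D := fun x => pow_nonneg (decay_pos hL I.center x).le 3
            rw [(Finset.mem_filter.1 hI).2, haarKernel_of_lt h,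
              ← ENNReal.ofReal_add (D _) (D _), ← ENNReal.ofReal_add (add_nonneg (D _) (D _)) (D _),
              ← ENNReal.ofReal_mul (scaleGain_nonneg _)]
            refine ENNReal.ofReal_le_ofReal (mul_le_mul_of_nonneg_left ?_ (scaleGain_nonneg _))
            exact add_le_add (add_le_add (decay_pow_le hL _ _ (by norm_num))
              (decay_pow_le hL _ _ (by norm_num))) (decay_pow_le hL _ _ (by norm_num))
        _ ≤ ENNReal.ofReal (scaleGain (n + j)) * (ENNReal.ofReal (8 * decayConst) +
            ENNReal.ofReal (8 * decayConst) + ENNReal.ofReal (8 * decayConst)) := by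
            rw [← Finset.mul_sum, Finset.sum_add_distrib, Finset.sum_add_distrib]
            gcongr <;> exact base _
        _ = _ := by rw [e24]; ring
  calc _ ≤ ∑ I ∈ S, ∑' j : ℤ, (if I.length = 2 ^ j then
        ENNReal.ofReal (haarKernel I.center I.length n k) else 0) := by
        refine Finset.sum_le_sum fun I hI => ?_
        obtain ⟨j, hj⟩ := hG.2 I (hS I hI)
        refine le_trans ?_ (ENNReal.le_tsum j)
        rw [if_pos hj]
    _ = ∑' j : ℤ, ∑ I ∈ S with I.length = 2 ^ j,
        ENNReal.ofReal (haarKernel I.center I.length n k) := by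
        rw [← Summable.tsum_finsetSum fun _ _ => ENNReal.summable]
        simp_rw [Finset.sum_filter]
    _ ≤ ∑' j : ℤ, ENNReal.ofReal (24 * decayConst) * ENNReal.ofReal (scaleGain (n + j)) :=
        ENNReal.tsum_le_tsum single
    _ = _ := by
        simp_rw [add_comm n]
        rw [ENNReal.tsum_mul_left, tsum_scaleGain_add, ← ENNReal.ofReal_mul (by positivity)]

theorem abs_sub_le_of_mem_Icc {u v x y : ℝ} (hx : x ∈ Set.Icc u v) (hy : y ∈ Set.Icc u v) :
    |x - y| ≤ v - u := by
  rw [abs_le]; constructor <;> linarith [hx.1, hx.2, hy.1, hy.2]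

/-- The three jump points of a Haar function. -/
theorem mem_Icc_dyadic (n k : ℤ) {θ : ℝ} (h0 : 0 ≤ θ) (h1 : θ ≤ 1) :
    ((k : ℝ) + θ) * 2 ^ (-n) ∈ Set.Icc ((k : ℝ) * 2 ^ (-n)) (((k : ℝ) + 1) * 2 ^ (-n)) := by
  have : (0 : ℝ) < 2 ^ (-n) := by positivity
  constructor <;> gcongr
  linarith

theorem tsum_decay_dyadic_le {c L : ℝ} (hL : 0 < L) {n : ℤ} (hn : L ≤ 2 ^ (-n)) {θ : ℝ}
    (h0 : 0 ≤ θ) (h1 : θ ≤ 1) :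
    ∑' k : ℤ, ENNReal.ofReal (decay c L ((k + θ) * 2 ^ (-n)) ^ 3) ≤
      ENNReal.ofReal (8 * decayConst) := by
  refine tsum_decay_le (s := dyadic n) (measurableSet_dyadic n) (pairwise_disjoint_dyadic n) hL hn
    (fun k => volume_dyadic n k) (fun k y hy => ?_) c
  refine (abs_sub_le_of_mem_Icc (mem_Icc_dyadic n k h0 h1) (Set.Ico_subset_Icc_self hy)).trans ?_
  linarith

/-- The average of an `A₁` weight over a long dyadic interval, compared with its value at a point
of an interval of centre `c` and length `L`. -/
theorem IsA1.decay_mul_dyAvgW_le {Q : ℝ} {w : ℝ → ℝ≥0∞} (h : IsA1 Q w) (hQ : 0 ≤ Q)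
    {c L x : ℝ} (hL : 0 < L) (hx : |x - c| ≤ L) {n : ℤ} (hn : L ≤ 2 ^ (-n)) (k : ℤ) {θ : ℝ}
    (h0 : 0 ≤ θ) (h1 : θ ≤ 1) :
    ENNReal.ofReal (decay c L ((k + θ) * 2 ^ (-n))) * dyAvgW w n k ≤
      ENNReal.ofReal (2 * Q) * w x := by
  obtain ⟨l, hl⟩ : ∃ l : ℝ, l = 2 ^ (-n) := ⟨_, rfl⟩
  have hl0 : 0 < l := by rw [hl]; positivity
  have hinv : (2 : ℝ) ^ n = l⁻¹ := by rw [hl, zpow_neg, inv_inv]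
  have hmem := mem_Icc_dyadic n k h0 h1
  unfold dyAvgW dyadic
  rw [hinv]
  rw [← hl] at hn hmem ⊢
  obtain ⟨e, he⟩ : ∃ e, e = ((k : ℝ) + θ) * l := ⟨_, rfl⟩
  obtain ⟨u, hu⟩ : ∃ u, u = (k : ℝ) * l := ⟨_, rfl⟩
  obtain ⟨v, hv⟩ : ∃ v, v = ((k : ℝ) + 1) * l := ⟨_, rfl⟩
  rw [← he, ← hu, ← hv] at hmem
  rw [← he, ← hu, ← hv]
  have huv : v = u + l := by rw [hu, hv]; ring
  have hlen : max x v - min x u ≤ |x - e| + l := by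
    have := neg_abs_le (x - e)
    have := le_abs_self (x - e)
    rcases max_cases x v with ⟨h3, _⟩ | ⟨h3, _⟩ <;> rcases min_cases x u with ⟨h4, _⟩ | ⟨h4, _⟩ <;>
      rw [h3, h4] <;> linarith [hmem.1, hmem.2]
  have hxe : |x - e| ≤ |e - c| + L := by
    have := abs_sub_le x c e
    rw [abs_sub_comm c e] at this
    linarith
  have hlt : min x u < max x v := by
    have h3 := min_le_right x u
    have h4 := le_max_right x v
    linarith
  have key : ∫⁻ y in Set.Ico u v, w y ≤ ENNReal.ofReal (Q * (max x v - min x u)) * w x :=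
    (lintegral_mono_set (Set.Ico_subset_Icc_self.trans
      (Set.Icc_subset_Icc (min_le_right _ _) (le_max_right _ _)))).trans
      (h _ _ hlt x ⟨min_le_left _ _, le_max_left _ _⟩)
  have hD : 0 ≤ decay c L e := (decay_pos hL c e).le
  calc _ ≤ ENNReal.ofReal (decay c L e) * (ENNReal.ofReal l⁻¹ *
        (ENNReal.ofReal (Q * (max x v - min x u)) * w x)) := by gcongr
    _ = ENNReal.ofReal (decay c L e * (l⁻¹ * (Q * (max x v - min x u)))) * w x := by
        rw [ENNReal.ofReal_mul hD, ENNReal.ofReal_mul (p := l⁻¹) (by positivity)]; ring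
    _ ≤ _ := by
        refine mul_le_mul_left (ENNReal.ofReal_le_ofReal ?_) _
        calc _ ≤ decay c L e * (l⁻¹ * (Q * (2 * (l * (1 + |e - c| / L))))) := by
              have : max x v - min x u ≤ 2 * (l * (1 + |e - c| / L)) := by
                have : |e - c| ≤ l * (|e - c| / L) := by
                  rw [mul_div_assoc', le_div_iff₀ hL]
                  nlinarith [abs_nonneg (e - c)]
                have h5 := abs_nonneg (e - c)
                nlinarith
              gcongr
          _ = 2 * Q := by
              unfold decay
              have : 1 + |e - c| / L ≠ 0 := by positivity
              field_simp

/-- The rows of the Haar kernel, integrated against an `A₁` weight, reproduce the weight up to the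
factor `Q`. -/
theorem IsA1.tsum_haarKernel_le {Q : ℝ} {w : ℝ → ℝ≥0∞} (h : IsA1 Q w) (hQ : 0 ≤ Q)
    (hw : Measurable w) {c x : ℝ} {j : ℤ} (hx : |x - c| ≤ 2 ^ j) :
    ∑' n, ∑' k, ENNReal.ofReal (haarKernel c (2 ^ j) n k) * dyAvgW w n k ≤
      ENNReal.ofReal (48 * decayConst * gainConst * Q) * w x := by
  have hκ : 0 ≤ decayConst := zero_le_two.trans two_le_decayConst
  have hL : (0 : ℝ) < 2 ^ j := by positivity
  have single : ∀ n : ℤ, ∑' k, ENNReal.ofReal (haarKernel c (2 ^ j) n k) * dyAvgW w n k ≤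
      ENNReal.ofReal (scaleGain (n + j)) * (ENNReal.ofReal (48 * decayConst * Q) * w x) := by
    intro n
    rcases le_or_gt 0 (n + j) with hnj | hnj
    · have hle : (2 : ℝ) ^ (-n) ≤ 2 ^ j := zpow_le_zpow_right₀ (by norm_num) (by omega)
      calc _ ≤ ∑' k, ENNReal.ofReal (scaleGain (n + j)) * (ENNReal.ofReal (8 / 2 ^ j) *
            ∫⁻ y in dyadic n k, ENNReal.ofReal (decay c (2 ^ j) y ^ 3) * w y) := by
            refine ENNReal.tsum_le_tsum fun k => ?_
            obtain ⟨m, hm⟩ : ∃ m : ℝ, m = (k + 1 / 2) * 2 ^ (-n) := ⟨_, rfl⟩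
            have hm' := mem_Icc_dyadic n k (θ := 1 / 2) (by norm_num) (by norm_num)
            have hD := (decay_pos hL c m).le
            rw [haarKernel_of_le hnj, ← hm, ENNReal.ofReal_mul (scaleGain_nonneg _), mul_assoc]
            refine mul_le_mul_right ?_ _
            unfold dyAvgW
            rw [← mul_assoc, ← ENNReal.ofReal_mul (by positivity),
              ← lintegral_const_mul' _ _ ENNReal.ofReal_ne_top,
              ← lintegral_const_mul' _ _ ENNReal.ofReal_ne_top]
            refine setLIntegral_mono' (measurableSet_dyadic n k) fun y hy => ?_
            rw [← mul_assoc, ← ENNReal.ofReal_mul (by positivity)]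
            refine mul_le_mul_left (ENNReal.ofReal_le_ofReal ?_) _
            have h2 : decay c (2 ^ j) m ≤ 2 * decay c (2 ^ j) y := by
              refine decay_le_two_mul hL ?_
              rw [hm]
              refine (abs_sub_le_of_mem_Icc hm' (Set.Ico_subset_Icc_self hy)).trans ?_
              linarith
            have h1 : (2 : ℝ) ^ (-n) * 2 ^ n = 1 := by rw [← zpow_add₀ (by norm_num)]; simp
            calc _ = (2 ^ (-n) * 2 ^ n) / 2 ^ j * decay c (2 ^ j) m ^ 7 := by ring
              _ ≤ 1 / 2 ^ j * (2 * decay c (2 ^ j) y) ^ 3 := by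
                rw [h1]
                gcongr
                exact (decay_pow_le hL c m (by norm_num : 3 ≤ 7)).trans (by gcongr)
              _ = _ := by ring
        _ = ENNReal.ofReal (scaleGain (n + j)) * (ENNReal.ofReal (8 / 2 ^ j) *
            ∫⁻ y, ENNReal.ofReal (decay c (2 ^ j) y ^ 3) * w y) := by
            rw [ENNReal.tsum_mul_left, ENNReal.tsum_mul_left, ← lintegral_eq_tsum_dyadic _ n]
        _ ≤ ENNReal.ofReal (scaleGain (n + j)) * (ENNReal.ofReal (8 / 2 ^ j) *
            (ENNReal.ofReal (decayConst * Q * 2 ^ j) * w x)) := by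
            gcongr
            exact h.lintegral_decay_le hQ hw hL hx
        _ ≤ _ := by
            rw [← mul_assoc (ENNReal.ofReal (8 / 2 ^ j)), ← ENNReal.ofReal_mul (by positivity)]
            refine mul_le_mul_right (mul_le_mul_left (ENNReal.ofReal_le_ofReal ?_) _) _
            rw [show 8 / 2 ^ j * (decayConst * Q * 2 ^ j) = 8 * (decayConst * Q) by field_simp]
            have : 0 ≤ decayConst * Q := by positivity
            nlinarith
    · have hle : (2 : ℝ) ^ j ≤ 2 ^ (-n) := zpow_le_zpow_right₀ (by norm_num) (by omega)
      have piece : ∀ θ : ℝ, 0 ≤ θ → θ ≤ 1 →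
          ∑' k : ℤ, ENNReal.ofReal (decay c (2 ^ j) ((k + θ) * 2 ^ (-n)) ^ 4) * dyAvgW w n k ≤
            ENNReal.ofReal (16 * decayConst * Q) * w x := by
        intro θ h0 h1
        calc _ ≤ ∑' k : ℤ, ENNReal.ofReal (decay c (2 ^ j) ((k + θ) * 2 ^ (-n)) ^ 3) *
              (ENNReal.ofReal (2 * Q) * w x) := by
              refine ENNReal.tsum_le_tsum fun k => ?_
              rw [pow_succ _ 3, ENNReal.ofReal_mul (pow_nonneg (decay_pos hL _ _).le 3), mul_assoc]
              refine mul_le_mul_right ?_ _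
              exact h.decay_mul_dyAvgW_le hQ hL hx hle k h0 h1
          _ ≤ ENNReal.ofReal (8 * decayConst) * (ENNReal.ofReal (2 * Q) * w x) := by
              rw [ENNReal.tsum_mul_right]
              gcongr
              exact tsum_decay_dyadic_le hL hle h0 h1
          _ = _ := by
              rw [← mul_assoc, ← ENNReal.ofReal_mul (by positivity)]; congr 2; ring
      have p0 := piece 0 le_rfl zero_le_one
      have p1 := piece (1 / 2) (by norm_num) (by norm_num)
      have p2 := piece 1 zero_le_one le_rfl
      simp only [add_zero] at p0
      calc _ = ENNReal.ofReal (scaleGain (n + j)) *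
            ((∑' k : ℤ, ENNReal.ofReal (decay c (2 ^ j) (k * 2 ^ (-n)) ^ 4) * dyAvgW w n k) +
            (∑' k : ℤ, ENNReal.ofReal (decay c (2 ^ j) ((k + 1 / 2) * 2 ^ (-n)) ^ 4) *
              dyAvgW w n k) +
            ∑' k : ℤ, ENNReal.ofReal (decay c (2 ^ j) ((k + 1) * 2 ^ (-n)) ^ 4) *
              dyAvgW w n k) := by
            rw [← ENNReal.tsum_add, ← ENNReal.tsum_add, ← ENNReal.tsum_mul_left]
            refine tsum_congr fun k => ?_
            have D := fun x => pow_nonneg (decay_pos hL c x).le 4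
            rw [haarKernel_of_lt hnj, ENNReal.ofReal_mul (scaleGain_nonneg _),
              ENNReal.ofReal_add (add_nonneg (D _) (D _)) (D _), ENNReal.ofReal_add (D _) (D _)]
            ring
        _ ≤ ENNReal.ofReal (scaleGain (n + j)) * (ENNReal.ofReal (16 * decayConst * Q) * w x +
            ENNReal.ofReal (16 * decayConst * Q) * w x +
            ENNReal.ofReal (16 * decayConst * Q) * w x) := by gcongr
        _ = _ := by
            rw [← add_mul, ← add_mul, ← ENNReal.ofReal_add (by positivity) (by positivity),
              ← ENNReal.ofReal_add (by positivity) (by positivity)]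
            congr 3; ring
  calc _ ≤ ∑' n, ENNReal.ofReal (scaleGain (n + j)) *
        (ENNReal.ofReal (48 * decayConst * Q) * w x) := ENNReal.tsum_le_tsum single
    _ = _ := by
        rw [ENNReal.tsum_mul_right, tsum_scaleGain_add, ← mul_assoc,
          ← ENNReal.ofReal_mul gainConst_nonneg]
        congr 2; ring

/-! ### Product wave packets and the two-parameter weighted estimate -/

/-- `ψ` is a product wave packet of height `a` adapted to the product of two intervals with
centres `c₁`, `c₂` and lengths `L₁`, `L₂`. The smoothness in the second variable is expressed by
differences, which are again wave packets in the first variable. -/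
structure IsProdPacket (c₁ L₁ c₂ L₂ a : ℝ) (ψ : ℝ → ℝ → ℂ) : Prop where
  continuous : Continuous (Function.uncurry ψ)
  fst : ∀ y, IsPacket c₁ L₁ (a * decay c₂ L₂ y ^ 7) fun x => ψ x y
  fst_sub : ∀ y y', |y - y'| ≤ L₂ →
    IsPacket c₁ L₁ (a * (|y - y'| / L₂) * decay c₂ L₂ y ^ 7) fun x => ψ x y - ψ x y'
  integral_snd : ∀ x, ∫ y, ψ x y = 0

theorem haarCoeff_sub {f g : ℝ → ℂ} (hf : Integrable f) (hg : Integrable g) (n k : ℤ) :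
    haarCoeff (fun x => f x - g x) n k = haarCoeff f n k - haarCoeff g n k := by
  unfold haarCoeff
  rw [integral_sub hf.integrableOn hg.integrableOn, integral_sub hf.integrableOn hg.integrableOn]
  ring

theorem haarCoeff_sum {ι : Type*} (S : Finset ι) (b : ι → ℂ) {f : ι → ℝ → ℂ}
    (hf : ∀ i ∈ S, Integrable (f i)) (n k : ℤ) :
    haarCoeff (fun x => ∑ i ∈ S, b i * f i x) n k = ∑ i ∈ S, b i * haarCoeff (f i) n k := by
  unfold haarCoeff
  rw [integral_finsetSum _ fun i hi => ((hf i hi).const_mul _).integrableOn,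
    integral_finsetSum _ fun i hi => ((hf i hi).const_mul _).integrableOn, ← Finset.sum_sub_distrib]
  simp_rw [integral_const_mul, mul_sub]

/-- A Haar coefficient in the first variable turns a product wave packet into a wave packet in the
second variable. -/
theorem IsProdPacket.haarCoeff {c₁ L₁ c₂ L₂ a : ℝ} {ψ : ℝ → ℝ → ℂ}
    (h : IsProdPacket c₁ L₁ c₂ L₂ a ψ) (hL₁ : 0 < L₁) (hL₂ : 0 < L₂) (ha : 0 ≤ a) (n k : ℤ) :
    IsPacket c₂ L₂ (haarConst * a * (√L₁ * √(2 ^ (-n)) * haarKernel c₁ L₁ n k))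
      fun y => ProductJN.haarCoeff (fun x => ψ x y) n k := by
  have D := fun y => (decay_pos hL₂ c₂ y).le
  have hint : ∀ y, Integrable fun x => ψ x y := fun y =>
    (h.fst y).integrable hL₁ (by have := D y; positivity)
  refine ⟨fun y => ?_, fun y y' hy => ?_, ?_⟩
  · refine ((h.fst y).norm_haarCoeff_le hL₁ (by have := D y; positivity) n k).trans (le_of_eq ?_)
    ring
  · rw [← haarCoeff_sub (hint y) (hint y')]
    refine ((h.fst_sub y y' hy).norm_haarCoeff_le hL₁ (by have := D y; positivity) n k).trans
      (le_of_eq ?_)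
    ring
  · have prod : ∀ m l : ℤ, Integrable (Function.uncurry fun y x => ψ x y)
        (volume.prod (volume.restrict (dyadic m l))) := by
      intro m l
      have hfin : IsFiniteMeasure (volume.restrict (dyadic m l)) :=
        ⟨by rw [Measure.restrict_apply_univ, volume_dyadic]; exact ENNReal.ofReal_lt_top⟩
      refine (((integrable_decay hL₂ c₂).const_mul a).mul_prod
        (integrable_const (1 : ℝ) (μ := volume.restrict (dyadic m l)))).mono'
        (h.continuous.comp continuous_swap).aestronglyMeasurable (Eventually.of_forall fun z => ?_)
      have := D z.1
      have h1 := decay_pos hL₁ c₁ z.2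
      refine ((h.fst z.1).norm_le z.2).trans ?_
      rw [mul_one]
      refine (mul_le_of_le_one_right (by positivity)
        (pow_le_one₀ h1.le (decay_le_one hL₁ c₁ z.2))).trans ?_
      exact mul_le_mul_of_nonneg_left (decay_pow_le hL₂ c₂ z.1 (by norm_num)) ha
    have zero : ∀ m l : ℤ, ∫ y, ∫ x in dyadic m l, ψ x y = 0 := by
      intro m l
      rw [integral_integral_swap (prod m l)]
      simp [h.integral_snd]
    have i1 : ∀ m l : ℤ, Integrable fun y => ∫ x in dyadic m l, ψ x y :=
      fun m l => (prod m l).integral_prod_left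
    simp only [ProductJN.haarCoeff]
    rw [integral_sub (i1 _ _) (i1 _ _), zero, zero, sub_zero]

theorem measurable_dyAvgW {W : ℝ → ℝ → ℝ≥0∞} (hW : Measurable (Function.uncurry W)) (n k : ℤ) :
    Measurable fun y => dyAvgW (fun x => W x y) n k :=
  (Measurable.lintegral_prod_right' (f := fun z : ℝ × ℝ => W z.2 z.1)
    (hW.comp measurable_swap)).const_mul _

/-- Averaging in one variable preserves the `A₁` condition in the other one. -/
theorem isA1_dyAvgW {W : ℝ → ℝ → ℝ≥0∞} (hW : Measurable (Function.uncurry W)) {Q : ℝ}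
    (h : ∀ x, IsA1 Q (W x)) (n k : ℤ) : IsA1 Q fun y => dyAvgW (fun x => W x y) n k := by
  intro a b hab y hy
  simp only [dyAvgW]
  have swap := lintegral_lintegral_swap (μ := volume.restrict (Set.Icc a b))
    (ν := volume.restrict (dyadic n k)) (f := fun y x => W x y)
    (hW.comp measurable_swap).aemeasurable
  rw [lintegral_const_mul' _ _ ENNReal.ofReal_ne_top, swap, mul_left_comm]
  gcongr
  rw [← lintegral_const_mul' _ _ ENNReal.ofReal_ne_top]
  exact lintegral_mono fun x => h x a b hab y hy

theorem sq_sum_mul_le {ι : Type*} (S : Finset ι) (u f : ι → ℝ≥0∞) :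
    (∑ i ∈ S, u i * f i) ^ 2 ≤ (∑ i ∈ S, u i) * ∑ i ∈ S, u i * f i ^ 2 := by
  have h := ENNReal.inner_le_weight_mul_Lp_of_nonneg S (p := 2) (by norm_num) u f
  calc _ ≤ ((∑ i ∈ S, u i) ^ (1 - (2 : ℝ)⁻¹) * (∑ i ∈ S, u i * f i ^ (2 : ℝ)) ^ (2 : ℝ)⁻¹) ^ 2 := by
        gcongr
    _ = _ := by
        rw [mul_pow, ← ENNReal.rpow_natCast, ← ENNReal.rpow_mul, ← ENNReal.rpow_natCast,
          ← ENNReal.rpow_mul]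
        norm_num

/-- The infimum of a function over the rectangle `R`, in coordinates. -/
def rectInf (W : ℝ → ℝ → ℝ≥0∞) (R : Rect) : ℝ≥0∞ := ⨅ x ∈ R.I.toSet, ⨅ y ∈ R.J.toSet, W x y

/-- The absolute constant in the two-parameter weighted estimate. -/
def weightedConst : ℝ :=
  38 ^ 2 * haarConst ^ 4 * (24 * decayConst * gainConst) ^ 2 * (48 * decayConst * gainConst + 1) ^ 2

theorem one_le_haarConst : 1 ≤ haarConst := by
  unfold haarConst; linarith [two_le_decayConst]

theorem weightedConst_nonneg : 0 ≤ weightedConst := by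
  unfold weightedConst; positivity

section Weighted

variable {𝓘 𝓙 : Set HalfOpenInterval} {S : Finset Rect} {ψ : Rect → ℝ → ℝ → ℂ} {a : ℝ}

theorem sum_haarKernel_mul_le (h𝓘 : IsDyadicGrid 𝓘) (h𝓙 : IsDyadicGrid 𝓙)
    (hS : ∀ R ∈ S, R.I ∈ 𝓘 ∧ R.J ∈ 𝓙) (n k n' k' : ℤ) :
    ∑ R ∈ S, ENNReal.ofReal (haarKernel R.I.center R.I.length n k) *
      ENNReal.ofReal (haarKernel R.J.center R.J.length n' k') ≤
        ENNReal.ofReal ((24 * decayConst * gainConst) ^ 2) := by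
  classical
  have hκ : 0 ≤ 24 * decayConst * gainConst := by
    have := zero_le_two.trans two_le_decayConst
    have := gainConst_nonneg
    positivity
  set F : HalfOpenInterval → ℝ≥0∞ := fun I => ENNReal.ofReal (haarKernel I.center I.length n k)
  set F' : HalfOpenInterval → ℝ≥0∞ := fun J => ENNReal.ofReal (haarKernel J.center J.length n' k')
  have hinj : Set.InjOn (fun R : Rect => (R.I, R.J)) S := fun R _ R' _ h => by
    have h := Prod.mk.inj h
    exact Rect.ext h.1 h.2
  calc _ = ∑ z ∈ S.image fun R : Rect => (R.I, R.J), F z.1 * F' z.2 :=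
        (Finset.sum_image hinj).symm
    _ ≤ ∑ z ∈ S.image Rect.I ×ˢ S.image Rect.J, F z.1 * F' z.2 := by
        refine Finset.sum_le_sum_of_subset fun z hz => ?_
        obtain ⟨R, hR, rfl⟩ := Finset.mem_image.1 hz
        exact Finset.mem_product.2 ⟨Finset.mem_image_of_mem _ hR, Finset.mem_image_of_mem _ hR⟩
    _ = (∑ I ∈ S.image Rect.I, F I) * ∑ J ∈ S.image Rect.J, F' J := by
        rw [Finset.sum_product, Finset.sum_mul]
        simp_rw [Finset.mul_sum]
    _ ≤ ENNReal.ofReal (24 * decayConst * gainConst) *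
        ENNReal.ofReal (24 * decayConst * gainConst) := by
        gcongr
        · refine sum_haarKernel_le h𝓘 (fun I hI => ?_) n k
          obtain ⟨R, hR, rfl⟩ := Finset.mem_image.1 hI
          exact (hS R hR).1
        · refine sum_haarKernel_le h𝓙 (fun I hI => ?_) n' k'
          obtain ⟨R, hR, rfl⟩ := Finset.mem_image.1 hI
          exact (hS R hR).2
    _ = _ := by rw [← ENNReal.ofReal_mul hκ, sq]

/-- The rows of the two-parameter Haar kernel, integrated against a weight that is in `A₁` in each
variable. -/
theorem tsum_haarKernel_mul_le (h𝓘 : IsDyadicGrid 𝓘) (h𝓙 : IsDyadicGrid 𝓙) {R : Rect}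
    (hI : R.I ∈ 𝓘) (hJ : R.J ∈ 𝓙) {W : ℝ → ℝ → ℝ≥0∞} (hW : Measurable (Function.uncurry W))
    {Q : ℝ} (hQ : 1 ≤ Q) (h₁ : ∀ y, IsA1 Q fun x => W x y) (h₂ : ∀ x, IsA1 Q (W x)) :
    ∑' n, ∑' k, ∑' n', ∑' k', ENNReal.ofReal (haarKernel R.I.center R.I.length n k) *
      ENNReal.ofReal (haarKernel R.J.center R.J.length n' k') *
        dyAvgW (fun y => dyAvgW (fun x => W x y) n k) n' k' ≤
      ENNReal.ofReal ((48 * decayConst * gainConst + 1) ^ 2 * Q ^ 2) * rectInf W R := by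
  have hκ : 0 ≤ 48 * decayConst * gainConst := by
    have := zero_le_two.trans two_le_decayConst
    have := gainConst_nonneg
    positivity
  obtain ⟨i, hi⟩ := h𝓘.2 R.I hI
  obtain ⟨j, hj⟩ := h𝓙.2 R.J hJ
  set C := ENNReal.ofReal ((48 * decayConst * gainConst + 1) * Q) with hC
  have hCle : ENNReal.ofReal (48 * decayConst * gainConst * Q) ≤ C :=
    ENNReal.ofReal_le_ofReal (by nlinarith)
  have hC0 : C ≠ 0 := by
    rw [hC, Ne, ENNReal.ofReal_eq_zero, not_le]; positivity
  have hCt : C ≠ ∞ := ENNReal.ofReal_ne_top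
  have e : ENNReal.ofReal ((48 * decayConst * gainConst + 1) ^ 2 * Q ^ 2) = C * C := by
    rw [hC, ← ENNReal.ofReal_mul (by positivity)]; congr 1; ring
  have hCC0 : C * C ≠ 0 := mul_ne_zero hC0 hC0
  have hCCt : C * C ≠ ∞ := ENNReal.mul_ne_top hCt hCt
  rw [e, ← ENNReal.div_le_iff' hCC0 hCCt]
  refine le_iInf₂ fun x hx => le_iInf₂ fun y hy => ?_
  rw [ENNReal.div_le_iff' hCC0 hCCt]
  have hx' := R.I.abs_sub_center_le hx
  have hy' := R.J.abs_sub_center_le hy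
  rw [hi] at hx' ⊢
  rw [hj] at hy' ⊢
  calc _ ≤ ∑' n, ∑' k, ENNReal.ofReal (haarKernel R.I.center (2 ^ i) n k) *
        (C * dyAvgW (fun x => W x y) n k) := by
        refine ENNReal.tsum_le_tsum fun n => ENNReal.tsum_le_tsum fun k => ?_
        simp_rw [mul_assoc, ENNReal.tsum_mul_left]
        refine mul_le_mul_right ?_ _
        refine ((isA1_dyAvgW hW h₂ n k).tsum_haarKernel_le (by linarith) (measurable_dyAvgW hW n k)
          hy').trans ?_
        gcongr
    _ = C * ∑' n, ∑' k, ENNReal.ofReal (haarKernel R.I.center (2 ^ i) n k) *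
        dyAvgW (fun x => W x y) n k := by
        simp_rw [mul_left_comm _ C, ENNReal.tsum_mul_left]
    _ ≤ C * (C * W x y) := by
        gcongr
        refine ((h₁ y).tsum_haarKernel_le (by linarith)
          (hW.comp (measurable_id.prodMk measurable_const)) hx').trans ?_
        gcongr
    _ = _ := by rw [mul_assoc]

/-- The two-parameter Haar coefficients of a sum of product wave packets. -/
theorem haarCoeff_haarCoeff_le (hψ : ∀ R ∈ S, IsProdPacket R.I.center R.I.length R.J.center
    R.J.length (a / (√R.I.length * √R.J.length)) (ψ R)) (ha : 0 ≤ a) (b : Rect → ℂ)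
    (n k n' k' : ℤ) :
    ENNReal.ofReal (2 ^ n) * ENNReal.ofReal (2 ^ n') *
      ‖haarCoeff (fun y => haarCoeff (fun x => ∑ R ∈ S, b R * ψ R x y) n k) n' k'‖ₑ ^ 2 ≤
    ENNReal.ofReal (haarConst ^ 4 * a ^ 2) *
      (∑ R ∈ S, ENNReal.ofReal (haarKernel R.I.center R.I.length n k) *
        ENNReal.ofReal (haarKernel R.J.center R.J.length n' k') * ‖b R‖ₑ) ^ 2 := by
  have hH : 0 ≤ haarConst := zero_le_one.trans one_le_haarConst
  have D := fun (R : Rect) y => (decay_pos R.J.length_pos R.J.center y).le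
  have int1 : ∀ R ∈ S, ∀ y, Integrable fun x => ψ R x y := fun R hR y =>
    ((hψ R hR).fst y).integrable R.I.length_pos (by have := D R y; positivity)
  have pk := fun R hR => (hψ R hR).haarCoeff R.I.length_pos R.J.length_pos (by positivity) n k
  have K := fun (I : HalfOpenInterval) n k => haarKernel_nonneg I.length_pos I.center n k
  have int2 : ∀ R ∈ S, Integrable fun y => haarCoeff (fun x => ψ R x y) n k := fun R hR =>
    (pk R hR).integrable R.J.length_pos (by have := K R.I n k; positivity)
  have e1 : (fun y => haarCoeff (fun x => ∑ R ∈ S, b R * ψ R x y) n k) =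
      fun y => ∑ R ∈ S, b R * haarCoeff (fun x => ψ R x y) n k := by
    ext y; exact haarCoeff_sum S b (fun R hR => int1 R hR y) n k
  rw [e1, haarCoeff_sum S b int2]
  have bound : √(2 ^ n) * √(2 ^ n') *
      ‖∑ R ∈ S, b R * haarCoeff (fun y => haarCoeff (fun x => ψ R x y) n k) n' k'‖ ≤
      haarConst ^ 2 * a * ∑ R ∈ S, haarKernel R.I.center R.I.length n k *
        haarKernel R.J.center R.J.length n' k' * ‖b R‖ := by
    refine (mul_le_mul_of_nonneg_left (norm_sum_le _ _) (by positivity)).trans ?_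
    rw [Finset.mul_sum, Finset.mul_sum]
    refine Finset.sum_le_sum fun R hR => ?_
    have h1 := (pk R hR).norm_haarCoeff_le R.J.length_pos (by have := K R.I n k; positivity) n' k'
    rw [norm_mul]
    have s : ∀ m : ℤ, √((2 : ℝ) ^ m) * √(2 ^ (-m)) = 1 := fun m => by
      rw [← Real.sqrt_mul (by positivity), ← zpow_add₀ (by norm_num)]; simp
    have hI : √R.I.length ≠ 0 := (Real.sqrt_pos.2 R.I.length_pos).ne'
    have hJ : √R.J.length ≠ 0 := (Real.sqrt_pos.2 R.J.length_pos).ne'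
    calc _ ≤ √(2 ^ n) * √(2 ^ n') * (‖b R‖ * (haarConst * (haarConst *
          (a / (√R.I.length * √R.J.length)) * (√R.I.length * √(2 ^ (-n)) *
            haarKernel R.I.center R.I.length n k)) * (√R.J.length * √(2 ^ (-n')) *
              haarKernel R.J.center R.J.length n' k'))) := by gcongr
      _ = (√(2 ^ n) * √(2 ^ (-n))) * (√(2 ^ n') * √(2 ^ (-n'))) * (haarConst ^ 2 * a *
          (haarKernel R.I.center R.I.length n k * haarKernel R.J.center R.J.length n' k' *
            ‖b R‖)) := by field_simp
      _ = _ := by rw [s, s]; ring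
  have e2 : ∑ R ∈ S, ENNReal.ofReal (haarKernel R.I.center R.I.length n k) *
      ENNReal.ofReal (haarKernel R.J.center R.J.length n' k') * ‖b R‖ₑ =
      ENNReal.ofReal (∑ R ∈ S, haarKernel R.I.center R.I.length n k *
        haarKernel R.J.center R.J.length n' k' * ‖b R‖) := by
    rw [ENNReal.ofReal_sum_of_nonneg fun R _ =>
      mul_nonneg (mul_nonneg (K R.I n k) (K R.J n' k')) (norm_nonneg _)]
    refine Finset.sum_congr rfl fun R _ => ?_
    rw [ENNReal.ofReal_mul (mul_nonneg (K R.I n k) (K R.J n' k')), ENNReal.ofReal_mul (K R.I n k),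
      ofReal_norm]
  have hsum : 0 ≤ ∑ R ∈ S, haarKernel R.I.center R.I.length n k *
      haarKernel R.J.center R.J.length n' k' * ‖b R‖ := Finset.sum_nonneg fun R _ =>
        mul_nonneg (mul_nonneg (K R.I n k) (K R.J n' k')) (norm_nonneg _)
  rw [e2, ← ofReal_norm, ← ENNReal.ofReal_pow (norm_nonneg _), ← ENNReal.ofReal_pow hsum,
    ← ENNReal.ofReal_mul (by positivity), ← ENNReal.ofReal_mul (by positivity),
    ← ENNReal.ofReal_mul (by positivity)]
  refine ENNReal.ofReal_le_ofReal ?_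
  have := pow_le_pow_left₀ (by positivity) bound 2
  rw [mul_pow, mul_pow, Real.sq_sqrt (by positivity), Real.sq_sqrt (by positivity)] at this
  refine this.trans (le_of_eq ?_)
  ring

/-- The two-parameter weighted estimate: for a bounded weight in `A₁` with constant `Q` in each
variable, the weighted `L²` norm of a sum of product wave packets is controlled by the coefficients
weighted with the infimum of the weight over the rectangle. -/
theorem lintegral_sq_mul_le_sum_rectInf (h𝓘 : IsDyadicGrid 𝓘) (h𝓙 : IsDyadicGrid 𝓙)
    (hS : ∀ R ∈ S, R.I ∈ 𝓘 ∧ R.J ∈ 𝓙) (hψ : ∀ R ∈ S, IsProdPacket R.I.center R.I.length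
      R.J.center R.J.length (a / (√R.I.length * √R.J.length)) (ψ R)) (ha : 0 ≤ a) (b : Rect → ℂ)
    {W : ℝ → ℝ → ℝ≥0∞} (hW : Measurable (Function.uncurry W)) {c : ℝ≥0∞} (hc : ∀ x y, W x y ≤ c)
    (hct : c ≠ ∞) {Q : ℝ} (hQ : 1 ≤ Q) (h₁ : ∀ y, IsA1 Q fun x => W x y) (h₂ : ∀ x, IsA1 Q (W x)) :
    ∫⁻ y, ∫⁻ x, ‖∑ R ∈ S, b R * ψ R x y‖ₑ ^ 2 * W x y ≤
      ENNReal.ofReal (weightedConst * a ^ 2 * Q ^ 4) * ∑ R ∈ S, ‖b R‖ₑ ^ 2 * rectInf W R := by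
  have D := fun (R : Rect) y => (decay_pos R.J.length_pos R.J.center y).le
  have K := fun (I : HalfOpenInterval) n k => haarKernel_nonneg I.length_pos I.center n k
  have hH : 0 ≤ haarConst := zero_le_one.trans one_le_haarConst
  have apos : ∀ R : Rect, 0 ≤ a / (√R.I.length * √R.J.length) := fun R => by positivity
  set B : ℝ → ℝ → ℂ := fun x y => ∑ R ∈ S, b R * ψ R x y with hB
  set G : ℤ → ℤ → ℝ → ℂ := fun n k y => haarCoeff (fun x => B x y) n k with hG
  set V : ℤ → ℤ → ℝ → ℝ≥0∞ := fun n k y => dyAvgW (fun x => W x y) n k with hV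
  have int1 : ∀ R ∈ S, ∀ y, Integrable fun x => ψ R x y := fun R hR y =>
    ((hψ R hR).fst y).integrable R.I.length_pos (by have := D R y; positivity)
  have pk := fun R hR n k => (hψ R hR).haarCoeff R.I.length_pos R.J.length_pos (apos R) n k
  have hGe : ∀ n k, G n k = fun y => ∑ R ∈ S, b R * haarCoeff (fun x => ψ R x y) n k := by
    intro n k; ext y; exact haarCoeff_sum S b (fun R hR => int1 R hR y) n k
  have hGc : ∀ n k, Continuous (G n k) := fun n k => by
    rw [hGe]
    refine continuous_finsetSum _ fun R hR => continuous_const.mul ?_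
    exact (pk R hR n k).continuous R.J.length_pos (by have := K R.I n k; have := apos R; positivity)
  have hGi : ∀ n k, Integrable (G n k) := fun n k => by
    rw [hGe]
    refine integrable_finsetSum _ fun R hR => Integrable.const_mul ?_ _
    exact (pk R hR n k).integrable R.J.length_pos (by have := K R.I n k; have := apos R; positivity)
  have hVm : ∀ n k, Measurable (V n k) := fun n k => measurable_dyAvgW hW n k
  have first : ∀ y, ∫⁻ x, ‖B x y‖ₑ ^ 2 * W x y ≤ ENNReal.ofReal (38 * Q) *
      ∑' n, ∑' k, ENNReal.ofReal (2 ^ n) * (‖G n k y‖ₑ ^ 2 * V n k y) := by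
    intro y
    have := lintegral_sq_mul_le_haar (g := fun x => B x y) (w := fun x => W x y)
      (continuous_finsetSum _ fun R hR => continuous_const.mul
        ((hψ R hR).continuous.comp (continuous_id.prodMk continuous_const)))
      (integrable_finsetSum _ fun R hR => (int1 R hR y).const_mul _)
      (hW.comp (measurable_id.prodMk measurable_const)) (fun x => hc x y) hct hQ (h₁ y)
    simpa only [haarLevel, mul_assoc] using this
  have second : ∀ n k, ∫⁻ y, ‖G n k y‖ₑ ^ 2 * V n k y ≤ ENNReal.ofReal (38 * Q) *
      ∑' n', ∑' k', ENNReal.ofReal (2 ^ n') * ‖haarCoeff (G n k) n' k'‖ₑ ^ 2 *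
        dyAvgW (V n k) n' k' := fun n k =>
    lintegral_sq_mul_le_haar (hGc n k) (hGi n k) (hVm n k) (fun y => dyAvgW_le (fun x => hc x y) n k)
      hct hQ (isA1_dyAvgW hW h₂ n k)
  set M : Rect → ℤ → ℤ → ℤ → ℤ → ℝ≥0∞ := fun R n k n' k' =>
    ENNReal.ofReal (haarKernel R.I.center R.I.length n k) *
      ENNReal.ofReal (haarKernel R.J.center R.J.length n' k') with hM
  have entry : ∀ n k n' k', ENNReal.ofReal (2 ^ n) * (ENNReal.ofReal (2 ^ n') *
      ‖haarCoeff (G n k) n' k'‖ₑ ^ 2 * dyAvgW (V n k) n' k') ≤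
      ENNReal.ofReal (haarConst ^ 4 * a ^ 2) * ENNReal.ofReal ((24 * decayConst * gainConst) ^ 2) *
        ∑ R ∈ S, ‖b R‖ₑ ^ 2 * (M R n k n' k' * dyAvgW (V n k) n' k') := by
    intro n k n' k'
    calc _ = ENNReal.ofReal (2 ^ n) * ENNReal.ofReal (2 ^ n') * ‖haarCoeff (G n k) n' k'‖ₑ ^ 2 *
          dyAvgW (V n k) n' k' := by ring
      _ ≤ ENNReal.ofReal (haarConst ^ 4 * a ^ 2) * ((∑ R ∈ S, M R n k n' k') *
          ∑ R ∈ S, M R n k n' k' * ‖b R‖ₑ ^ 2) * dyAvgW (V n k) n' k' := by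
          refine mul_le_mul_left ((haarCoeff_haarCoeff_le hψ ha b n k n' k').trans ?_) _
          exact mul_le_mul_right (sq_sum_mul_le S _ _) _
      _ ≤ ENNReal.ofReal (haarConst ^ 4 * a ^ 2) *
          (ENNReal.ofReal ((24 * decayConst * gainConst) ^ 2) *
          ∑ R ∈ S, M R n k n' k' * ‖b R‖ₑ ^ 2) * dyAvgW (V n k) n' k' := by
          gcongr
          exact sum_haarKernel_mul_le h𝓘 h𝓙 hS n k n' k'
      _ = _ := by
          rw [← mul_assoc, mul_assoc _ _ (dyAvgW (V n k) n' k'), Finset.sum_mul]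
          congr 1
          refine Finset.sum_congr rfl fun R _ => by ring
  calc _ ≤ ∫⁻ y, ENNReal.ofReal (38 * Q) *
        ∑' n, ∑' k, ENNReal.ofReal (2 ^ n) * (‖G n k y‖ₑ ^ 2 * V n k y) := lintegral_mono first
    _ = ENNReal.ofReal (38 * Q) *
        ∑' n, ∑' k, ENNReal.ofReal (2 ^ n) * ∫⁻ y, ‖G n k y‖ₑ ^ 2 * V n k y := by
        have hm : ∀ n k, Measurable fun y => ENNReal.ofReal (2 ^ n) * (‖G n k y‖ₑ ^ 2 * V n k y) :=
          fun n k => (((hGc n k).measurable.enorm.pow_const 2).mul (hVm n k)).const_mul _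
        rw [lintegral_const_mul' _ _ ENNReal.ofReal_ne_top,
          lintegral_tsum fun n => (Measurable.tsum fun k => hm n k).aemeasurable]
        congr 1
        refine tsum_congr fun n => ?_
        rw [lintegral_tsum fun k => (hm n k).aemeasurable]
        refine tsum_congr fun k => ?_
        rw [lintegral_const_mul' _ _ ENNReal.ofReal_ne_top]
    _ ≤ ENNReal.ofReal (38 * Q) * ∑' n, ∑' k, ENNReal.ofReal (2 ^ n) * (ENNReal.ofReal (38 * Q) *
        ∑' n', ∑' k', ENNReal.ofReal (2 ^ n') * ‖haarCoeff (G n k) n' k'‖ₑ ^ 2 *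
          dyAvgW (V n k) n' k') := by
        gcongr with n k
        exact second n k
    _ = ENNReal.ofReal (38 * Q) * (ENNReal.ofReal (38 * Q) * ∑' n, ∑' k, ∑' n', ∑' k',
        ENNReal.ofReal (2 ^ n) * (ENNReal.ofReal (2 ^ n') * ‖haarCoeff (G n k) n' k'‖ₑ ^ 2 *
          dyAvgW (V n k) n' k')) := by
        simp_rw [mul_left_comm _ (ENNReal.ofReal (38 * Q)), ENNReal.tsum_mul_left]
    _ ≤ ENNReal.ofReal (38 * Q) * (ENNReal.ofReal (38 * Q) * ∑' n, ∑' k, ∑' n', ∑' k',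
        ENNReal.ofReal (haarConst ^ 4 * a ^ 2) *
          ENNReal.ofReal ((24 * decayConst * gainConst) ^ 2) *
          ∑ R ∈ S, ‖b R‖ₑ ^ 2 * (M R n k n' k' * dyAvgW (V n k) n' k')) := by
        refine mul_le_mul_right (mul_le_mul_right (ENNReal.tsum_le_tsum fun n =>
          ENNReal.tsum_le_tsum fun k => ENNReal.tsum_le_tsum fun n' =>
          ENNReal.tsum_le_tsum fun k' => entry n k n' k') _) _
    _ = ENNReal.ofReal (38 * Q) * (ENNReal.ofReal (38 * Q) *
        (ENNReal.ofReal (haarConst ^ 4 * a ^ 2) *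
          ENNReal.ofReal ((24 * decayConst * gainConst) ^ 2) *
        ∑ R ∈ S, ‖b R‖ₑ ^ 2 * ∑' n, ∑' k, ∑' n', ∑' k',
          M R n k n' k' * dyAvgW (V n k) n' k')) := by
        simp_rw [ENNReal.tsum_mul_left, Summable.tsum_finsetSum fun _ _ => ENNReal.summable,
          ENNReal.tsum_mul_left]
    _ ≤ ENNReal.ofReal (38 * Q) * (ENNReal.ofReal (38 * Q) *
        (ENNReal.ofReal (haarConst ^ 4 * a ^ 2) *
          ENNReal.ofReal ((24 * decayConst * gainConst) ^ 2) *
        ∑ R ∈ S, ‖b R‖ₑ ^ 2 * (ENNReal.ofReal ((48 * decayConst * gainConst + 1) ^ 2 * Q ^ 2) *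
          rectInf W R))) := by
        gcongr with R hR
        exact tsum_haarKernel_mul_le h𝓘 h𝓙 (hS R hR).1 (hS R hR).2 hW hQ h₁ h₂
    _ = _ := by
        simp_rw [mul_left_comm _ (ENNReal.ofReal ((48 * decayConst * gainConst + 1) ^ 2 * Q ^ 2))]
        rw [← Finset.mul_sum]
        simp_rw [← mul_assoc]
        congr 1
        have h38 : 0 ≤ 38 * Q := by linarith
        have e : weightedConst * a ^ 2 * Q ^ 4 = 38 * Q * (38 * Q) * (haarConst ^ 4 * a ^ 2) *
            (24 * decayConst * gainConst) ^ 2 * ((48 * decayConst * gainConst + 1) ^ 2 * Q ^ 2) := by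
          unfold weightedConst; ring
        rw [e, ENNReal.ofReal_mul (q := (48 * decayConst * gainConst + 1) ^ 2 * Q ^ 2)
          (by positivity), ENNReal.ofReal_mul (q := (24 * decayConst * gainConst) ^ 2)
          (by positivity), ENNReal.ofReal_mul (q := haarConst ^ 4 * a ^ 2) (by positivity),
          ENNReal.ofReal_mul (q := 38 * Q) h38]

end Weighted

/-! ### Coordinates of an orientation -/

theorem norm_sq_eq_coords (e : Plane) : ‖e‖ ^ 2 = e 0 ^ 2 + e 1 ^ 2 := by
  rw [EuclideanSpace.norm_sq_eq, Fin.sum_univ_two, Real.norm_eq_abs, Real.norm_eq_abs, sq_abs, sq_abs]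

theorem norm_perp (e : Plane) : ‖perp e‖ = ‖e‖ := by
  have h : ‖perp e‖ ^ 2 = ‖e‖ ^ 2 := by
    rw [norm_sq_eq_coords, norm_sq_eq_coords]; simp [perp]; ring
  exact (pow_left_inj₀ (norm_nonneg _) (norm_nonneg _) two_ne_zero).1 h

theorem inner_perp (e : Plane) : inner ℝ e (perp e) = 0 := by
  rw [PiLp.inner_apply, Fin.sum_univ_two]; simp [perp]; ring

theorem orthonormal_orientation {e : Plane} (he : ‖e‖ = 1) : Orthonormal ℝ ![e, perp e] := by
  have h := inner_perp e
  constructor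
  · intro i; fin_cases i
    · simpa using he
    · simpa [norm_perp] using he
  · intro i j hij
    fin_cases i <;> fin_cases j
    · exact absurd rfl hij
    · simpa using h
    · simpa [real_inner_comm] using h
    · exact absurd rfl hij

/-- The orthonormal basis `(e, perp e)` of the plane. -/
def orientationBasis {e : Plane} (he : ‖e‖ = 1) : OrthonormalBasis (Fin 2) ℝ Plane :=
  OrthonormalBasis.mk (orthonormal_orientation he) (le_of_eq
    ((orthonormal_orientation he).linearIndependent.span_eq_top_of_card_eq_finrank
      (by simp)).symm)

theorem inner_fst_coords {e : Plane} (he : ‖e‖ = 1) (s t : ℝ) :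
    inner ℝ e (s • e + t • perp e) = s := by
  rw [inner_add_right, inner_smul_right, inner_smul_right, inner_perp, real_inner_self_eq_norm_sq, he]
  ring

theorem inner_snd_coords {e : Plane} (he : ‖e‖ = 1) (s t : ℝ) :
    inner ℝ (perp e) (s • e + t • perp e) = t := by
  rw [inner_add_right, inner_smul_right, inner_smul_right, real_inner_comm, inner_perp,
    real_inner_self_eq_norm_sq, norm_perp, he]
  ring

theorem coords_inner {e : Plane} (he : ‖e‖ = 1) (x : Plane) :
    (inner ℝ e x : ℝ) • e + (inner ℝ (perp e) x : ℝ) • perp e = x := by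
  have := (orientationBasis he).sum_repr' x
  rw [Fin.sum_univ_two] at this
  simpa [orientationBasis] using this

theorem mem_rect_coords {e : Plane} (he : ‖e‖ = 1) (R : Rect) (s t : ℝ) :
    s • e + t • perp e ∈ R.toSet e ↔ s ∈ R.I.toSet ∧ t ∈ R.J.toSet := by
  rw [Rect.toSet, Set.mem_ofPred_eq, inner_fst_coords he, inner_snd_coords he]

theorem measurePreserving_coords {e : Plane} (he : ‖e‖ = 1) :
    MeasurePreserving (fun z : ℝ × ℝ => z.1 • e + z.2 • perp e) := by
  have h1 : MeasurePreserving (MeasurableEquiv.finTwoArrow (α := ℝ)).symm :=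
    (volume_preserving_finTwoArrow ℝ).symm
  have h2 := PiLp.volume_preserving_toLp (Fin 2)
  have h := ((orientationBasis he).measurePreserving_repr_symm.comp h2).comp h1
  have heq : (fun z : ℝ × ℝ => z.1 • e + z.2 • perp e) = ((orientationBasis he).repr.symm ∘
      WithLp.toLp 2) ∘ (MeasurableEquiv.finTwoArrow (α := ℝ)).symm := by
    funext z
    rw [Function.comp_apply, Function.comp_apply, ← OrthonormalBasis.sum_repr_symm, Fin.sum_univ_two]
    simp [orientationBasis, MeasurableEquiv.finTwoArrow, MeasurableEquiv.piFinTwo]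
  rw [heq]
  exact h

/-- Integration over the plane in the coordinates of an orientation. -/
theorem lintegral_coords {e : Plane} (he : ‖e‖ = 1) {F : Plane → ℝ≥0∞} (hF : Measurable F) :
    ∫⁻ x, F x = ∫⁻ t : ℝ, ∫⁻ s : ℝ, F (s • e + t • perp e) := by
  have hm := (measurePreserving_coords he).measurable
  rw [← (measurePreserving_coords he).lintegral_comp hF, Measure.volume_eq_prod]
  exact lintegral_prod_symm' (fun z : ℝ × ℝ => F (z.1 • e + z.2 • perp e)) (hF.comp hm)

theorem measurableSet_rect (e : Plane) (R : Rect) : MeasurableSet (R.toSet e) := by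
  have h1 : Measurable fun x : Plane => (inner ℝ e x : ℝ) := by fun_prop
  have h2 : Measurable fun x : Plane => (inner ℝ (perp e) x : ℝ) := by fun_prop
  exact (h1 measurableSet_Ico).inter (h2 measurableSet_Ico)

theorem volume_rect {e : Plane} (he : ‖e‖ = 1) (R : Rect) :
    volume (R.toSet e) = ENNReal.ofReal (R.I.length * R.J.length) := by
  have h : (fun z : ℝ × ℝ => z.1 • e + z.2 • perp e) ⁻¹' R.toSet e = R.I.toSet ×ˢ R.J.toSet := by
    ext z; exact mem_rect_coords he R z.1 z.2
  rw [← (measurePreserving_coords he).measure_preimage (measurableSet_rect e R).nullMeasurableSet,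
    h, Measure.volume_eq_prod, Measure.prod_prod, R.I.volume_toSet, R.J.volume_toSet,
    ENNReal.ofReal_mul R.I.length_pos.le]

/-! ### From adapted functions on the plane to product wave packets -/

theorem norm_sub_le_of_norm_deriv_le {g : ℝ → ℂ} (hg : Differentiable ℝ g) {C x x' : ℝ}
    (h : ∀ z ∈ Set.uIcc x x', ‖deriv g z‖ ≤ C) : ‖g x - g x'‖ ≤ C * |x - x'| := by
  have := (convex_uIcc x x').norm_image_sub_le_of_norm_deriv_le (fun z _ => hg z) h
    (Set.right_mem_uIcc) (Set.left_mem_uIcc)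
  simpa using this

theorem decay_pow_le_of_mem_uIcc {c L x x' z : ℝ} (hL : 0 < L) (hx : |x - x'| ≤ L)
    (hz : z ∈ Set.uIcc x x') : decay c L z ^ 7 ≤ 2 ^ 7 * decay c L x ^ 7 := by
  rw [← mul_pow]
  have h : |z - x| ≤ L := by
    rw [abs_sub_comm] at hx
    exact (Set.abs_sub_left_of_mem_uIcc hz).trans hx
  have := decay_pos hL c z
  gcongr
  exact decay_le_two_mul hL h

/-- The sum of the absolute values of the adaptation constants of order at most one in each
variable, the only ones that matter. -/
def adaptConst (A : ℕ → ℕ → ℝ) : ℝ := |A 0 0| + |A 1 0| + |A 0 1| + |A 1 1|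

theorem adaptConst_nonneg (A : ℕ → ℕ → ℝ) : 0 ≤ adaptConst A := by unfold adaptConst; positivity

/-- Joint decay of order `14 = 7 + 7` splits into decay of order `7` in each variable. -/
theorem joint_decay_le {K c₁ L₁ c₂ L₂ x₁ x₂ : ℝ} (hK : 14 ≤ K) (h₁ : 0 < L₁) (h₂ : 0 < L₂) :
    (1 + |x₁ - c₁| / L₁ + |x₂ - c₂| / L₂) ^ (-K) ≤ decay c₁ L₁ x₁ ^ 7 * decay c₂ L₂ x₂ ^ 7 := by
  have u : 0 ≤ |x₁ - c₁| / L₁ := by positivity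
  have v : 0 ≤ |x₂ - c₂| / L₂ := by positivity
  unfold decay
  generalize |x₁ - c₁| / L₁ = u' at *
  generalize |x₂ - c₂| / L₂ = v' at *
  calc (1 + u' + v') ^ (-K) ≤ (1 + u' + v') ^ (-(14 : ℕ) : ℝ) :=
        Real.rpow_le_rpow_of_exponent_le (by linarith) (by push_cast; linarith)
    _ = ((1 + u' + v')⁻¹) ^ 7 * ((1 + u' + v')⁻¹) ^ 7 := by
        rw [Real.rpow_neg (by positivity), Real.rpow_natCast, ← pow_add, inv_pow]
    _ ≤ _ := by
        have hu : (1 + u' + v')⁻¹ ≤ (1 + u')⁻¹ := inv_anti₀ (by linarith) (by linarith)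
        have hv : (1 + u' + v')⁻¹ ≤ (1 + v')⁻¹ := inv_anti₀ (by linarith) (by linarith)
        exact mul_le_mul (pow_le_pow_left₀ (by positivity) hu 7)
          (pow_le_pow_left₀ (by positivity) hv 7) (by positivity) (by positivity)

theorem IsAdapted.norm_mixedDeriv_le {e : Plane} {K : ℝ} {A : ℕ → ℕ → ℝ} {R : Rect}
    {ψ : 𝓢(Plane, ℂ)} (h : IsAdapted e K A R ψ) (hK : 14 ≤ K) {α β : ℕ} (hα : α ≤ 1) (hβ : β ≤ 1)
    (x₁ x₂ : ℝ) :
    ‖mixedDeriv e α β ψ x₁ x₂‖ ≤ adaptConst A / (√R.I.length * √R.J.length) /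
      (R.I.length ^ α * R.J.length ^ β) *
        (decay R.I.center R.I.length x₁ ^ 7 * decay R.J.center R.J.length x₂ ^ 7) := by
  have hI := R.I.length_pos
  have hJ := R.J.length_pos
  refine (h α β x₁ x₂).trans ?_
  have hA : A α β ≤ adaptConst A := by
    unfold adaptConst
    have h00 := abs_nonneg (A 0 0)
    have h10 := abs_nonneg (A 1 0)
    have h01 := abs_nonneg (A 0 1)
    have h11 := abs_nonneg (A 1 1)
    interval_cases α <;> interval_cases β
    · linarith [le_abs_self (A 0 0)]
    · linarith [le_abs_self (A 0 1)]
    · linarith [le_abs_self (A 1 0)]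
    · linarith [le_abs_self (A 1 1)]
  have e1 : ∀ {l : ℝ} (_ : 0 < l) (m : ℕ), l ^ ((m : ℝ) + 1 / 2) = l ^ m * √l := fun hl m => by
    rw [Real.rpow_add hl, Real.rpow_natCast, Real.sqrt_eq_rpow]
  rw [e1 hI, e1 hJ, div_div]
  have hd := joint_decay_le (c₁ := R.I.center) (c₂ := R.J.center) (x₁ := x₁) (x₂ := x₂) hK hI hJ
  have hA0 := adaptConst_nonneg A
  calc _ ≤ adaptConst A / (R.I.length ^ α * √R.I.length * (R.J.length ^ β * √R.J.length)) *
        (1 + |x₁ - R.I.center| / R.I.length + |x₂ - R.J.center| / R.J.length) ^ (-K) := by gcongr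
    _ ≤ adaptConst A / (R.I.length ^ α * √R.I.length * (R.J.length ^ β * √R.J.length)) *
        (decay R.I.center R.I.length x₁ ^ 7 * decay R.J.center R.J.length x₂ ^ 7) := by gcongr
    _ = _ := by
        congr 2; ring

/-- A product wave packet on the plane is a product wave packet in coordinates. The derivative bounds
become Lipschitz bounds by the mean value theorem; comparing the decay factors at the intermediate
point and at the end point costs a factor `2 ^ 7` in each variable. -/
theorem isProdPacket_coords {e : Plane} {K : ℝ} {A : ℕ → ℕ → ℝ} {R : Rect}
    {ψ : 𝓢(Plane, ℂ)} (h : IsAdapted e K A R ψ) (hK : 14 ≤ K) (hz : HasProductMeanZero e ψ) :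
    IsProdPacket R.I.center R.I.length R.J.center R.J.length
      (2 ^ 14 * adaptConst A / (√R.I.length * √R.J.length))
      fun s t => ψ (s • e + t • perp e) := by
  have hI := R.I.length_pos
  have hJ := R.J.length_pos
  obtain ⟨H, hH⟩ : ∃ H, H = adaptConst A / (√R.I.length * √R.J.length) := ⟨_, rfl⟩
  have hH0 : 0 ≤ H := by rw [hH]; exact div_nonneg (adaptConst_nonneg A) (by positivity)
  have bound := fun α β hα hβ x₁ x₂ => h.norm_mixedDeriv_le hK (α := α) (β := β) hα hβ x₁ x₂
  rw [mul_div_assoc]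
  simp only [← hH] at bound ⊢
  have h00 := bound 0 0 (by norm_num) (by norm_num)
  have h10 := bound 1 0 (by norm_num) (by norm_num)
  have h01 := bound 0 1 (by norm_num) (by norm_num)
  have h11 := bound 1 1 (by norm_num) (by norm_num)
  simp only [mixedDeriv, iteratedDeriv_zero, iteratedDeriv_one, pow_zero, pow_one, mul_one, one_mul,
    div_one] at h00 h10 h01 h11
  set c₁ := R.I.center
  set c₂ := R.J.center
  set L₁ := R.I.length
  set L₂ := R.J.length
  have D₁ := fun x => (decay_pos hI c₁ x).le
  have D₂ := fun x => (decay_pos hJ c₂ x).le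
  have hd : Differentiable ℝ ψ := (ψ.smooth 1).differentiable (by simp)
  have d1 : ∀ t : ℝ, Differentiable ℝ fun s : ℝ => ψ (s • e + t • perp e) := fun t =>
    hd.comp (by fun_prop)
  have d2 : ∀ s : ℝ, Differentiable ℝ fun t : ℝ => ψ (s • e + t • perp e) := fun s =>
    hd.comp (by fun_prop)
  have d3 : ∀ t : ℝ, Differentiable ℝ fun s : ℝ => deriv (fun t : ℝ => ψ (s • e + t • perp e)) t := by
    intro t
    have e1 : (fun s : ℝ => deriv (fun t : ℝ => ψ (s • e + t • perp e)) t) =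
        fun s : ℝ => fderiv ℝ ψ (s • e + t • perp e) (perp e) := by
      ext s
      have hg : HasDerivAt (fun t : ℝ => s • e + t • perp e) (perp e) t := by
        simpa using ((hasDerivAt_id t).smul_const (perp e)).const_add (s • e)
      exact ((hd _).hasFDerivAt.comp_hasDerivAt t hg).deriv
    rw [e1]
    have h2 : Differentiable ℝ (fderiv ℝ ψ) :=
      ((ψ.smooth 2).fderiv_right (m := 1) (by norm_num)).differentiable (by simp)
    exact (h2.comp (by fun_prop : Differentiable ℝ fun s : ℝ => s • e + t • perp e)).clm_apply
      (differentiable_const _)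
  have fst : ∀ y, IsPacket c₁ L₁ (2 ^ 7 * H * decay c₂ L₂ y ^ 7)
      fun x => ψ (x • e + y • perp e) := by
    intro y
    refine ⟨fun x => ?_, fun x x' hx => ?_, ?_⟩
    · have := D₁ x
      have := D₂ y
      refine (h00 x y).trans ?_
      have : 0 ≤ H * (decay c₁ L₁ x ^ 7 * decay c₂ L₂ y ^ 7) := by positivity
      nlinarith
    · have := D₂ y
      have := D₁ x
      refine (norm_sub_le_of_norm_deriv_le (d1 y) (C := H / L₁ *
        (2 ^ 7 * decay c₁ L₁ x ^ 7 * decay c₂ L₂ y ^ 7)) fun z hz' => ?_).trans (le_of_eq (by ring))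
      refine (h10 z y).trans ?_
      gcongr
      exact decay_pow_le_of_mem_uIcc hI hx hz'
    · have := (hz (y • perp e)).1
      simpa only [add_comm] using this
  have int : ∀ y : ℝ, Integrable fun x : ℝ => ψ (x • e + y • perp e) := fun y =>
    (fst y).integrable hI (by have := D₂ y; positivity)
  refine ⟨by fun_prop, fun y => ?_, fun y y' hy => ?_, fun x => (hz (x • e)).2⟩
  · obtain ⟨f1, f2, f3⟩ := fst y
    have hle : 2 ^ 7 * H * decay c₂ L₂ y ^ 7 ≤ 2 ^ 14 * H * decay c₂ L₂ y ^ 7 := by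
      have := D₂ y
      gcongr <;> norm_num
    refine ⟨fun x => (f1 x).trans ?_, fun x x' hx => (f2 x x' hx).trans ?_, f3⟩
    · have := D₁ x; gcongr
    · have := D₁ x; gcongr
  · refine ⟨fun x => ?_, fun x x' hx => ?_, ?_⟩
    · have := D₂ y
      have := D₁ x
      refine (norm_sub_le_of_norm_deriv_le (d2 x) (C := H / L₂ *
        (decay c₁ L₁ x ^ 7 * (2 ^ 7 * decay c₂ L₂ y ^ 7))) fun z hz' => ?_).trans ?_
      · refine (h01 x z).trans ?_
        gcongr
        exact decay_pow_le_of_mem_uIcc hJ hy hz'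
      · have : 0 ≤ H * (|y - y'| / L₂) * decay c₂ L₂ y ^ 7 * decay c₁ L₁ x ^ 7 := by positivity
        have e1 : H / L₂ * (decay c₁ L₁ x ^ 7 * (2 ^ 7 * decay c₂ L₂ y ^ 7)) * |y - y'| =
          2 ^ 7 * (H * (|y - y'| / L₂) * decay c₂ L₂ y ^ 7 * decay c₁ L₁ x ^ 7) := by ring
        rw [e1]
        nlinarith
    · have := D₂ y
      have := D₁ x
      have e1 : (ψ (x • e + y • perp e) - ψ (x • e + y' • perp e)) -
          (ψ (x' • e + y • perp e) - ψ (x' • e + y' • perp e)) =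
          (ψ (x • e + y • perp e) - ψ (x' • e + y • perp e)) -
          (ψ (x • e + y' • perp e) - ψ (x' • e + y' • perp e)) := by ring
      rw [e1]
      refine (norm_sub_le_of_norm_deriv_le ((d2 x).sub (d2 x')) (C := H / (L₁ * L₂) *
        (2 ^ 7 * decay c₁ L₁ x ^ 7 * (2 ^ 7 * decay c₂ L₂ y ^ 7)) * |x - x'|)
        fun z hz' => ?_).trans (le_of_eq (by ring))
      rw [deriv_sub (d2 x z) (d2 x' z)]
      refine norm_sub_le_of_norm_deriv_le (d3 z) fun z₁ hz₁ => ?_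
      refine (h11 z₁ z).trans ?_
      have := D₂ z
      gcongr
      · exact decay_pow_le_of_mem_uIcc hI hx hz₁
      · exact decay_pow_le_of_mem_uIcc hJ hy hz'
    · rw [integral_sub (int y) (int y'), (fst y).integral_eq_zero, (fst y').integral_eq_zero, sub_zero]

/-! ### The Carleson embedding -/

theorem shadow_mono (e : Plane) {𝓡 𝓡' : Set Rect} (h : 𝓡 ⊆ 𝓡') : shadow e 𝓡 ⊆ shadow e 𝓡' :=
  Set.biUnion_mono h fun _ _ => subset_rfl

/-- The defining property of the size, for finite subcollections. -/
theorem sum_enorm_sq_le_size {e : Plane} (he : ‖e‖ = 1) {𝓡 : Set Rect} (b : Rect → ℂ)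
    (hfin : volume (shadow e 𝓡) ≠ ∞) {S : Finset Rect} (hS : (S : Set Rect) ⊆ 𝓡) :
    ∑ R ∈ S, ‖b R‖ₑ ^ 2 ≤ size e 𝓡 b ^ 2 * volume (shadow e (S : Set Rect)) := by
  rcases S.eq_empty_or_nonempty with rfl | ⟨R, hR⟩
  · simp
  have hv0 : volume (shadow e (S : Set Rect)) ≠ 0 := by
    have h1 : R.toSet e ⊆ shadow e (S : Set Rect) :=
      Set.subset_biUnion_of_mem (u := fun R => Rect.toSet e R) hR
    have h2 : 0 < volume (R.toSet e) := by
      rw [volume_rect he, ENNReal.ofReal_pos]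
      exact mul_pos R.I.length_pos R.J.length_pos
    exact (h2.trans_le (measure_mono h1)).ne'
  have hvt : volume (shadow e (S : Set Rect)) ≠ ∞ :=
    ne_top_of_le_ne_top hfin (measure_mono (shadow_mono e hS))
  have h : ((∑' R : (S : Set Rect), ‖b R‖ₑ ^ 2) / volume (shadow e (S : Set Rect))) ^ (1 / 2 : ℝ) ≤
      size e 𝓡 b :=
    le_iSup₂ (f := fun (𝓡' : Set Rect) (_ : 𝓡' ⊆ 𝓡) =>
      ((∑' R : 𝓡', ‖b R‖ₑ ^ 2) / volume (shadow e 𝓡')) ^ (1 / 2 : ℝ)) (S : Set Rect) hS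
  have h2 := ENNReal.rpow_le_rpow h (by norm_num : (0 : ℝ) ≤ 2)
  rw [← ENNReal.rpow_mul, show (1 / 2 : ℝ) * 2 = 1 by norm_num, ENNReal.rpow_one,
    ENNReal.rpow_ofNat, ENNReal.div_le_iff hv0 hvt] at h2
  refine le_trans (le_of_eq ?_) h2
  exact (Finset.tsum_subtype S fun R => ‖b R‖ₑ ^ 2).symm

/-- The Carleson embedding: integrating the level sets of the weight, coefficients weighted by
infima over rectangles are controlled by the integral of the weight over the shadow. -/
theorem sum_rectInf_le {e : Plane} (he : ‖e‖ = 1) {𝓡 : Set Rect} (b : Rect → ℂ)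
    (hfin : volume (shadow e 𝓡) ≠ ∞) {S : Finset Rect} (hS : (S : Set Rect) ⊆ 𝓡)
    {W : ℝ → ℝ → ℝ≥0∞} (hW : Measurable (Function.uncurry W)) {c : ℝ≥0∞} (hc : ∀ x y, W x y ≤ c)
    (hct : c ≠ ∞) :
    ∑ R ∈ S, ‖b R‖ₑ ^ 2 * rectInf W R ≤
      size e 𝓡 b ^ 2 * ∫⁻ x in shadow e (S : Set Rect), W (inner ℝ e x) (inner ℝ (perp e) x) := by
  classical
  have hinf : ∀ (R : Rect) (x : Plane), x ∈ R.toSet e →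
      rectInf W R ≤ W (inner ℝ e x) (inner ℝ (perp e) x) := fun R x hx =>
    (iInf₂_le _ hx.1).trans (iInf₂_le _ hx.2)
  have hit : ∀ R : Rect, rectInf W R ≠ ∞ := fun R =>
    ne_top_of_le_ne_top hct (((iInf₂_le R.I.left (Set.left_mem_Ico.2 R.I.left_lt_right)).trans
      (iInf₂_le R.J.left (Set.left_mem_Ico.2 R.J.left_lt_right))).trans (hc _ _))
  have hWm : Measurable fun x : Plane => W (inner ℝ e x) (inner ℝ (perp e) x) := by
    have h1 : Measurable fun x : Plane => ((inner ℝ e x : ℝ), (inner ℝ (perp e) x : ℝ)) := by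
      fun_prop
    exact hW.comp h1
  have hWt : ∀ x : Plane, W (inner ℝ e x) (inner ℝ (perp e) x) ≠ ∞ := fun x =>
    ne_top_of_le_ne_top hct (hc _ _)
  have layer : ∀ R, ‖b R‖ₑ ^ 2 * rectInf W R = ∫⁻ t in Set.Ioi (0 : ℝ),
      (Set.Iio (rectInf W R).toReal).indicator (fun _ => ‖b R‖ₑ ^ 2) t := by
    intro R
    rw [setLIntegral_indicator measurableSet_Iio, setLIntegral_const, Set.inter_comm,
      Set.Ioi_inter_Iio, Real.volume_Ioo, sub_zero, ENNReal.ofReal_toReal (hit R)]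
  have level : ∀ t ∈ Set.Ioi (0 : ℝ),
      ∑ R ∈ S, (Set.Iio (rectInf W R).toReal).indicator (fun _ => ‖b R‖ₑ ^ 2) t ≤
      size e 𝓡 b ^ 2 * volume.restrict (shadow e (S : Set Rect))
        {x | t < (W (inner ℝ e x) (inner ℝ (perp e) x)).toReal} := by
    intro t _
    have e1 : ∑ R ∈ S, (Set.Iio (rectInf W R).toReal).indicator (fun _ => ‖b R‖ₑ ^ 2) t =
        ∑ R ∈ S with t < (rectInf W R).toReal, ‖b R‖ₑ ^ 2 := by
      rw [Finset.sum_filter]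
      refine Finset.sum_congr rfl fun R _ => ?_
      simp [Set.indicator_apply]
    rw [e1]
    refine (sum_enorm_sq_le_size he b hfin (S := S.filter fun R => t < (rectInf W R).toReal)
      (fun R hR => hS (Finset.mem_filter.1 hR).1)).trans ?_
    refine mul_le_mul_right ?_ _
    rw [Measure.restrict_apply (measurableSet_lt measurable_const hWm.ennreal_toReal)]
    refine measure_mono fun x hx => ?_
    obtain ⟨R, hR, hx⟩ := Set.mem_iUnion₂.1 hx
    have hR' := Finset.mem_filter.1 (Finset.mem_coe.1 hR)
    refine ⟨hR'.2.trans_le (ENNReal.toReal_mono (hWt x) (hinf R x hx)), ?_⟩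
    exact Set.mem_biUnion (Finset.mem_coe.2 hR'.1) hx
  have lc := lintegral_eq_lintegral_meas_lt (volume.restrict (shadow e (S : Set Rect)))
    (f := fun x : Plane => (W (inner ℝ e x) (inner ℝ (perp e) x)).toReal)
    (Eventually.of_forall fun _ => ENNReal.toReal_nonneg) hWm.ennreal_toReal.aemeasurable
  simp_rw [ENNReal.ofReal_toReal (hWt _)] at lc
  rw [lc]
  simp_rw [layer]
  rw [← lintegral_finsetSum _ fun R _ => measurable_const.indicator measurableSet_Iio]
  calc _ ≤ ∫⁻ t in Set.Ioi (0 : ℝ), size e 𝓡 b ^ 2 * volume.restrict (shadow e (S : Set Rect))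
        {x | t < (W (inner ℝ e x) (inner ℝ (perp e) x)).toReal} :=
        setLIntegral_mono' measurableSet_Ioi level
    _ = _ := by
        refine lintegral_const_mul _ ?_
        exact Antitone.measurable fun s t hst => measure_mono fun x hx =>
          lt_of_le_of_lt hst hx

/-! ### The `L^p` bound for finite sums of wave packets -/

/-- The finite sum of the wave packets with rectangle in `S`, as a Schwartz function. -/
def packetSum (b : Rect → ℂ) (ψ : Rect → 𝓢(Plane, ℂ)) (S : Finset Rect) : 𝓢(Plane, ℂ) :=
  ∑ R ∈ S, b R • ψ R

theorem packetSum_apply (b : Rect → ℂ) (ψ : Rect → 𝓢(Plane, ℂ)) (S : Finset Rect) (x : Plane) :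
    packetSum b ψ S x = ∑ R ∈ S, b R * ψ R x := by
  simp [packetSum]

/-- The hypotheses of the product John–Nirenberg inequality, with the wave packets described in
the coordinates of the orientation by a single amplitude `a`. -/
structure IsPacketSystem (e : Plane) (a : ℝ) (𝓡 : Set Rect) (b : Rect → ℂ)
    (ψ : Rect → 𝓢(Plane, ℂ)) : Prop where
  norm_eq_one : ‖e‖ = 1
  nonneg : 0 ≤ a
  grid : ∃ 𝓘 𝓙, IsDyadicGrid 𝓘 ∧ IsDyadicGrid 𝓙 ∧ ∀ R ∈ 𝓡, R.I ∈ 𝓘 ∧ R.J ∈ 𝓙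
  packet : ∀ R ∈ 𝓡, IsProdPacket R.I.center R.I.length R.J.center R.J.length
    (a / (√R.I.length * √R.J.length)) fun s t => ψ R (s • e + t • perp e)
  shadow_ne_top : volume (shadow e 𝓡) ≠ ∞
  size_ne_top : size e 𝓡 b ≠ ∞

variable {e : Plane} {a : ℝ} {𝓡 : Set Rect} {b : Rect → ℂ} {ψ : Rect → 𝓢(Plane, ℂ)}

theorem IsPacketSystem.lintegral_sq_mul_le_sum_rectInf (h : IsPacketSystem e a 𝓡 b ψ)
    {S : Finset Rect} (hS : (S : Set Rect) ⊆ 𝓡) {W : ℝ → ℝ → ℝ≥0∞}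
    (hW : Measurable (Function.uncurry W)) {c : ℝ≥0∞} (hc : ∀ x y, W x y ≤ c) (hct : c ≠ ∞)
    {Q : ℝ} (hQ : 1 ≤ Q) (h₁ : ∀ y, IsA1 Q fun x => W x y) (h₂ : ∀ x, IsA1 Q (W x)) :
    ∫⁻ x, ‖packetSum b ψ S x‖ₑ ^ 2 * W (inner ℝ e x) (inner ℝ (perp e) x) ≤
      ENNReal.ofReal (weightedConst * a ^ 2 * Q ^ 4) * ∑ R ∈ S, ‖b R‖ₑ ^ 2 * rectInf W R := by
  obtain ⟨𝓘, 𝓙, h𝓘, h𝓙, hg⟩ := h.grid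
  have hm : Measurable fun x : Plane => ((inner ℝ e x : ℝ), (inner ℝ (perp e) x : ℝ)) := by fun_prop
  have hWm : Measurable fun x : Plane => W (inner ℝ e x) (inner ℝ (perp e) x) := hW.comp hm
  have hFm : Measurable fun x : Plane =>
      ‖packetSum b ψ S x‖ₑ ^ 2 * W (inner ℝ e x) (inner ℝ (perp e) x) :=
    ((packetSum b ψ S).continuous.measurable.enorm.pow_const 2).mul hWm
  rw [lintegral_coords h.norm_eq_one hFm]
  simp_rw [inner_fst_coords h.norm_eq_one, inner_snd_coords h.norm_eq_one, packetSum_apply]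
  exact ProductJN.lintegral_sq_mul_le_sum_rectInf (S := S) h𝓘 h𝓙 (fun R hR => hg R (hS hR))
    (fun R hR => h.packet R (hS hR)) h.nonneg b hW hc hct hQ h₁ h₂

/-- Almost orthogonality of the wave packets: the weighted estimate for the constant weight. -/
theorem IsPacketSystem.lintegral_sq_le_sum (h : IsPacketSystem e a 𝓡 b ψ)
    {S : Finset Rect} (hS : (S : Set Rect) ⊆ 𝓡) :
    ∫⁻ x, ‖packetSum b ψ S x‖ₑ ^ 2 ≤
      ENNReal.ofReal (weightedConst * a ^ 2) * ∑ R ∈ S, ‖b R‖ₑ ^ 2 := by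
  have := h.lintegral_sq_mul_le_sum_rectInf hS (W := fun _ _ => 1) measurable_const
    (fun _ _ => le_rfl) ENNReal.one_ne_top le_rfl (fun _ => isA1_const le_rfl 1)
    (fun _ => isA1_const le_rfl 1)
  simp only [mul_one, one_pow] at this
  refine this.trans (mul_le_mul_right (Finset.sum_le_sum fun R _ => ?_) _)
  refine mul_le_of_le_one_right (by positivity) ?_
  exact (iInf₂_le R.I.left (Set.left_mem_Ico.2 R.I.left_lt_right)).trans
    (iInf₂_le R.J.left (Set.left_mem_Ico.2 R.J.left_lt_right))

/-- The constant in the bound of the squared `L^p` norm. -/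
def sqNormConst (a : ℝ) : ℝ := 2 * weightedConst * a ^ 2 * 80 ^ 4

theorem sqNormConst_nonneg (a : ℝ) : 0 ≤ sqNormConst a := by
  have := weightedConst_nonneg
  unfold sqNormConst; positivity

/-- The bound for `p > 2`. The weight is the Rubio de Francia majorant of `|B|^(p-2)`, whose `A₁`
constant is of order `p`; the fourth power of that constant is what gives the growth `p²` of the
norm. -/
theorem IsPacketSystem.lintegral_rpow_le_of_two_lt (h : IsPacketSystem e a 𝓡 b ψ)
    {S : Finset Rect} (hS : (S : Set Rect) ⊆ 𝓡) {p : ℝ} (hp : 2 < p) :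
    (∫⁻ x, ‖packetSum b ψ S x‖ₑ ^ p) ^ (2 / p) ≤
      ENNReal.ofReal (sqNormConst a * p ^ 4) * size e 𝓡 b ^ 2 * volume (shadow e 𝓡) ^ (2 / p) := by
  have he := h.norm_eq_one
  set g := packetSum b ψ S with hg
  set X := ∫⁻ x, ‖g x‖ₑ ^ p with hX
  have hp0 : 0 < p := by linarith
  have hgm : Measurable fun x => ‖g x‖ₑ := g.continuous.measurable.enorm
  have hXt : X ≠ ∞ := by
    have := lintegral_rpow_enorm_lt_top_of_eLpNorm_lt_top (p := ENNReal.ofReal p) (by simpa using hp0)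
      ENNReal.ofReal_ne_top (g.memLp (ENNReal.ofReal p) volume).2
    rw [ENNReal.toReal_ofReal hp0.le] at this
    exact this.ne
  rcases eq_or_ne X 0 with hX0 | hX0
  · rw [hX0, ENNReal.zero_rpow_of_pos (by positivity)]; positivity
  set w : ℝ → ℝ → ℝ≥0∞ := fun s t => ‖g (s • e + t • perp e)‖ₑ ^ (p - 2) with hw
  have hwm : Measurable (Function.uncurry w) :=
    (hgm.comp (measurePreserving_coords he).measurable).pow_const _
  obtain ⟨M, -, hM⟩ := g.decay 0 0
  have hM' : ∀ x, ‖g x‖ₑ ≤ ENNReal.ofReal M := fun x => by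
    rw [← ofReal_norm]
    exact ENNReal.ofReal_le_ofReal (by simpa using hM x)
  have hwc : ∀ s t, w s t ≤ ENNReal.ofReal M ^ (p - 2) := fun s t =>
    ENNReal.rpow_le_rpow (hM' _) (by linarith)
  have hct : ENNReal.ofReal M ^ (p - 2) ≠ ∞ :=
    ENNReal.rpow_ne_top_of_nonneg (by linarith) ENNReal.ofReal_ne_top
  obtain ⟨q, hq⟩ : ∃ q, q = p / (p - 2) := ⟨_, rfl⟩
  have hp2 : 0 < p - 2 := by linarith
  have hq1 : 1 < q := by rw [hq, one_lt_div hp2]; linarith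
  have hqN : 40 * (q / (q - 1)) = 20 * p := by
    rw [hq]
    have h3 : p / (p - 2) - 1 = 2 / (p - 2) := by field_simp; ring
    rw [h3]; field_simp; ring
  have hWq := lintegral_rdf_rpow_le hwm hwc hct hq1
  rw [hqN] at hWq
  set W := rdf (20 * p) w with hWdef
  have hWm : Measurable (Function.uncurry W) := measurable_rdf _ hwm
  have hWc : ∀ s t, W s t ≤ 2 * ENNReal.ofReal M ^ (p - 2) := rdf_le (by linarith) hwc
  have hWct : 2 * ENNReal.ofReal M ^ (p - 2) ≠ ∞ := ENNReal.mul_ne_top (by simp) hct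
  obtain ⟨hA₁, hA₂⟩ := isA1_rdf (N := 20 * p) (by positivity) hwm
  set V : Plane → ℝ≥0∞ := fun x => W (inner ℝ e x) (inner ℝ (perp e) x) with hV
  have hVm : Measurable V := by
    have hm : Measurable fun x : Plane => ((inner ℝ e x : ℝ), (inner ℝ (perp e) x : ℝ)) := by
      fun_prop
    exact hWm.comp hm
  -- The majorant has the same `L^q` norm as the weight, up to a factor `2`.
  have hVq : ∫⁻ x, V x ^ q ≤ 2 ^ q * X := by
    rw [lintegral_coords he (hVm.pow_const q), hX, lintegral_coords he (hgm.pow_const p)]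
    simp only [hV, inner_fst_coords he, inner_snd_coords he]
    refine hWq.trans (le_of_eq ?_)
    simp only [hw, ← ENNReal.rpow_mul]
    rw [show (p - 2) * q = p by rw [hq]; field_simp]
  have h1 : X ≤ ∫⁻ x, ‖g x‖ₑ ^ 2 * V x := by
    refine lintegral_mono fun x => ?_
    have hle : ‖g x‖ₑ ^ (p - 2) ≤ V x := by
      have := le_rdf (20 * p) w (inner ℝ e x) (inner ℝ (perp e) x)
      simp only [hw] at this
      rwa [coords_inner he] at this
    calc ‖g x‖ₑ ^ p = ‖g x‖ₑ ^ 2 * ‖g x‖ₑ ^ (p - 2) := by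
          rw [← ENNReal.rpow_two, ← ENNReal.rpow_add_of_nonneg _ _ (by norm_num) hp2.le]
          congr 1; ring
      _ ≤ _ := by gcongr
  have h2 : ∫⁻ x, ‖g x‖ₑ ^ 2 * V x ≤ ENNReal.ofReal (weightedConst * a ^ 2 * (4 * (20 * p)) ^ 4) *
      (size e 𝓡 b ^ 2 * ∫⁻ x in shadow e (S : Set Rect), V x) :=
    (h.lintegral_sq_mul_le_sum_rectInf hS hWm hWc hWct (by linarith) hA₁ hA₂).trans
      (mul_le_mul_right (sum_rectInf_le he b h.shadow_ne_top hS hWm hWc hWct) _)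
  have h3 : ∫⁻ x in shadow e (S : Set Rect), V x ≤
      2 * X ^ (1 - 2 / p) * volume (shadow e 𝓡) ^ (2 / p) := by
    have hqi : 1 / q = 1 - 2 / p := by rw [hq]; field_simp
    have hq0 : 0 < q := by linarith
    have hle2 : 2 / p ≤ 1 := by rw [div_le_one hp0]; exact hp.le
    have hH := ENNReal.lintegral_mul_norm_pow_le (μ := volume.restrict (shadow e (S : Set Rect)))
      (f := fun x => V x ^ q) (g := fun _ => 1) (hVm.pow_const q).aemeasurable
      aemeasurable_const (p := 1 - 2 / p) (q := 2 / p) (by linarith) (by positivity) (by ring)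
    simp only [ENNReal.one_rpow, mul_one, ← ENNReal.rpow_mul, ← hqi] at hH
    rw [mul_one_div_cancel hq0.ne'] at hH
    simp only [ENNReal.rpow_one] at hH
    refine hH.trans ?_
    rw [lintegral_one, Measure.restrict_apply_univ]
    have h4 : (∫⁻ x in shadow e (S : Set Rect), V x ^ q) ^ (1 / q) ≤ 2 * X ^ (1 - 2 / p) := by
      calc _ ≤ (2 ^ q * X) ^ (1 / q) :=
            ENNReal.rpow_le_rpow ((setLIntegral_le_lintegral _ _).trans hVq) (by positivity)
        _ = _ := by
            rw [ENNReal.mul_rpow_of_nonneg _ _ (by positivity), ← ENNReal.rpow_mul,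
              mul_one_div_cancel hq0.ne', ENNReal.rpow_one, hqi]
    exact mul_le_mul' h4 (ENNReal.rpow_le_rpow (measure_mono (shadow_mono e hS)) (by positivity))
  -- Cancel the power of `X` on the right.
  have hXs : X = X ^ (2 / p) * X ^ (1 - 2 / p) := by
    rw [← ENNReal.rpow_add _ _ hX0 hXt]; simp
  have hY0 : X ^ (1 - 2 / p) ≠ 0 := by simp [ENNReal.rpow_eq_zero_iff, hX0, hXt]
  have hYt : X ^ (1 - 2 / p) ≠ ∞ := by simp [ENNReal.rpow_eq_top_iff, hX0, hXt]
  rw [← ENNReal.mul_le_mul_iff_left hY0 hYt, ← hXs]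
  calc X ≤ _ := h1.trans h2
    _ ≤ ENNReal.ofReal (weightedConst * a ^ 2 * (4 * (20 * p)) ^ 4) *
      (size e 𝓡 b ^ 2 * (2 * X ^ (1 - 2 / p) * volume (shadow e 𝓡) ^ (2 / p))) := by gcongr
    _ = _ := by
      have : ENNReal.ofReal (sqNormConst a * p ^ 4) =
          2 * ENNReal.ofReal (weightedConst * a ^ 2 * (4 * (20 * p)) ^ 4) := by
        rw [← ENNReal.ofReal_ofNat, ← ENNReal.ofReal_mul (by norm_num)]
        congr 1
        unfold sqNormConst; ring
      rw [this]; ring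

/-- The `L^p` bound for finite sums. -/
theorem IsPacketSystem.lintegral_rpow_le (h : IsPacketSystem e a 𝓡 b ψ)
    {S : Finset Rect} (hS : (S : Set Rect) ⊆ 𝓡) {p : ℝ} (hp : 2 ≤ p) :
    (∫⁻ x, ‖packetSum b ψ S x‖ₑ ^ p) ^ (2 / p) ≤
      ENNReal.ofReal (sqNormConst a * p ^ 4) * size e 𝓡 b ^ 2 * volume (shadow e 𝓡) ^ (2 / p) := by
  rcases hp.eq_or_lt with rfl | hp
  · have h1 := h.lintegral_sq_le_sum hS
    rw [div_self two_ne_zero, ENNReal.rpow_one, ENNReal.rpow_one]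
    simp only [ENNReal.rpow_ofNat]
    have hw := weightedConst_nonneg
    calc _ ≤ _ := h1
      _ ≤ ENNReal.ofReal (weightedConst * a ^ 2) * (size e 𝓡 b ^ 2 * volume (shadow e 𝓡)) := by
          refine mul_le_mul_right ((sum_enorm_sq_le_size h.norm_eq_one b h.shadow_ne_top hS).trans
            (mul_le_mul_right (measure_mono (shadow_mono e hS)) _)) _
      _ ≤ _ := by
          rw [mul_assoc]
          refine mul_le_mul_left (ENNReal.ofReal_le_ofReal ?_) _
          unfold sqNormConst
          nlinarith [mul_nonneg hw (sq_nonneg a)]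
  · exact h.lintegral_rpow_le_of_two_lt hS hp

/-- The constant in the bound of the `L^p` norm. -/
def normConst (a : ℝ) : ℝ := √(sqNormConst a)

theorem eLpNorm_ofReal {f : Plane → ℂ} {p : ℝ} (hp : 0 < p) :
    eLpNorm f (ENNReal.ofReal p) volume = (∫⁻ x, ‖f x‖ₑ ^ p) ^ (1 / p) := by
  rw [eLpNorm_eq_lintegral_rpow_enorm_toReal (by simpa using hp) ENNReal.ofReal_ne_top,
    ENNReal.toReal_ofReal hp.le]

theorem IsPacketSystem.eLpNorm_le (h : IsPacketSystem e a 𝓡 b ψ)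
    {S : Finset Rect} (hS : (S : Set Rect) ⊆ 𝓡) {p : ℝ} (hp : 2 ≤ p) :
    eLpNorm (packetSum b ψ S) (ENNReal.ofReal p) volume ≤
      ENNReal.ofReal (normConst a * p ^ 2) * size e 𝓡 b * volume (shadow e 𝓡) ^ (1 / p) := by
  have hp0 : 0 < p := by linarith
  have h1 : ∀ x : ℝ≥0∞, x ^ (2 / p) = (x ^ (1 / p)) ^ 2 := fun x => by
    rw [← ENNReal.rpow_two, ← ENNReal.rpow_mul]; congr 1; ring
  rw [eLpNorm_ofReal hp0, ← ENNReal.pow_le_pow_left_iff two_ne_zero, ← h1]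
  refine (h.lintegral_rpow_le hS hp).trans (le_of_eq ?_)
  rw [h1, mul_pow, mul_pow, ← ENNReal.ofReal_pow (by unfold normConst; positivity), mul_pow, normConst,
    Real.sq_sqrt (sqNormConst_nonneg a)]
  ring_nf

/-! ### Unconditional convergence -/

/-- Fatou's lemma for functions that converge in `L²` along an arbitrary filter. -/
theorem eLpNorm_sub_le_of_tendsto {ι : Type*} {l : Filter ι} [NeBot l] {g : ι → Plane → ℂ}
    {f k : Plane → ℂ} (hg : ∀ i, AEStronglyMeasurable (g i) volume)
    (hf : AEStronglyMeasurable f volume) (hk : AEStronglyMeasurable k volume)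
    (hlim : Tendsto (fun i => eLpNorm (g i - f) 2 volume) l (𝓝 0)) {p M : ℝ≥0∞}
    (hM : ∀ᶠ i in l, eLpNorm (g i - k) p volume ≤ M) : eLpNorm (f - k) p volume ≤ M := by
  have ex : ∀ n : ℕ, ∃ i, eLpNorm (g i - f) 2 volume ≤ (n : ℝ≥0∞)⁻¹ ∧
      eLpNorm (g i - k) p volume ≤ M := fun n =>
    (((ENNReal.tendsto_nhds_zero.1 hlim) _ (by simp)).and hM).exists
  choose i hi using ex
  refine eLpNorm_le_of_tendstoInMeasure (u := atTop) (f := fun n => g (i n) - k)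
    (Eventually.of_forall fun n => (hi n).2) ?_ fun n => (hg _).sub hk
  refine tendstoInMeasure_of_tendsto_eLpNorm (p := 2) two_ne_zero (fun n => (hg _).sub hk)
    (hf.sub hk) ?_
  simp only [sub_sub_sub_cancel_right]
  exact tendsto_of_tendsto_of_tendsto_of_le_of_le tendsto_const_nhds
    ENNReal.tendsto_inv_nat_nhds_zero (fun _ => by positivity) fun n => (hi n).1

/-- The partial sum over a finite set of indices in the subtype `𝓡`. -/
def partialSum (b : Rect → ℂ) (ψ : Rect → 𝓢(Plane, ℂ)) (F : Finset 𝓡) : 𝓢(Plane, ℂ) :=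
  packetSum b ψ (F.map (Function.Embedding.subtype _))

theorem partialSum_apply (F : Finset 𝓡) (x : Plane) :
    partialSum b ψ F x = ∑ R ∈ F, b R * ψ R x := by
  rw [partialSum, packetSum_apply, Finset.sum_map]; rfl

theorem coe_map_subtype_subset (F : Finset 𝓡) :
    ((F.map (Function.Embedding.subtype _) : Finset Rect) : Set Rect) ⊆ 𝓡 := by
  intro R hR
  obtain ⟨R', -, rfl⟩ := Finset.mem_map.1 (Finset.mem_coe.1 hR)
  exact R'.2

theorem IsPacketSystem.tsum_enorm_sq_ne_top (h : IsPacketSystem e a 𝓡 b ψ) :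
    ∑' R : 𝓡, ‖b R‖ₑ ^ 2 ≠ ∞ := by
  refine ne_top_of_le_ne_top (ENNReal.mul_ne_top (ENNReal.pow_ne_top h.size_ne_top (n := 2))
    h.shadow_ne_top) ?_
  rw [ENNReal.tsum_eq_iSup_sum]
  refine iSup_le fun F => ?_
  have h1 := sum_enorm_sq_le_size h.norm_eq_one b h.shadow_ne_top (coe_map_subtype_subset F)
  rw [Finset.sum_map] at h1
  exact h1.trans (mul_le_mul_right (measure_mono (shadow_mono e (coe_map_subtype_subset F))) _)

/-- Cauchy's criterion in `L^p`: interpolate between the smallness of the tails in `L²` and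
their boundedness in `L^(2p-2)`. -/
theorem IsPacketSystem.exists_tail_bound (h : IsPacketSystem e a 𝓡 b ψ) {p : ℝ} (hp : 2 ≤ p) :
    ∃ ρ : Finset 𝓡 → ℝ≥0∞, Tendsto ρ atTop (𝓝 0) ∧ ∀ F₀ F : Finset 𝓡, Disjoint F F₀ →
      eLpNorm (partialSum b ψ F) (ENNReal.ofReal p) volume ≤ ρ F₀ := by
  classical
  have hp0 : 0 < p := by linarith
  obtain ⟨D, hD⟩ : ∃ D, D = ENNReal.ofReal (sqNormConst a * (2 * p - 2) ^ 4) * size e 𝓡 b ^ 2 *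
    volume (shadow e 𝓡) ^ (2 / (2 * p - 2)) := ⟨_, rfl⟩
  have hDt : D ≠ ∞ := by
    rw [hD]
    exact ENNReal.mul_ne_top (ENNReal.mul_ne_top ENNReal.ofReal_ne_top
      (ENNReal.pow_ne_top h.size_ne_top)) (ENNReal.rpow_ne_top_of_nonneg
        (div_nonneg (by norm_num) (by linarith)) h.shadow_ne_top)
  have hDp : D ^ ((p - 1) * (1 / 2)) ≠ ∞ :=
    ENNReal.rpow_ne_top_of_nonneg (mul_nonneg (by linarith) (by norm_num)) hDt
  refine ⟨fun F₀ => ((ENNReal.ofReal (weightedConst * a ^ 2) *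
    ∑' R : {R : 𝓡 // R ∉ F₀}, ‖b R‖ₑ ^ 2) ^ (1 / 2 : ℝ) * D ^ ((p - 1) * (1 / 2))) ^ (1 / p),
    ?_, fun F₀ F hF => ?_⟩
  · have h0 := ENNReal.tendsto_tsum_compl_atTop_zero h.tsum_enorm_sq_ne_top
    have h1 := ENNReal.Tendsto.const_mul (a := ENNReal.ofReal (weightedConst * a ^ 2)) h0
      (Or.inr ENNReal.ofReal_ne_top)
    have h2 := ENNReal.Tendsto.mul_const (b := D ^ ((p - 1) * (1 / 2)))
      (h1.ennrpow_const (1 / 2 : ℝ)) (Or.inr hDp)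
    have h3 := h2.ennrpow_const (1 / p)
    have e0 : (((ENNReal.ofReal (weightedConst * a ^ 2)) * 0) ^ (1 / 2 : ℝ) *
        D ^ ((p - 1) * (1 / 2))) ^ (1 / p) = 0 := by
      rw [mul_zero, ENNReal.zero_rpow_of_pos (by norm_num), zero_mul,
        ENNReal.zero_rpow_of_pos (by positivity)]
    rwa [e0] at h3
  · rw [eLpNorm_ofReal hp0]
    refine ENNReal.rpow_le_rpow ?_ (by positivity)
    have hgm : Measurable fun x => ‖partialSum b ψ F x‖ₑ :=
      (partialSum b ψ F).continuous.measurable.enorm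
    have hH := ENNReal.lintegral_mul_norm_pow_le (μ := volume)
      (f := fun x => ‖partialSum b ψ F x‖ₑ ^ 2) (g := fun x => ‖partialSum b ψ F x‖ₑ ^ (2 * p - 2))
      (hgm.pow_const 2).aemeasurable (hgm.pow_const _).aemeasurable
      (p := 1 / 2) (q := 1 / 2) (by norm_num) (by norm_num) (by norm_num)
    have e1 : ∀ z : ℝ≥0∞, (z ^ 2) ^ (1 / 2 : ℝ) * (z ^ (2 * p - 2)) ^ (1 / 2 : ℝ) = z ^ p := by
      intro z
      rw [← ENNReal.rpow_two, ← ENNReal.rpow_mul, ← ENNReal.rpow_mul,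
        ← ENNReal.rpow_add_of_nonneg _ _ (by norm_num) (by linarith)]
      congr 1; ring
    simp only [e1] at hH
    refine hH.trans (mul_le_mul' (ENNReal.rpow_le_rpow ?_ (by norm_num)) ?_)
    · refine (h.lintegral_sq_le_sum (coe_map_subtype_subset F)).trans (mul_le_mul_right ?_ _)
      rw [Finset.sum_map]
      have hF' : ∀ R ∈ F, R ∉ F₀ := fun R hR => Finset.disjoint_left.1 hF hR
      exact (Finset.sum_subtype_of_mem (fun R : 𝓡 => ‖b R‖ₑ ^ 2) hF').symm.le.trans
        (ENNReal.sum_le_tsum _)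
    · have h1 := h.lintegral_rpow_le (coe_map_subtype_subset F) (p := 2 * p - 2) (by linarith)
      rw [← hD] at h1
      have h2 := ENNReal.rpow_le_rpow h1 (z := (p - 1) * (1 / 2))
        (mul_nonneg (by linarith) (by norm_num))
      refine le_trans (le_of_eq ?_) h2
      rw [← ENNReal.rpow_mul]
      congr 1
      have : p - 1 ≠ 0 := by linarith
      rw [show 2 * p - 2 = 2 * (p - 1) by ring]
      field_simp

theorem partialSum_sub {F F' : Finset 𝓡} [DecidableEq 𝓡] (hF : F ⊆ F') :
    (partialSum b ψ F' : Plane → ℂ) - partialSum b ψ F = partialSum b ψ (F' \ F) := by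
  ext x
  rw [Pi.sub_apply, partialSum_apply, partialSum_apply, partialSum_apply, sub_eq_iff_eq_add,
    Finset.sum_sdiff hF]

theorem IsPacketSystem.exists_tendsto_two (h : IsPacketSystem e a 𝓡 b ψ) :
    ∃ B : Plane → ℂ, AEStronglyMeasurable B volume ∧
      Tendsto (fun F : Finset 𝓡 => eLpNorm (⇑(partialSum b ψ F) - B) 2 volume) atTop (𝓝 0) := by
  obtain ⟨ρ, hρ, hle⟩ := h.exists_tail_bound le_rfl
  rw [ENNReal.ofReal_ofNat] at hle
  have hcoe : ∀ F : Finset 𝓡, ⇑(∑ R ∈ F, b R • (ψ R).toLp 2 volume) =ᵐ[volume]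
      ⇑(partialSum b ψ F) := by
    intro F
    have : ∑ R ∈ F, b R • (ψ R).toLp 2 volume = (partialSum b ψ F).toLp 2 volume := by
      have hl : ∀ g : 𝓢(Plane, ℂ), g.toLp 2 volume =
          SchwartzMap.toLpCLM ℂ ℂ 2 volume g := fun g => rfl
      simp only [hl, partialSum, packetSum, Finset.sum_map, map_sum, map_smul]
      rfl
    rw [this]
    exact SchwartzMap.coeFn_toLp _ 2 volume
  have hs : Summable fun R : 𝓡 => b R • (ψ R).toLp 2 volume := by
    rw [summable_iff_vanishing_norm]
    intro ε hε
    obtain ⟨F₀, hF₀⟩ := ((tendsto_order.1 hρ).2 (ENNReal.ofReal ε) (by simpa using hε)).exists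
    refine ⟨F₀, fun F hF => ?_⟩
    rw [Lp.norm_def, eLpNorm_congr_ae (hcoe F)]
    exact (ENNReal.lt_ofReal_iff_toReal_lt (ne_top_of_lt ((hle F₀ F hF).trans_lt hF₀))).1
      ((hle F₀ F hF).trans_lt hF₀)
  obtain ⟨u, hu⟩ := hs
  refine ⟨u, Lp.aestronglyMeasurable u, ?_⟩
  have h1 := (Lp.tendsto_Lp_iff_tendsto_eLpNorm' _ _).1 hu
  refine h1.congr fun F => eLpNorm_congr_ae ?_
  exact (hcoe F).sub EventuallyEq.rfl

theorem IsPacketSystem.exists_isLpSum (h : IsPacketSystem e a 𝓡 b ψ) :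
    ∃ B : Plane → ℂ, ∀ p : ℝ, 2 ≤ p → IsLpSum (ENNReal.ofReal p) 𝓡 b ψ B ∧
      eLpNorm B (ENNReal.ofReal p) volume ≤
        ENNReal.ofReal (normConst a * p ^ 2) * size e 𝓡 b * volume (shadow e 𝓡) ^ (1 / p) := by
  classical
  obtain ⟨B, hBm, hB⟩ := h.exists_tendsto_two
  refine ⟨B, fun p hp => ?_⟩
  have hgm : ∀ F : Finset 𝓡, AEStronglyMeasurable (partialSum b ψ F) volume := fun F =>
    (partialSum b ψ F).continuous.aestronglyMeasurable
  have hle : eLpNorm B (ENNReal.ofReal p) volume ≤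
      ENNReal.ofReal (normConst a * p ^ 2) * size e 𝓡 b * volume (shadow e 𝓡) ^ (1 / p) := by
    have := eLpNorm_sub_le_of_tendsto hgm hBm (k := 0) aestronglyMeasurable_zero hB
      (Eventually.of_forall fun F => by
        rw [sub_zero]; exact h.eLpNorm_le (coe_map_subtype_subset F) hp)
    rwa [sub_zero] at this
  refine ⟨⟨⟨hBm, hle.trans_lt (Ne.lt_top ?_)⟩, ?_⟩, hle⟩
  · exact ENNReal.mul_ne_top (ENNReal.mul_ne_top ENNReal.ofReal_ne_top h.size_ne_top)
      (ENNReal.rpow_ne_top_of_nonneg (by positivity) h.shadow_ne_top)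
  obtain ⟨ρ, hρ, hρle⟩ := h.exists_tail_bound hp
  refine tendsto_of_tendsto_of_tendsto_of_le_of_le tendsto_const_nhds hρ
    (fun _ => by positivity) fun F => ?_
  have := eLpNorm_sub_le_of_tendsto hgm hBm (hgm F) hB (p := ENNReal.ofReal p) (M := ρ F) (by
    filter_upwards [eventually_ge_atTop F] with F' hF'
    rw [partialSum_sub hF']
    exact hρle F _ Finset.sdiff_disjoint)
  refine le_trans (le_of_eq ?_) this
  congr 1
  ext x
  rw [Pi.sub_apply, partialSum_apply]

/-! ### The exponential estimate -/

/-- If `‖f‖_p ≤ C p² s v^(1/p)` for all `p ≥ 2`, then the distribution function of `f` decays like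
`exp(-c √(l/s))`: Chebyshev's inequality with `p = √(l / (e C s))`. -/
theorem measure_lt_le_of_eLpNorm_le {f : Plane → ℂ} (hf : AEStronglyMeasurable f volume)
    {C : ℝ} (hC : Real.exp 2 ≤ C) {s v : ℝ≥0∞} (hs : s ≠ ∞)
    (h : ∀ p : ℝ, 2 ≤ p →
      eLpNorm f (ENNReal.ofReal p) volume ≤ ENNReal.ofReal (C * p ^ 2) * s * v ^ (1 / p))
    {E : Set Plane} (hE : volume E ≤ v) {l : ℝ} (hl : 0 < l) :
    volume {x ∈ E | l < ‖f x‖} ≤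
      ENNReal.ofReal (C * Real.exp (-(√(Real.exp 1 * C))⁻¹ * √(l / s.toReal))) * v := by
  have hC0 : 0 < C := (Real.exp_pos 2).trans_le hC
  obtain ⟨p, hp⟩ : ∃ p, p = (√(Real.exp 1 * C))⁻¹ * √(l / s.toReal) := ⟨_, rfl⟩
  rw [neg_mul, ← hp]
  rcases lt_or_ge p 2 with h2 | h2
  · have h1 : 1 ≤ C * Real.exp (-p) := by
      calc (1 : ℝ) = Real.exp 2 * Real.exp (-2) := by rw [← Real.exp_add]; simp
        _ ≤ C * Real.exp (-p) := by gcongr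
    calc _ ≤ volume E := measure_mono (Set.sep_subset _ _)
      _ ≤ v := hE
      _ ≤ _ := le_mul_of_one_le_left (by positivity) (by simpa using h1)
  have hp0 : 0 < p := by linarith
  have hs0 : 0 < s.toReal := by
    refine lt_of_le_of_ne ENNReal.toReal_nonneg fun h0 => ?_
    rw [← h0, div_zero, Real.sqrt_zero, mul_zero] at hp
    linarith
  -- By the choice of `p`, the factor `C p² s / l` is `1 / e`.
  have hpl : C * p ^ 2 * s.toReal = l * Real.exp (-1) := by
    rw [hp, mul_pow, inv_pow, Real.sq_sqrt (by positivity), Real.sq_sqrt (by positivity),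
      Real.exp_neg]
    field_simp
  have hch := meas_ge_le_mul_pow_eLpNorm_enorm volume (p := ENNReal.ofReal p) (by simpa using hp0)
    ENNReal.ofReal_ne_top hf (ε := ENNReal.ofReal l) (by simpa using hl) (by simp)
  rw [ENNReal.toReal_ofReal hp0.le] at hch
  calc volume {x ∈ E | l < ‖f x‖} ≤ volume {x | ENNReal.ofReal l ≤ ‖f x‖ₑ} := by
        refine measure_mono fun x hx => ?_
        rw [Set.mem_ofPred_eq, ← ofReal_norm]
        exact ENNReal.ofReal_le_ofReal hx.2.le
    _ ≤ _ := hch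
    _ ≤ (ENNReal.ofReal l)⁻¹ ^ p * (ENNReal.ofReal (C * p ^ 2) * s * v ^ (1 / p)) ^ p := by
        gcongr; exact h p h2
    _ = ENNReal.ofReal (Real.exp (-p)) * v := by
        rw [← ENNReal.mul_rpow_of_nonneg _ _ hp0.le, ← mul_assoc,
          ENNReal.mul_rpow_of_nonneg _ _ hp0.le, ← ENNReal.rpow_mul, one_div_mul_cancel hp0.ne',
          ENNReal.rpow_one]
        congr 1
        nth_rewrite 1 [← ENNReal.ofReal_toReal hs]
        rw [← ENNReal.ofReal_mul (by positivity), hpl, ENNReal.ofReal_mul hl.le, ← mul_assoc,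
          ENNReal.inv_mul_cancel (by simpa using hl) ENNReal.ofReal_ne_top, one_mul,
          ENNReal.ofReal_rpow_of_pos (Real.exp_pos _), ← Real.exp_mul, neg_one_mul]
    _ ≤ _ := by
        refine mul_le_mul_left (ENNReal.ofReal_le_ofReal ?_) _
        have : (1 : ℝ) ≤ C := (Real.one_le_exp (by norm_num)).trans hC
        exact le_mul_of_one_le_left (Real.exp_pos _).le this

end ProductJN

end

/-- Product John-Nirenberg inequality. The `L^p` bound holds with or without the assumption that
each `ψ R` is supported in `R`; the exponential bound is under that assumption (which, `ψ R` being
continuous, is the same for the closed support and the closed rectangle). -/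
theorem mainTheorem5 :
    ∃ K₀ : ℝ, ∀ K : ℝ, K₀ ≤ K → ∀ A : ℕ → ℕ → ℝ,
      ∃ C c : ℝ, 0 < C ∧ 0 < c ∧
        ∀ (e : ProductJN.Plane), ‖e‖ = 1 →
        ∀ (𝓘 𝓙 : Set ProductJN.HalfOpenInterval),
          ProductJN.IsDyadicGrid 𝓘 → ProductJN.IsDyadicGrid 𝓙 →
        ∀ (𝓡 : Set ProductJN.Rect), (∀ R ∈ 𝓡, R.I ∈ 𝓘 ∧ R.J ∈ 𝓙) →
        ∀ (ψ : ProductJN.Rect → 𝓢(ProductJN.Plane, ℂ)),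
          ProductJN.AreProductWavePackets e K A 𝓡 ψ →
        ∀ (b : ProductJN.Rect → ℂ),
          volume (ProductJN.shadow e 𝓡) ≠ ∞ → ProductJN.size e 𝓡 b ≠ ∞ →
          ∃ B : ProductJN.Plane → ℂ,
            (∀ p : ℝ, 2 ≤ p →
              ProductJN.IsLpSum (ENNReal.ofReal p) 𝓡 b ψ B ∧
              eLpNorm B (ENNReal.ofReal p) volume ≤
                ENNReal.ofReal (C * p ^ 2) * ProductJN.size e 𝓡 b *
                  volume (ProductJN.shadow e 𝓡) ^ (1 / p)) ∧
            ((∀ R ∈ 𝓡, Function.support (ψ R) ⊆ R.toSet e) →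
              ∀ l : ℝ, 0 < l →
                volume {x ∈ ProductJN.shadow e 𝓡 | l < ‖B x‖} ≤
                  ENNReal.ofReal
                      (C * Real.exp (-c * Real.sqrt (l / (ProductJN.size e 𝓡 b).toReal))) *
                    volume (ProductJN.shadow e 𝓡)) := by
  refine ⟨14, fun K hK A => ?_⟩
  set a := 2 ^ 14 * ProductJN.adaptConst A with ha
  have hC : Real.exp 2 ≤ ProductJN.normConst a + Real.exp 2 :=
    le_add_of_nonneg_left (Real.sqrt_nonneg _)
  have hC0 := (Real.exp_pos 2).trans_le hC
  refine ⟨ProductJN.normConst a + Real.exp 2,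
    (√(Real.exp 1 * (ProductJN.normConst a + Real.exp 2)))⁻¹, hC0,
    inv_pos.2 (Real.sqrt_pos.2 (mul_pos (Real.exp_pos 1) hC0)), ?_⟩
  intro e he 𝓘 𝓙 h𝓘 h𝓙 𝓡 hg ψ hψ b hfin hsize
  have hsys : ProductJN.IsPacketSystem e a 𝓡 b ψ :=
    { norm_eq_one := he
      nonneg := mul_nonneg (by norm_num) (ProductJN.adaptConst_nonneg A)
      grid := ⟨𝓘, 𝓙, h𝓘, h𝓙, hg⟩
      packet := fun R hR => ProductJN.isProdPacket_coords (hψ R hR).1 hK (hψ R hR).2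
      shadow_ne_top := hfin
      size_ne_top := hsize }
  obtain ⟨B, hB⟩ := hsys.exists_isLpSum
  have hB' : ∀ p : ℝ, 2 ≤ p → eLpNorm B (ENNReal.ofReal p) volume ≤
      ENNReal.ofReal ((ProductJN.normConst a + Real.exp 2) * p ^ 2) * ProductJN.size e 𝓡 b *
        volume (ProductJN.shadow e 𝓡) ^ (1 / p) := fun p hp => by
    refine (hB p hp).2.trans (mul_le_mul_left (mul_le_mul_left (ENNReal.ofReal_le_ofReal ?_) _) _)
    exact mul_le_mul_of_nonneg_right (le_add_of_nonneg_right (Real.exp_pos 2).le) (sq_nonneg p)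
  refine ⟨B, fun p hp => ⟨(hB p hp).1, hB' p hp⟩, fun _ l hl => ?_⟩
  exact ProductJN.measure_lt_le_of_eLpNorm_le (hB 2 le_rfl).1.1.1 hC hsize hB' le_rfl hl
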